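/- All graphs are finite, undirected, without loops or parallel edges; $v(G)$ is the number of vertices of $G$. Let $\Lambda$ be the 3-vertex path. A $\Lambda$-packing of $G$ is a subgraph of $G$ all of whose components are isomorphic to $\Lambda$; it is a $\Lambda$-factor if it contains every vertex of $G$; $\lambda(G)$ is the maximum number of components of a $\Lambda$-packing of $G$ (the maximum number of disjoint 3-vertex paths). Let $\mathcal{CBP}$ be the class of graphs that are 2-connected, cubic, bipartite and planar. Operations. Let $A$ and $B$ be disjoint graphs. (i) For $a\in V(A)$, $b\in V(B)$ and a bijection $\sigma:N(a,A)\to N(b,B)$, let $Aa\sigma bB$ be $(A-a)\cup(B-b)$ together with the edges $x\sigma(x)$, $x\in N(a,A)$. (ii) For edges $a=a_1a_2$ of $A$ and $b=b_1b_2$ of $B$, let $AabB$ be $(A-a)\cup(B-b)$ (edges deleted) together with the edges $a_1b_1$, $a_2b_2$. (iii) Let $Aa|bB$ be obtained from $AabB$ by replacing each edge $a_ib_i$ by a path $a_iz_ib_i$ with a new vertex $z_i$ ($i=1,2$), and adding the middle edge $z_1z_2$. Construction from a class $\mathcal B$ of ingredient graphs. (1) $K=Aa|bB$ with middle edge $z$,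 where $A,B\in\mathcal B$, $v(A)\equiv v(B)\equiv 2 \pmod 6$, $a\in E(A)$, $b\in E(B)$. (2) $H=Kk\sigma sS$, where $K$ is from (1) with middle edge $kk_1$, $N(k,K)=\{k_1,k_2,k_3\}$, $S\in\mathcal B$, $v(S)\equiv 0\pmod 6$, $s\in V(S)$, and $\sigma:N(k,K)\to N(s,S)$ is a bijection. Put $h=k_3\sigma(k_3)$ and $x=\sigma(k_2)$. (3) $D=KzhH$, where $K$ is from (1) with middle edge $z$, and $H$, $h$, $x$ are from (2). (4) $F=QqdD$, where $Q\in\mathcal B$, $v(Q)\equiv 2\pmod 6$, $q=q_1q_2\in E(Q)$, $D$ is from (3), $d=xy\in E(D)$, and the new edges are $q_1x$ and $f=q_2y$. (5) $N=KzfF$, where $K$ is from (1) with middle edge $z$, and $F$, $f$ are from (4). (The graphs $K$ used in different steps may be different.) Theorem. (a) There are infinitely many graphs $G\in\mathcal{CBP}$ (of infinitely many different orders) with $v(G)\equiv 0\pmod 6$ that have no $\Lambda$-factor. Moreover, they can be taken to be graphs $N$ obtained by the construction (1)–(5) with ingredients from $\mathcal{CBP}$, and to belong to the smallest isomorphism-closed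 class of graphs that contains the cube and the six-prism and is closed under the operations (i)–(iii). (b) Every $G\in\mathcal{CBP}$ with $v(G)\equiv 0\pmod 6$ and without a $\Lambda$-factor satisfies $\lambda(G)<\lfloor v(G)/3\rfloor$. Hence it is not true that $\lambda(G)=\lfloor v(G)/3\rfloor$ for every 2-connected, cubic, bipartite and planar graph $G$. (c) With all ingredients being cubes and six-prisms (so that every graph $K$ in (1) is glued from two cubes and has 18 vertices), the construction gives a graph $N\in\mathcal{CBP}$ with $v(N)=72$ and without a $\Lambda$-factor; and 72 is the smallest number of vertices of a graph $G\in\mathcal{CBP}$ with $v(G)\equiv 0\pmod 6$ that has no $\Lambda$-factor and is obtained by the construction (1)–(5) with ingredients from $\mathcal{CBP}$. -/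

import Mathlib

namespace LambdaPacking

/-! Packings and factors -/

/-- An `H`-packing of `G`: a subgraph of `G` all of whose components are isomorphic to `H`. -/
def IsPacking {U V : Type} (H : SimpleGraph U) (G : SimpleGraph V) (P : G.Subgraph) : Prop :=
  ∀ c : P.coe.ConnectedComponent, Nonempty (c.toSimpleGraph ≃g H)

/-- The graph `Λ`, a 3-vertex path. -/
abbrev Lam : SimpleGraph (Fin 3) := SimpleGraph.pathGraph 3

/-- `G` has a `Λ`-factor: a `Λ`-packing that contains every vertex of `G`. -/
def HasLambdaFactor {V : Type} (G : SimpleGraph V) : Prop :=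
  ∃ P : G.Subgraph, IsPacking Lam G P ∧ P.IsSpanning

/-- `λ(G)`, for a finite graph `G`: the maximum number of disjoint 3-vertex paths in `G`,
that is, the maximum number of components of a `Λ`-packing of `G`. -/
noncomputable def lambda {V : Type} (G : SimpleGraph V) : ℕ :=
  sSup {k : ℕ | ∃ P : G.Subgraph, IsPacking Lam G P ∧ Nat.card P.coe.ConnectedComponent = k}

/-! Cubic, bipartite, planar, 2-connected graphs -/

/-- `G` is 2-connected: it has more than two vertices, it is connected, and it remains connected
after the deletion of any one vertex. -/
def IsTwoConnected {V : Type} (G : SimpleGraph V) : Prop :=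
  3 ≤ Nat.card V ∧ G.Connected ∧ ∀ v : V, (G.induce {w : V | w ≠ v}).Connected

/-- Every vertex of `G` has exactly three neighbours. -/
def IsCubic {V : Type} (G : SimpleGraph V) : Prop :=
  ∀ v : V, (G.neighborSet v).ncard = 3

/-- `G` has a drawing in the plane: vertices are distinct points `pt v`, the edge `uv` is a simple
arc from `pt u` to `pt v`, an arc contains no vertex other than its ends, and two arcs
meet only in common ends. -/
def IsPlanar {V : Type} (G : SimpleGraph V) : Prop :=
  ∃ (pt : V → ℝ × ℝ) (arc : Sym2 V → Set (ℝ × ℝ)),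
    Function.Injective pt ∧
    (∀ u v : V, G.Adj u v →
      ∃ γ : Path (pt u) (pt v), Function.Injective γ ∧ Set.range γ = arc s(u, v)) ∧
    (∀ e ∈ G.edgeSet, ∀ w : V, pt w ∈ arc e → w ∈ e) ∧
    (∀ e ∈ G.edgeSet, ∀ f ∈ G.edgeSet, e ≠ f →
      arc e ∩ arc f ⊆ pt '' {w : V | w ∈ e ∧ w ∈ f})

/-- The class of finite cubic, bipartite, planar, 2-connected (simple) graphs. -/
structure IsCBP {V : Type} (G : SimpleGraph V) : Prop where
  finite : Finite V
  twoConnected : IsTwoConnected G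
  cubic : IsCubic G
  bipartite : G.IsBipartite
  planar : IsPlanar G

/-! The three gluing operations -/

/-- The graph `A a σ b B`: the disjoint union of `A - a` and `B - b` together with the edges
`x σ(x)` for `x` in the neighbourhood of `a`. -/
def glueVertex {V W : Type} (A : SimpleGraph V) (a : V) (B : SimpleGraph W) (b : W)
    (σ : A.neighborSet a ≃ B.neighborSet b) : SimpleGraph ({x : V // x ≠ a} ⊕ {y : W // y ≠ b}) where
  Adj p q :=
    match p, q with
    | Sum.inl x, Sum.inl y => A.Adj x y
    | Sum.inr x, Sum.inr y => B.Adj x y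
    | Sum.inl x, Sum.inr y => ∃ h : A.Adj a x, (σ ⟨x, h⟩ : W) = y
    | Sum.inr y, Sum.inl x => ∃ h : A.Adj a x, (σ ⟨x, h⟩ : W) = y
  symm := ⟨by
    rintro (x | x) (y | y) h
    · exact SimpleGraph.Adj.symm (G := A) h
    · exact h
    · exact h
    · exact SimpleGraph.Adj.symm (G := B) h⟩
  loopless := ⟨by
    rintro (x | x) h
    · exact A.loopless.irrefl _ h
    · exact B.loopless.irrefl _ h⟩

/-- The graph `A a b B` for edges `a = a₁a₂` and `b = b₁b₂`: the edges `a` and `b` are deleted from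
the disjoint union of `A` and `B`, and the edges `a₁b₁` and `a₂b₂` are added. -/
def glueEdge {V W : Type} (A : SimpleGraph V) (a₁ a₂ : V) (B : SimpleGraph W) (b₁ b₂ : W) :
    SimpleGraph (V ⊕ W) where
  Adj p q :=
    match p, q with
    | Sum.inl x, Sum.inl y => A.Adj x y ∧ s(x, y) ≠ s(a₁, a₂)
    | Sum.inr x, Sum.inr y => B.Adj x y ∧ s(x, y) ≠ s(b₁, b₂)
    | Sum.inl x, Sum.inr y => (x = a₁ ∧ y = b₁) ∨ (x = a₂ ∧ y = b₂)
    | Sum.inr y, Sum.inl x => (x = a₁ ∧ y = b₁) ∨ (x = a₂ ∧ y = b₂)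
  symm := ⟨by
    rintro (x | x) (y | y) h
    · exact ⟨h.1.symm, by rw [Sym2.eq_swap]; exact h.2⟩
    · exact h
    · exact h
    · exact ⟨h.1.symm, by rw [Sym2.eq_swap]; exact h.2⟩⟩
  loopless := ⟨by
    rintro (x | x) h
    · exact A.loopless.irrefl _ h.1
    · exact B.loopless.irrefl _ h.1⟩

/-- The graph `A a|b B` for edges `a = a₁a₂` and `b = b₁b₂`: in `A a b B` each edge `aᵢbᵢ` is
replaced by a 3-vertex path `aᵢ zᵢ bᵢ`, and the middle edge `z₁z₂` is added. Here `z₁` and `z₂` are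
the elements `0` and `1` of the last summand. -/
def glueMiddle {V W : Type} (A : SimpleGraph V) (a₁ a₂ : V) (B : SimpleGraph W) (b₁ b₂ : W) :
    SimpleGraph (V ⊕ (W ⊕ Fin 2)) where
  Adj p q :=
    match p, q with
    | Sum.inl x, Sum.inl y => A.Adj x y ∧ s(x, y) ≠ s(a₁, a₂)
    | Sum.inr (Sum.inl x), Sum.inr (Sum.inl y) => B.Adj x y ∧ s(x, y) ≠ s(b₁, b₂)
    | Sum.inr (Sum.inr i), Sum.inr (Sum.inr j) => i ≠ j
    | Sum.inl _, Sum.inr (Sum.inl _) => False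
    | Sum.inr (Sum.inl _), Sum.inl _ => False
    | Sum.inl x, Sum.inr (Sum.inr i) => (x = a₁ ∧ i = 0) ∨ (x = a₂ ∧ i = 1)
    | Sum.inr (Sum.inr i), Sum.inl x => (x = a₁ ∧ i = 0) ∨ (x = a₂ ∧ i = 1)
    | Sum.inr (Sum.inl y), Sum.inr (Sum.inr i) => (y = b₁ ∧ i = 0) ∨ (y = b₂ ∧ i = 1)
    | Sum.inr (Sum.inr i), Sum.inr (Sum.inl y) => (y = b₁ ∧ i = 0) ∨ (y = b₂ ∧ i = 1)
  symm := ⟨by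
    rintro (x | x | x) (y | y | y) h
    · exact ⟨h.1.symm, by rw [Sym2.eq_swap]; exact h.2⟩
    · exact h
    · exact h
    · exact h
    · exact ⟨h.1.symm, by rw [Sym2.eq_swap]; exact h.2⟩
    · exact h
    · exact h
    · exact h
    · exact fun e => h e.symm⟩
  loopless := ⟨by
    rintro (x | x | x) h
    · exact A.loopless.irrefl _ h.1
    · exact B.loopless.irrefl _ h.1
    · exact h rfl⟩

/-! Cubes, six-prisms and the graphs glued from them -/

/-- The `n`-prism: two disjoint `n`-cycles with corresponding vertices joined. -/
def prism (n : ℕ) : SimpleGraph (Fin n × Fin 2) :=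
  SimpleGraph.boxProd (SimpleGraph.cycleGraph n) (⊤ : SimpleGraph (Fin 2))

/-- The skeleton of the cube, which is the 4-prism. -/
abbrev cube : SimpleGraph (Fin 4 × Fin 2) := prism 4

/-- The six-prism. -/
abbrev sixPrism : SimpleGraph (Fin 6 × Fin 2) := prism 6

/-- The graphs glued from cubes and six-prisms: the smallest class of graphs that contains both
and is closed under isomorphism and under the three gluing operations. -/
inductive IsGlued : ∀ {V : Type}, SimpleGraph V → Prop
  | cube : IsGlued cube
  | sixPrism : IsGlued sixPrism
  | vertex {V W : Type} {A : SimpleGraph V} {B : SimpleGraph W} (hA : IsGlued A) (hB : IsGlued B)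
      (a : V) (b : W) (σ : A.neighborSet a ≃ B.neighborSet b) : IsGlued (glueVertex A a B b σ)
  | edge {V W : Type} {A : SimpleGraph V} {B : SimpleGraph W} (hA : IsGlued A) (hB : IsGlued B)
      {a₁ a₂ : V} {b₁ b₂ : W} (ha : A.Adj a₁ a₂) (hb : B.Adj b₁ b₂) :
      IsGlued (glueEdge A a₁ a₂ B b₁ b₂)
  | middle {V W : Type} {A : SimpleGraph V} {B : SimpleGraph W} (hA : IsGlued A) (hB : IsGlued B)
      {a₁ a₂ : V} {b₁ b₂ : W} (ha : A.Adj a₁ a₂) (hb : B.Adj b₁ b₂) :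
      IsGlued (glueMiddle A a₁ a₂ B b₁ b₂)
  | iso {V W : Type} {A : SimpleGraph V} {B : SimpleGraph W} (hA : IsGlued A) (e : A ≃g B) :
      IsGlued B

/-- `G` is (a copy of) the cube or the six-prism. -/
def IsCubeOrSixPrism (V : Type) (G : SimpleGraph V) : Prop :=
  Nonempty (G ≃g cube) ∨ Nonempty (G ≃g sixPrism)

/-! The construction, in five steps, from a class `𝓑` of ingredient graphs -/

/-- `K = A a|b B` with middle edge `z₁z₂`, where `A` and `B` are ingredients with
`v(A) ≡ v(B) ≡ 2 (mod 6)`. -/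
inductive StepK (𝓑 : ∀ V : Type, SimpleGraph V → Prop) :
    ∀ {V : Type}, SimpleGraph V → V → V → Prop
  | mk {V W : Type} (A : SimpleGraph V) (B : SimpleGraph W) (hA : 𝓑 V A) (hB : 𝓑 W B)
      (vA : Nat.card V % 6 = 2) (vB : Nat.card W % 6 = 2)
      (a₁ a₂ : V) (b₁ b₂ : W) (ha : A.Adj a₁ a₂) (hb : B.Adj b₁ b₂) :
      StepK 𝓑 (glueMiddle A a₁ a₂ B b₁ b₂) (Sum.inr (Sum.inr 0)) (Sum.inr (Sum.inr 1))

/-- `H = K k σ s S`, where `K` is from the first step, with middle edge `k k₁`, the vertex `k` has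
neighbours `k₁`, `k₂`, `k₃`, and `S` is an ingredient with `v(S) ≡ 0 (mod 6)`. The
graph `H` comes with the edge `k₃ σ(k₃)` and the vertex `σ(k₂)`. -/
inductive StepH (𝓑 : ∀ V : Type, SimpleGraph V → Prop) :
    ∀ {V : Type}, SimpleGraph V → V → V → V → Prop
  | mk {V W : Type} (K : SimpleGraph V) (S : SimpleGraph W) (k k₁ k₂ k₃ : V)
      (hK : StepK 𝓑 K k k₁ ∨ StepK 𝓑 K k₁ k)
      (hk₂ : K.Adj k k₂) (hk₃ : K.Adj k k₃) (h₁₂ : k₁ ≠ k₂) (h₁₃ : k₁ ≠ k₃) (h₂₃ : k₂ ≠ k₃)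
      (hS : 𝓑 W S) (vS : Nat.card W % 6 = 0)
      (s : W) (σ : K.neighborSet k ≃ S.neighborSet s) :
      StepH 𝓑 (glueVertex K k S s σ) (Sum.inl ⟨k₃, hk₃.ne'⟩)
        (Sum.inr ⟨(σ ⟨k₃, hk₃⟩ : W), (S.ne_of_adj (σ ⟨k₃, hk₃⟩).2).symm⟩)
        (Sum.inr ⟨(σ ⟨k₂, hk₂⟩ : W), (S.ne_of_adj (σ ⟨k₂, hk₂⟩).2).symm⟩)

/-- `D = K z h H`, where `K` with middle edge `z` is from the first step and `H` with edge `h` and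
vertex `x` is from the second step. The graph `D` comes with the vertex `x`. -/
inductive StepD (𝓑 : ∀ V : Type, SimpleGraph V → Prop) :
    ∀ {V : Type}, SimpleGraph V → V → Prop
  | mk {V W : Type} (K : SimpleGraph V) (H : SimpleGraph W) (z₁ z₂ : V) (h₁ h₂ x : W)
      (hK : StepK 𝓑 K z₁ z₂ ∨ StepK 𝓑 K z₂ z₁) (hH : StepH 𝓑 H h₁ h₂ x) :
      StepD 𝓑 (glueEdge K z₁ z₂ H h₁ h₂) (Sum.inr x)

/-- `F = Q q d D`, where `Q` is an ingredient with `v(Q) ≡ 2 (mod 6)`, `q = q₁q₂` is an edge of `Q`,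
`D` with vertex `x` is from the third step, and `d = xy` is an edge of `D`. The graph
`F` comes with its edge `q₂y`. -/
inductive StepF (𝓑 : ∀ V : Type, SimpleGraph V → Prop) :
    ∀ {V : Type}, SimpleGraph V → V → V → Prop
  | mk {V W : Type} (Q : SimpleGraph V) (D : SimpleGraph W) (q₁ q₂ : V) (x y : W)
      (hQ : 𝓑 V Q) (vQ : Nat.card V % 6 = 2) (hq : Q.Adj q₁ q₂)
      (hD : StepD 𝓑 D x) (hd : D.Adj x y) :
      StepF 𝓑 (glueEdge Q q₁ q₂ D x y) (Sum.inl q₂) (Sum.inr y)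

/-- `N = K z f F`, where `K` with middle edge `z` is from the first step and `F` with edge `f` is
from the fourth step. -/
inductive StepN (𝓑 : ∀ V : Type, SimpleGraph V → Prop) :
    ∀ {V : Type}, SimpleGraph V → Prop
  | mk {V W : Type} (K : SimpleGraph V) (F : SimpleGraph W) (z₁ z₂ : V) (f₁ f₂ : W)
      (hK : StepK 𝓑 K z₁ z₂ ∨ StepK 𝓑 K z₂ z₁) (hF : StepF 𝓑 F f₁ f₂) :
      StepN 𝓑 (glueEdge K z₁ z₂ F f₁ f₂)

end LambdaPacking

/-!
A `Λ`-factor partitions the vertices into *stars*: triples with a centre that is adjacent to the two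
other members (`HasLambdaFactor.hasStarPartition`). If a set `Y` of vertices has `2` vertices
modulo 3 and stars can leave it only through certain vertices `z`, then the stars of these `z`
together have at least two vertices in `Y`. This simple count drives the whole argument that
no graph of the construction has a `Λ`-factor (`StepN.not_hasLambdaFactor`):

* Let `K = A a|b B` be glued along its middle edge `z₁z₂` to a graph `G`. The stars of `z₁` and `z₂`
  have at most four further vertices, and both `A` and `B` claim two of them. Hence
  `A ∪ B ∪ {z₁, z₂}` is a union of stars, and `G` minus the edge of the gluing has a `Λ`-factor
  (`HasStarPartition.of_glueEdge_isGate`).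
* So a `Λ`-factor of `N` gives one of `F - f`. There, stars can leave `Q` only through `x`, so that
  `Q ∪ {x}` is a union of stars, and `D - x` has a `Λ`-factor. Again by the first point, so has
  `H - h - x`.
* In `H - h - x` the stars can leave both ingredients of `K` only through `k₁`. The star of `k₁`
  cannot have two vertices in each of them (`StepH.not_hasStarPartition`).

Since `v(G) / 3` disjoint 3-vertex paths would cover a graph `G` of order divisible by 3, the
inequality for `λ` follows (`lambda_lt_of_not_hasLambdaFactor`).

The graphs that are cubic, bipartite and 2-connected are closed under the gluing operations.
Planarity is obtained from straight-line drawings. If `A` has a drawing between two parallel lines, with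
the ends of an edge `a₁a₂` on these lines and nothing else, then `A` can be flattened and
inserted into any edge of a drawing of `B`, which draws `A a b B` (`exists_isDrawing_glueEdge`).
The vertex-gluing of the second step amounts to two such insertions
(`exists_isDrawing_glueVertex_glueMiddle`), so that drawings of the cube, of the six-prism and
of the graph `K` glued from two cubes suffice; these have integer coordinates and are checked
by computation. Repeated insertion of six-prisms into the ingredient `Q` gives infinitely many
orders.

An ingredient with `2` vertices modulo 6 has at least 8 vertices. One of order divisible by 6 has at
least 12, because a cubic bipartite graph with six vertices is `K₃,₃`, which is not planar
(`not_isPlanar_of_K33`); this gives the lower bound 72 (`StepN.le_card`). That `K₃,₃` has no drawing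
even with arbitrary arcs is proved by a parity count of winding angles
(`false_of_nine_curves`), which avoids the Jordan curve theorem.
-/

namespace LambdaPacking

/-! ### Partitions into stars and counting modulo 3 -/

/-- `S` assigns to each vertex of `X` the vertex set `S v ∋ v` of its part in a partition of `X`
into triples, each of which has a centre `c` adjacent in `G` to the two other members. This is the
vertex partition of a `Λ`-factor of the graph that `G` induces on `X`. -/
def IsStarPartition {V : Type} (G : SimpleGraph V) (X : Set V) (S : V → Set V) : Prop :=
  ∀ v ∈ X, v ∈ S v ∧ S v ⊆ X ∧ (S v).ncard = 3 ∧ (∀ w ∈ S v, S w = S v) ∧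
    ∃ c ∈ S v, ∀ w ∈ S v, w ≠ c → G.Adj c w

/-- The graph that `G` induces on `X` has a partition into stars with three vertices. -/
def HasStarPartition {V : Type} (G : SimpleGraph V) (X : Set V) : Prop :=
  ∃ S : V → Set V, IsStarPartition G X S

theorem HasLambdaFactor.hasStarPartition {V : Type} {G : SimpleGraph V} (h : HasLambdaFactor G) :
    HasStarPartition G Set.univ := by
  obtain ⟨P, hP, hs⟩ := h
  let C : V → P.coe.ConnectedComponent := fun v => P.coe.connectedComponentMk ⟨v, hs v⟩
  refine ⟨fun v => Subtype.val '' (C v).supp, fun v _ => ⟨⟨⟨v, hs v⟩, rfl, rfl⟩,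
    Set.subset_univ _, ?_, ?_, ?_⟩⟩
  · obtain ⟨e⟩ := hP (C v)
    rw [Set.ncard_image_of_injective _ Subtype.val_injective, ← Nat.card_coe_set_eq]
    calc Nat.card (C v).supp = Nat.card (Fin 3) := Nat.card_congr e.toEquiv
      _ = 3 := by simp
  · rintro _ ⟨w, hw, rfl⟩
    have : C w.1 = C v := hw
    simp only [this]
  · obtain ⟨e⟩ := hP (C v)
    refine ⟨_, ⟨(e.symm 1).1, (e.symm 1).2, rfl⟩, ?_⟩
    rintro _ ⟨w, hw, rfl⟩ hne
    have h1 : Lam.Adj 1 (e ⟨w, hw⟩) := by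
      have h2 : e ⟨w, hw⟩ ≠ 1 := by
        intro h3
        apply hne
        rw [← h3, e.symm_apply_apply]
      rw [SimpleGraph.pathGraph_adj]
      generalize e ⟨w, hw⟩ = i at h2
      fin_cases i <;> simp_all
    have h2 := e.symm.map_rel_iff.2 h1
    rw [show e.symm (e ⟨w, hw⟩) = ⟨w, hw⟩ from e.symm_apply_apply _] at h2
    exact P.adj_sub (SimpleGraph.comap_adj.1 h2)

namespace IsStarPartition

variable {V : Type} {G : SimpleGraph V} {X : Set V} {S : V → Set V}

theorem eq_of_mem (h : IsStarPartition G X S) {v w : V} (hv : v ∈ X) (hw : w ∈ S v) : S w = S v :=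
  (h v hv).2.2.2.1 w hw

theorem finite (h : IsStarPartition G X S) {v : V} (hv : v ∈ X) : (S v).Finite :=
  Set.finite_of_ncard_pos (by rw [(h v hv).2.2.1]; norm_num)

/-- The number of vertices of a union of stars is a multiple of 3. -/
theorem three_dvd_ncard (h : IsStarPartition G X S) {Y : Set V} (hY : Y.Finite) (hX : Y ⊆ X)
    (hs : ∀ v ∈ Y, S v ⊆ Y) : 3 ∣ Y.ncard := by
  induction hn : Y.ncard using Nat.strong_induction_on generalizing Y with
  | _ n ih =>
    subst hn
    rcases Y.eq_empty_or_nonempty with rfl | ⟨v, hv⟩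
    · simp
    · have h3 := (h v (hX hv)).2.2.1
      have hc := Set.ncard_sdiff_add_ncard_of_subset (hs v hv) hY
      have hd := ih (Y \ S v).ncard (by omega) (hY.subset Set.sdiff_subset)
        (Set.sdiff_subset.trans hX) (fun w hw u hu => ⟨hs w hw.1 hu, fun huv => hw.2 ?_⟩) rfl
      · omega
      · rw [← h.eq_of_mem (hX hv) huv, h.eq_of_mem (hX hw.1) hu]
        exact (h w (hX hw.1)).1

/-- A star that meets `Y` lies in `Y` or leaves it through a vertex of the outer boundary `W`. -/
theorem subset_or_exists_mem (h : IsStarPartition G X S) {Y W : Set V} (hX : Y ⊆ X)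
    (hb : ∀ u ∈ Y, ∀ w ∈ X, w ∉ Y → G.Adj u w → w ∈ W) {v : V} (hv : v ∈ Y) :
    S v ⊆ Y ∨ ∃ w ∈ W, w ∈ S v := by
  obtain ⟨hvv, hSX, -, -, c, hc, hcs⟩ := h v (hX hv)
  by_cases hcY : c ∈ Y
  · by_contra! hcon
    obtain ⟨w, hw, hwY⟩ := Set.not_subset.1 hcon.1
    refine hcon.2 w (hb c hcY w (hSX hw) hwY (hcs w hw ?_)) hw
    rintro rfl
    exact hwY hcY
  · refine Or.inr ⟨c, hb v hv c (hSX hc) hcY (hcs v hvv ?_).symm, hc⟩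
    rintro rfl
    exact hcY hv

/-- If every star that leaves `Y` is one of the stars that make up `U`, then `Y` and `Y ∩ U` have
the same number of vertices modulo 3. -/
theorem ncard_mod_three (h : IsStarPartition G X S) {Y U : Set V} (hY : Y.Finite) (hX : Y ⊆ X)
    (hU : ∀ v ∈ U, v ∈ X ∧ S v ⊆ U) (hs : ∀ v ∈ Y, S v ⊆ Y ∨ v ∈ U) :
    (Y ∩ U).ncard % 3 = Y.ncard % 3 := by
  have hd := h.three_dvd_ncard (hY.subset Set.sdiff_subset) (Set.sdiff_subset.trans hX)
    (Y := Y \ U) (fun v hv w hw => ⟨((hs v hv.1).resolve_right hv.2) hw, fun hwU => hv.2 ?_⟩)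
  · have := Set.ncard_inter_add_ncard_sdiff_eq_ncard Y U hY
    omega
  · apply (hU w hwU).2
    rw [h.eq_of_mem (hX hv.1) hw]
    exact (h v (hX hv.1)).1

/-- If `Y` has `2` vertices modulo 3 and a star can leave `Y` only through `z`, then the star of
`z` has at least two vertices in `Y`. -/
theorem two_le_ncard_inter (h : IsStarPartition G X S) {Y : Set V} {z : V} (hY : Y.Finite)
    (hX : Y ⊆ X) (hz : z ∈ X) (hc : Y.ncard % 3 = 2)
    (hs : ∀ v ∈ Y, S v ⊆ Y ∨ z ∈ S v) : 2 ≤ (Y ∩ S z).ncard := by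
  have := h.ncard_mod_three hY hX (U := S z) (fun v hv => ⟨(h z hz).2.1 hv,
    (h.eq_of_mem hz hv).subset⟩) (fun v hv => (hs v hv).imp_right fun hzv => by
      rw [h.eq_of_mem (hX hv) hzv]
      exact (h v (hX hv)).1)
  omega

/-- If `Y` has `2` vertices modulo 3 and a star can leave `Y` only through `z`, then `Y ∪ {z}` is
a union of stars. -/
theorem insert_saturated (h : IsStarPartition G X S) {Y : Set V} {z : V} (hY : Y.Finite)
    (hX : Y ⊆ X) (hz : z ∈ X) (hzY : z ∉ Y) (hc : Y.ncard % 3 = 2)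
    (hb : ∀ u ∈ Y, ∀ w ∈ X, w ∉ Y → G.Adj u w → w = z) :
    ∀ v ∈ insert z Y, S v ⊆ insert z Y := by
  have hs : ∀ v ∈ Y, S v ⊆ Y ∨ z ∈ S v := fun v hv => by
    simpa using h.subset_or_exists_mem hX (W := {z}) hb hv
  have h2 := h.two_le_ncard_inter hY hX hz hc hs
  have hzS : S z ⊆ insert z Y := by
    have h3 := Set.ncard_sdiff_singleton_add_one (h z hz).1 (h.finite hz)
    rw [(h z hz).2.2.1] at h3
    have h4 : Y ∩ S z = S z \ {z} :=
      Set.eq_of_subset_of_ncard_le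
        (fun v hv => ⟨hv.2, fun hvz => hzY (by rw [← Set.mem_singleton_iff.1 hvz]; exact hv.1)⟩)
        (by omega) ((h.finite hz).subset Set.sdiff_subset)
    intro v hv
    by_cases hvz : v = z
    · exact Or.inl hvz
    · exact Or.inr (h4.symm.subset ⟨hv, hvz⟩).1
  rintro v (rfl | hv)
  · exact hzS
  · rcases hs v hv with h5 | h5
    · exact h5.trans (Set.subset_insert _ _)
    · rw [← h.eq_of_mem (hX hv) h5]
      exact hzS

/-- If `A` and `B` have `2` vertices modulo 3 each, and a star can leave `A` or `B` only through
one of the two gate vertices `z₁`, `z₂`, then `A ∪ B ∪ {z₁, z₂}` is a union of stars. -/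
theorem gate_saturated (h : IsStarPartition G X S) {A B : Set V} {z₁ z₂ : V} (hA : A.Finite)
    (hB : B.Finite) (hAX : A ⊆ X) (hBX : B ⊆ X) (hAB : Disjoint A B) (hz₁ : z₁ ∈ X) (hz₂ : z₂ ∈ X)
    (hz₁A : z₁ ∉ A) (hz₁B : z₁ ∉ B) (hz₂A : z₂ ∉ A) (hz₂B : z₂ ∉ B)
    (hcA : A.ncard % 3 = 2) (hcB : B.ncard % 3 = 2)
    (hbA : ∀ u ∈ A, ∀ w ∈ X, w ∉ A → G.Adj u w → w ∈ ({z₁, z₂} : Set V))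
    (hbB : ∀ u ∈ B, ∀ w ∈ X, w ∉ B → G.Adj u w → w ∈ ({z₁, z₂} : Set V)) :
    ∀ v ∈ A ∪ B ∪ {z₁, z₂}, S v ⊆ A ∪ B ∪ {z₁, z₂} := by
  set U : Set V := S z₁ ∪ S z₂ with hUdef
  have hUf : U.Finite := (h.finite hz₁).union (h.finite hz₂)
  have hU : ∀ v ∈ U, v ∈ X ∧ S v ⊆ U := by
    rintro v (hv | hv)
    · exact ⟨(h z₁ hz₁).2.1 hv, (h.eq_of_mem hz₁ hv).subset.trans Set.subset_union_left⟩
    · exact ⟨(h z₂ hz₂).2.1 hv, (h.eq_of_mem hz₂ hv).subset.trans Set.subset_union_right⟩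
  have key : ∀ Y : Set V, Y ⊆ X →
      (∀ u ∈ Y, ∀ w ∈ X, w ∉ Y → G.Adj u w → w ∈ ({z₁, z₂} : Set V)) →
      ∀ v ∈ Y, S v ⊆ Y ∨ v ∈ U := by
    intro Y hYX hb v hv
    refine (h.subset_or_exists_mem hYX hb hv).imp_right ?_
    rintro ⟨w, rfl | rfl, hw⟩
    · rw [hUdef, h.eq_of_mem (hYX hv) hw]
      exact Or.inl (h v (hYX hv)).1
    · rw [hUdef, h.eq_of_mem (hYX hv) hw]
      exact Or.inr (h v (hYX hv)).1
  have cA := h.ncard_mod_three hA hAX hU (key A hAX hbA)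
  have cB := h.ncard_mod_three hB hBX hU (key B hBX hbB)
  -- The two stars at the gate have at most four vertices besides `z₁`, `z₂`, so that `A` and `B`
  -- take exactly two of them each.
  have hc4 : (U \ {z₁, z₂}).ncard ≤ 4 := by
    have e1 := Set.ncard_sdiff_singleton_add_one (h z₁ hz₁).1 (h.finite hz₁)
    have e2 := Set.ncard_sdiff_singleton_add_one (h z₂ hz₂).1 (h.finite hz₂)
    rw [(h z₁ hz₁).2.2.1] at e1
    rw [(h z₂ hz₂).2.2.1] at e2
    have : U \ {z₁, z₂} ⊆ (S z₁ \ {z₁}) ∪ (S z₂ \ {z₂}) := by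
      rintro v ⟨hv | hv, hn⟩
      · exact Or.inl ⟨hv, fun hv' => hn (Or.inl hv')⟩
      · exact Or.inr ⟨hv, fun hv' => hn (Or.inr hv')⟩
    have e3 := Set.ncard_le_ncard this (((h.finite hz₁).subset Set.sdiff_subset).union
      ((h.finite hz₂).subset Set.sdiff_subset))
    have e4 := Set.ncard_union_le (S z₁ \ {z₁}) (S z₂ \ {z₂})
    omega
  have hdis : Disjoint (A ∩ U) (B ∩ U) := hAB.mono Set.inter_subset_left Set.inter_subset_left
  have hcU := Set.ncard_union_eq hdis (hA.subset Set.inter_subset_left)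
    (hB.subset Set.inter_subset_left)
  have hsub : A ∩ U ∪ B ∩ U ⊆ U \ {z₁, z₂} := by
    rintro v (⟨hv, hvU⟩ | ⟨hv, hvU⟩)
    · refine ⟨hvU, ?_⟩
      rintro (rfl | rfl)
      exacts [hz₁A hv, hz₂A hv]
    · refine ⟨hvU, ?_⟩
      rintro (rfl | rfl)
      exacts [hz₁B hv, hz₂B hv]
  have heq := Set.eq_of_subset_of_ncard_le hsub (by omega) (hUf.subset Set.sdiff_subset)
  have hUsub : U ⊆ A ∪ B ∪ {z₁, z₂} := by
    intro v hv
    by_cases hvz : v ∈ ({z₁, z₂} : Set V)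
    · exact Or.inr hvz
    · exact Or.inl ((heq.symm.subset ⟨hv, hvz⟩).imp (·.1) (·.1))
  rintro v ((hv | hv) | (rfl | rfl))
  · rcases key A hAX hbA v hv with h5 | h5
    · exact fun w hw => Or.inl (Or.inl (h5 hw))
    · exact (hU v h5).2.trans hUsub
  · rcases key B hBX hbB v hv with h5 | h5
    · exact fun w hw => Or.inl (Or.inr (h5 hw))
    · exact (hU v h5).2.trans hUsub
  · exact Set.subset_union_left.trans hUsub
  · exact Set.subset_union_right.trans hUsub

/-- The complement of a union of stars is a union of stars. -/
theorem diff_saturated (h : IsStarPartition G X S) {Y : Set V}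
    (hs : ∀ v ∈ Y, S v ⊆ Y) : ∀ v ∈ X \ Y, S v ⊆ X \ Y := by
  intro v hv w hw
  refine ⟨(h v hv.1).2.1 hw, fun hwY => hv.2 (hs w hwY ?_)⟩
  rw [h.eq_of_mem hv.1 hw]
  exact (h v hv.1).1

/-- A union of stars inside the range of an injection pulls back to a union of stars. -/
theorem comap {W : Type} (h : IsStarPartition G X S) (ι : W → V) (hι : Function.Injective ι)
    {Z : Set W} (hX : ι '' Z ⊆ X) (hs : ∀ v ∈ ι '' Z, S v ⊆ ι '' Z) :
    HasStarPartition (G.comap ι) Z := by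
  refine ⟨fun w => ι ⁻¹' S (ι w), fun w hw => ?_⟩
  have hw' : ι w ∈ ι '' Z := ⟨w, hw, rfl⟩
  obtain ⟨h1, h2, h3, h4, c, hc, h5⟩ := h (ι w) (hX hw')
  have hsub := hs _ hw'
  refine ⟨h1, fun u hu => ?_, ?_, fun u hu => ?_, ?_⟩
  · obtain ⟨u', hu', he⟩ := hsub hu
    rwa [← hι he]
  · rw [Set.ncard_preimage_of_injective_subset_range hι (hsub.trans (Set.image_subset_range _ _)),
      h3]
  · simp only [h4 _ hu]
  · obtain ⟨c', hc', rfl⟩ := hsub hc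
    exact ⟨c', hc, fun u hu hne => h5 _ hu fun e => hne (hι e)⟩

end IsStarPartition

theorem HasStarPartition.mono {V : Type} {G H : SimpleGraph V} {X : Set V} (hGH : G ≤ H)
    (h : HasStarPartition G X) : HasStarPartition H X := by
  obtain ⟨S, hS⟩ := h
  refine ⟨S, fun v hv => ?_⟩
  obtain ⟨h1, h2, h3, h4, c, hc, h5⟩ := hS v hv
  exact ⟨h1, h2, h3, h4, c, hc, fun w hw hne => hGH (h5 w hw hne)⟩

/-! ### The construction has no `Λ`-factor -/

theorem finite_of_card_mod_six {V : Type} {r : ℕ} (hr : r ≠ 0) (h : Nat.card V % 6 = r) :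
    Finite V := by
  apply Nat.finite_of_card_ne_zero
  rintro h0
  rw [h0] at h
  omega

theorem ncard_range_mod_three {V W : Type} {ι : V → W} (hι : Function.Injective ι)
    (h : Nat.card V % 6 = 2) : (Set.range ι).ncard % 3 = 2 := by
  rw [← Set.image_univ, Set.ncard_image_of_injective _ hι, Set.ncard_univ]
  omega

/-- The shape of the graph `K = A a|b B` around its middle edge `z₁z₂`: the rest of `K` consists of
two sets `A` and `B` with `2` vertices modulo 3 each, which have edges to `z₁` and `z₂` only, and
`z₁` and `z₂` have at most two neighbours besides each other. -/
structure IsGate {V : Type} (K : SimpleGraph V) (z₁ z₂ : V) (A B : Set V) : Prop where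
  finite_left : A.Finite
  finite_right : B.Finite
  ncard_left : A.ncard % 3 = 2
  ncard_right : B.ncard % 3 = 2
  disjoint : Disjoint A B
  ne : z₁ ≠ z₂
  notMem₁ : z₁ ∉ A ∧ z₁ ∉ B
  notMem₂ : z₂ ∉ A ∧ z₂ ∉ B
  union : A ∪ B ∪ {z₁, z₂} = Set.univ
  boundary_left : ∀ u ∈ A, ∀ w ∉ A, K.Adj u w → w = z₁ ∨ w = z₂
  boundary_right : ∀ u ∈ B, ∀ w ∉ B, K.Adj u w → w = z₁ ∨ w = z₂
  neighbors₁ : ∃ a b, ∀ u, K.Adj z₁ u → u = z₂ ∨ u = a ∨ u = b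
  neighbors₂ : ∃ a b, ∀ u, K.Adj z₂ u → u = z₁ ∨ u = a ∨ u = b

theorem IsGate.symm {V : Type} {K : SimpleGraph V} {z₁ z₂ : V} {A B : Set V}
    (h : IsGate K z₁ z₂ A B) : IsGate K z₂ z₁ A B :=
  ⟨h.1, h.2, h.3, h.4, h.5, h.6.symm, h.8, h.7, by rw [Set.pair_comm, h.9],
    fun u hu w hw e => (h.10 u hu w hw e).symm, fun u hu w hw e => (h.11 u hu w hw e).symm,
    h.13, h.12⟩

theorem StepK.exists_isGate {𝓑 : ∀ V : Type, SimpleGraph V → Prop} {V : Type}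
    {K : SimpleGraph V} {z₁ z₂ : V} (hK : StepK 𝓑 K z₁ z₂ ∨ StepK 𝓑 K z₂ z₁) :
    ∃ A B : Set V, IsGate K z₁ z₂ A B := by
  have main : ∀ {z₁ z₂ : V}, StepK 𝓑 K z₁ z₂ → ∃ A B : Set V, IsGate K z₁ z₂ A B := by
    intro z₁ z₂ hK
    cases hK with
    | @mk VA VB A B hA hB vA vB a₁ a₂ b₁ b₂ ha hb =>
      have := finite_of_card_mod_six (by norm_num) vA
      have := finite_of_card_mod_six (by norm_num) vB
      have hι : Function.Injective (Sum.inr ∘ Sum.inl : VB → VA ⊕ (VB ⊕ Fin 2)) :=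
        Sum.inr_injective.comp Sum.inl_injective
      refine ⟨Set.range Sum.inl, Set.range (Sum.inr ∘ Sum.inl), Set.finite_range _,
        Set.finite_range _, ncard_range_mod_three Sum.inl_injective vA,
        ncard_range_mod_three hι vB, ?_, by simp, by simp, by simp, ?_, ?_, ?_,
        ⟨Sum.inl a₁, Sum.inr (Sum.inl b₁), ?_⟩, ⟨Sum.inl a₂, Sum.inr (Sum.inl b₂), ?_⟩⟩
      · rw [Set.disjoint_left]
        rintro _ ⟨x, rfl⟩ ⟨y, hy⟩
        simp at hy
      · ext (u | u | i)
        · simp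
        · simp
        · fin_cases i <;> simp
      · rintro _ ⟨x, rfl⟩ (u | u | i) hw hadj
        · exact absurd ⟨u, rfl⟩ hw
        · exact hadj.elim
        · fin_cases i <;> simp
      · rintro _ ⟨x, rfl⟩ (u | u | i) hw hadj
        · exact hadj.elim
        · exact absurd ⟨u, rfl⟩ hw
        · fin_cases i <;> simp
      · rintro (u | u | i) hadj
        · exact Or.inr (Or.inl (by simpa [glueMiddle] using hadj))
        · exact Or.inr (Or.inr (by simpa [glueMiddle] using hadj))
        · exact Or.inl (by
            have : (0 : Fin 2) ≠ i := hadj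
            fin_cases i <;> simp_all)
      · rintro (u | u | i) hadj
        · exact Or.inr (Or.inl (by simpa [glueMiddle] using hadj))
        · exact Or.inr (Or.inr (by simpa [glueMiddle] using hadj))
        · exact Or.inl (by
            have : (1 : Fin 2) ≠ i := hadj
            fin_cases i <;> simp_all)
  rcases hK with hK | hK
  · exact main hK
  · obtain ⟨A, B, h⟩ := main hK
    exact ⟨A, B, h.symm⟩

/-- The edge-gluing of `K` along its middle edge acts on `Λ`-factors like an edge that must not be
used: the vertices of `K` form a union of stars, so that the rest has a `Λ`-factor as well. -/
theorem HasStarPartition.of_glueEdge_isGate {V W : Type} {K : SimpleGraph V} {z₁ z₂ : V}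
    {A B : Set V} (hK : IsGate K z₁ z₂ A B) {F : SimpleGraph W} {f₁ f₂ : W} {Z : Set W}
    (h : HasStarPartition (glueEdge K z₁ z₂ F f₁ f₂) (Set.range Sum.inl ∪ Sum.inr '' Z)) :
    HasStarPartition (F.deleteEdges {s(f₁, f₂)}) Z := by
  obtain ⟨S, hS⟩ := h
  have hsub : ∀ A : Set V, Sum.inl '' A ⊆ (Set.range Sum.inl ∪ Sum.inr '' Z : Set (V ⊕ W)) :=
    fun A => (Set.image_subset_range _ _).trans Set.subset_union_left
  have hb : ∀ A : Set V, z₁ ∉ A ∧ z₂ ∉ A → (∀ u ∈ A, ∀ w ∉ A, K.Adj u w → w = z₁ ∨ w = z₂) →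
      ∀ u ∈ Sum.inl '' A, ∀ w ∈ (Set.range Sum.inl ∪ Sum.inr '' Z : Set (V ⊕ W)),
        w ∉ Sum.inl '' A → (glueEdge K z₁ z₂ F f₁ f₂).Adj u w →
        w ∈ ({Sum.inl z₁, Sum.inl z₂} : Set (V ⊕ W)) := by
    rintro A hz hA _ ⟨u, hu, rfl⟩ (w | w) - hw hadj
    · simpa using hA u hu w (fun h => hw ⟨w, h, rfl⟩) hadj.1
    · rcases hadj with ⟨rfl, -⟩ | ⟨rfl, -⟩
      exacts [absurd hu hz.1, absurd hu hz.2]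
  have key := hS.gate_saturated (hK.finite_left.image Sum.inl) (hK.finite_right.image Sum.inl)
    (hsub A) (hsub B) ((Set.disjoint_image_iff Sum.inl_injective).2 hK.disjoint)
    (z₁ := Sum.inl z₁) (z₂ := Sum.inl z₂) (by simp) (by simp)
    (by simpa using hK.notMem₁.1) (by simpa using hK.notMem₁.2)
    (by simpa using hK.notMem₂.1) (by simpa using hK.notMem₂.2)
    (by rw [Set.ncard_image_of_injective _ Sum.inl_injective, hK.ncard_left])
    (by rw [Set.ncard_image_of_injective _ Sum.inl_injective, hK.ncard_right])
    (hb A ⟨hK.notMem₁.1, hK.notMem₂.1⟩ hK.boundary_left)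
    (hb B ⟨hK.notMem₁.2, hK.notMem₂.2⟩ hK.boundary_right)
  have hr : Sum.inl '' A ∪ Sum.inl '' B ∪ {Sum.inl z₁, Sum.inl z₂} =
      (Set.range Sum.inl : Set (V ⊕ W)) := by
    rw [← Set.image_pair, ← Set.image_union, ← Set.image_union, hK.union, Set.image_univ]
  rw [hr] at key
  have hdiff : (Set.range Sum.inl ∪ Sum.inr '' Z) \ Set.range Sum.inl =
      (Sum.inr '' Z : Set (V ⊕ W)) := by
    ext (v | w) <;> simp
  have hd := hS.diff_saturated key
  rw [hdiff] at hd
  refine (hS.comap Sum.inr Sum.inr_injective Set.subset_union_right hd).mono ?_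
  intro u v huv
  exact SimpleGraph.deleteEdges_adj.2 huv

/-- After the deletion of the vertex `x` and of its edge `h`, the graph `H` of the second step has
no `Λ`-factor: the star of `k₁` would have to contain two vertices of each of the two
ingredients of `K`. -/
theorem StepH.not_hasStarPartition {𝓑 : ∀ V : Type, SimpleGraph V → Prop} {V : Type}
    {H : SimpleGraph V} {h₁ h₂ x : V} (hH : StepH 𝓑 H h₁ h₂ x) :
    ¬ HasStarPartition (H.deleteEdges {s(h₁, h₂)}) {x}ᶜ := by
  rintro ⟨P, hP⟩
  cases hH with
  | @mk VK W K S k k₁ k₂ k₃ hK hk₂ hk₃ h₁₂ h₁₃ h₂₃ hS vS s σ =>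
    obtain ⟨A, B, hG⟩ := StepK.exists_isGate hK
    have hk : ∀ u, K.Adj k u → u = k₁ ∨ u = k₂ ∨ u = k₃ := by
      obtain ⟨a, b, hab⟩ := hG.neighbors₁
      intro u hu
      have h1 := hab u hu
      have h2 := hab k₂ hk₂
      have h3 := hab k₃ hk₃
      grind
    let ι : {v // v ≠ k} → {v // v ≠ k} ⊕ {y // y ≠ s} := Sum.inl
    let k₁' : {v // v ≠ k} := ⟨k₁, hG.ne.symm⟩
    -- The set `Y` stands for each of the two ingredients of `K`.
    have key : ∀ Y : Set VK, Y.Finite → Y.ncard % 3 = 2 → k ∉ Y → k₁ ∉ Y →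
        (∀ u ∈ Y, ∀ w ∉ Y, K.Adj u w → w = k ∨ w = k₁) →
        2 ≤ ((ι '' (Subtype.val ⁻¹' Y)) ∩ P (ι k₁')).ncard := by
      intro Y hY hc hkY hk₁Y hb
      have hsub : ι '' (Subtype.val ⁻¹' Y) ⊆
          {(Sum.inr ⟨(σ ⟨k₂, hk₂⟩ : W), (S.ne_of_adj (σ ⟨k₂, hk₂⟩).2).symm⟩ :
            {v // v ≠ k} ⊕ {y // y ≠ s})}ᶜ := by
        rintro _ ⟨x, -, rfl⟩
        simp [ι]
      refine hP.two_le_ncard_inter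
        ((hY.preimage Subtype.val_injective.injOn).image _) hsub (by simp [ι]) ?_ fun v hv => ?_
      · rw [Set.ncard_image_of_injective _ Sum.inl_injective,
          Set.ncard_preimage_of_injective_subset_range Subtype.val_injective, hc]
        intro u hu
        exact ⟨⟨u, fun h => hkY (h ▸ hu)⟩, rfl⟩
      have h0 := hP.subset_or_exists_mem hsub (W := {ι k₁'}) ?_ hv
      · simpa using h0
      rintro _ ⟨x, hxY, rfl⟩ w hwx hwY hadj
      rw [SimpleGraph.deleteEdges_adj] at hadj
      obtain ⟨hadj, hne⟩ := hadj
      rcases w with ⟨u, hu⟩ | ⟨w, hw⟩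
      · by_contra hcon
        refine hu ((hb x.1 hxY u (fun h => hwY ⟨⟨u, hu⟩, h, rfl⟩) hadj).resolve_right ?_)
        rintro rfl
        exact hcon rfl
      · exfalso
        obtain ⟨hkx, rfl⟩ := hadj
        rcases hk _ hkx with h | h | h
        · exact hk₁Y (h ▸ hxY)
        · have : (⟨x.1, hkx⟩ : K.neighborSet k) = ⟨k₂, hk₂⟩ := Subtype.ext h
          exact hwx (congrArg Sum.inr (Subtype.ext (congrArg (fun z => (σ z : W)) this)))
        · have h2 : (⟨x.1, hkx⟩ : K.neighborSet k) = ⟨k₃, hk₃⟩ := Subtype.ext h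
          have h3 : x = ⟨k₃, hk₃.ne'⟩ := Subtype.ext h
          apply hne
          rw [Set.mem_singleton_iff]
          exact congrArg₂ (fun p q => s(p, q)) (congrArg Sum.inl h3)
            (congrArg Sum.inr (Subtype.ext (congrArg (fun z => (σ z : W)) h2)))
    have h1 := key A hG.finite_left hG.ncard_left hG.notMem₁.1 hG.notMem₂.1 hG.boundary_left
    have h2 := key B hG.finite_right hG.ncard_right hG.notMem₁.2 hG.notMem₂.2 hG.boundary_right
    obtain ⟨-, -, h3, -⟩ := hP (ι k₁') (by simp [ι])
    have hfin := hP.finite (v := ι k₁') (by simp [ι])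
    have hdis : Disjoint (ι '' (Subtype.val ⁻¹' A) ∩ P (ι k₁'))
        (ι '' (Subtype.val ⁻¹' B) ∩ P (ι k₁')) :=
      ((Set.disjoint_image_iff Sum.inl_injective).2 (hG.disjoint.preimage _)).mono
        Set.inter_subset_left Set.inter_subset_left
    have h4 := Set.ncard_union_eq hdis (hfin.subset Set.inter_subset_right)
      (hfin.subset Set.inter_subset_right)
    have h5 := Set.ncard_le_ncard (Set.union_subset
      (Set.inter_subset_right (s := ι '' (Subtype.val ⁻¹' A)) (t := P (ι k₁')))
      (Set.inter_subset_right (s := ι '' (Subtype.val ⁻¹' B)))) hfin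
    omega

theorem StepD.not_hasStarPartition {𝓑 : ∀ V : Type, SimpleGraph V → Prop} {V : Type}
    {D : SimpleGraph V} {x : V} (hD : StepD 𝓑 D x) : ¬ HasStarPartition D {x}ᶜ := by
  intro h
  cases hD with
  | @mk VK W K H z₁ z₂ h₁ h₂ x hK hH =>
    obtain ⟨A, B, hG⟩ := StepK.exists_isGate hK
    refine hH.not_hasStarPartition (HasStarPartition.of_glueEdge_isGate hG ?_)
    have : (Set.range Sum.inl ∪ Sum.inr '' {x}ᶜ : Set (VK ⊕ W)) = {Sum.inr x}ᶜ := by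
      ext (v | w) <;> simp
    rwa [this]

theorem StepF.not_hasStarPartition {𝓑 : ∀ V : Type, SimpleGraph V → Prop} {V : Type}
    {F : SimpleGraph V} {f₁ f₂ : V} (hF : StepF 𝓑 F f₁ f₂) :
    ¬ HasStarPartition (F.deleteEdges {s(f₁, f₂)}) Set.univ := by
  rintro ⟨P, hP⟩
  cases hF with
  | @mk VQ W Q D q₁ q₂ x y hQ vQ hq hD hd =>
    apply hD.not_hasStarPartition
    have := finite_of_card_mod_six (by norm_num) vQ
    have hs := hP.insert_saturated (Set.finite_range (Sum.inl : VQ → VQ ⊕ W))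
      (Set.subset_univ _) (Set.mem_univ (Sum.inr x)) (by simp)
      (ncard_range_mod_three Sum.inl_injective vQ) (by
        rintro _ ⟨u, rfl⟩ (w | w) - hw hadj
        · exact absurd ⟨w, rfl⟩ hw
        · rw [SimpleGraph.deleteEdges_adj] at hadj
          obtain ⟨⟨rfl, rfl⟩ | ⟨rfl, rfl⟩, hne⟩ := hadj
          · rfl
          · exact absurd rfl hne)
    have hd' := hP.diff_saturated hs
    have hr : Set.univ \ insert (Sum.inr x) (Set.range Sum.inl) =
        (Sum.inr '' {x}ᶜ : Set (VQ ⊕ W)) := by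
      ext (v | w) <;> simp
    rw [hr] at hd'
    refine (hP.comap Sum.inr Sum.inr_injective (Set.subset_univ _) hd').mono ?_
    intro u v huv
    exact (SimpleGraph.deleteEdges_adj.1 huv).1.1

/-- No graph given by the construction has a `Λ`-factor. This depends on the orders of
the ingredients only. -/
theorem StepN.not_hasLambdaFactor {𝓑 : ∀ V : Type, SimpleGraph V → Prop} {V : Type}
    {N : SimpleGraph V} (hN : StepN 𝓑 N) : ¬ HasLambdaFactor N := by
  intro h
  cases hN with
  | @mk VK W K F z₁ z₂ f₁ f₂ hK hF =>
    obtain ⟨A, B, hG⟩ := StepK.exists_isGate hK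
    refine hF.not_hasStarPartition (HasStarPartition.of_glueEdge_isGate hG ?_)
    have : (Set.range Sum.inl ∪ Sum.inr '' Set.univ : Set (VK ⊕ W)) = Set.univ := by
      ext (v | w) <;> simp
    rw [this]
    exact h.hasStarPartition

/-! ### The number of components of a `Λ`-packing -/

theorem IsPacking.card_verts {V : Type} [Finite V] {G : SimpleGraph V} {P : G.Subgraph}
    (hP : IsPacking Lam G P) : Nat.card P.verts = 3 * Nat.card P.coe.ConnectedComponent := by
  have e : P.verts ≃ Σ c : P.coe.ConnectedComponent, c.supp :=
    (Equiv.sigmaFiberEquiv P.coe.connectedComponentMk).symm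
  have h3 : ∀ c : P.coe.ConnectedComponent, Nat.card c.supp = 3 := fun c => by
    obtain ⟨f⟩ := hP c
    calc Nat.card c.supp = Nat.card (Fin 3) := Nat.card_congr f.toEquiv
      _ = 3 := by simp
  have := Fintype.ofFinite P.coe.ConnectedComponent
  rw [Nat.card_congr e, Nat.card_sigma]
  simp [h3, mul_comm]

/-- `λ(G)` is attained by a packing, and a packing with `v(G) / 3` components is spanning. -/
theorem lambda_lt_of_not_hasLambdaFactor {V : Type} [Finite V] {G : SimpleGraph V}
    (hc : Nat.card V % 6 = 0) (h : ¬ HasLambdaFactor G) : lambda G < Nat.card V / 3 := by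
  by_contra! hcon
  have hle : ∀ P : G.Subgraph, Nat.card P.verts ≤ Nat.card V := fun P =>
    Nat.card_le_card_of_injective _ Subtype.val_injective
  have hmem : lambda G ∈ {k : ℕ | ∃ P : G.Subgraph, IsPacking Lam G P ∧
      Nat.card P.coe.ConnectedComponent = k} := by
    refine Nat.sSup_mem ⟨_, ⊥, fun c => ?_, rfl⟩ ⟨Nat.card V, ?_⟩
    · obtain ⟨⟨v, hv⟩, -⟩ := c.nonempty_supp
      exact hv.elim
    · rintro _ ⟨P, hP, rfl⟩
      have := hP.card_verts
      have := hle P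
      omega
  obtain ⟨P, hP, hk⟩ := hmem
  refine h ⟨P, hP, fun v => ?_⟩
  have h1 := hP.card_verts
  have h2 : P.verts = Set.univ := by
    apply Set.eq_of_subset_of_ncard_le (Set.subset_univ _) _ Set.finite_univ
    rw [Set.ncard_univ, ← Nat.card_coe_set_eq]
    omega
  rw [h2]
  trivial

/-! ### The graph `K₃,₃` is not planar -/

/-- A continuous logarithm of a nowhere vanishing function on the plane. -/
theorem exists_continuous_exp_eq {g : ℝ × ℝ → ℂ} (hg : Continuous g) (h0 : ∀ p, g p ≠ 0) :
    ∃ L : ℝ × ℝ → ℂ, Continuous L ∧ ∀ p, Complex.exp (L p) = g p := by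
  obtain ⟨F, ⟨-, hF⟩, -⟩ := Complex.isCoveringMapOn_exp.existsUnique_continuousMap_lifts
    ⟨g, hg⟩ (a₀ := 0) (Complex.exp_log (h0 0)) (fun p => h0 p)
  exact ⟨F, F.continuous, fun p => congrFun hF p⟩

/-- Two continuous logarithms of functions that differ by a constant factor have the same
variation. -/
theorem variation_eq_of_exp_eq {f g : ℝ → ℂ} (hf : Continuous f) (hg : Continuous g) {c : ℂ}
    (h : ∀ t, Complex.exp (f t) = c * Complex.exp (g t)) : f 1 - f 0 = g 1 - g 0 := by
  have key := Complex.isCoveringMap_exp.eq_of_comp_eq hf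
    (g₂ := fun t => g t + (f 0 - g 0)) (by fun_prop) (by
      funext t
      apply Subtype.ext
      simp only [Function.comp_apply]
      rw [Complex.exp_add, Complex.exp_sub, h t, h 0]
      field_simp) 0 (by ring)
  have := congrFun key 1
  rw [this]
  ring

/-- There is no system of nine curves that join three points to three points such that any two
curves without a common end are disjoint. For two such curves `γ`, `γ'` the nowhere vanishing
function `γ(s) - γ'(t)` has a continuous logarithm on the square, whose variation along the
boundary of the square is zero. Each of the four sides contributes the variation of the argument
along a curve seen from a point; modulo `2π` this depends on the points only. Counted modulo 2, each
such variation occurs twice in the sum over all pairs of curves, but the contributions of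
the points add up to an odd number. -/
theorem false_of_nine_curves (a b : Fin 3 → ℂ) (γ : Fin 3 → Fin 3 → ℝ → ℂ)
    (hγ : ∀ i j, Continuous (γ i j)) (h0 : ∀ i j, γ i j 0 = a i) (h1 : ∀ i j, γ i j 1 = b j)
    (hd : ∀ i k j l, i ≠ k → j ≠ l → ∀ s t, γ i j s ≠ γ k l t) : False := by
  have hother : ∀ i : Fin 3, ∃ j, i ≠ j := by decide
  -- logarithms of the curves as seen from the points that are not their ends
  have hA : ∀ k i j, ∃ L : ℝ → ℂ, i ≠ k → Continuous L ∧
      ∀ s, Complex.exp (L s) = γ i j s - a k := by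
    intro k i j
    by_cases hik : i ≠ k
    · obtain ⟨l, hl⟩ := hother j
      obtain ⟨L, hL, hexp⟩ := exists_continuous_exp_eq (g := fun p => γ i j p.1 - a k)
        (((hγ i j).comp continuous_fst).sub continuous_const) (fun p => by
          rw [sub_ne_zero, ← h0 k l]
          exact hd i k j l hik hl _ _)
      exact ⟨fun s => L (s, 0), fun _ => ⟨by fun_prop, fun s => hexp (s, 0)⟩⟩
    · exact ⟨0, fun h => absurd h hik⟩
  have hB : ∀ l i j, ∃ L : ℝ → ℂ, j ≠ l → Continuous L ∧
      ∀ s, Complex.exp (L s) = γ i j s - b l := by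
    intro l i j
    by_cases hjl : j ≠ l
    · obtain ⟨k, hk⟩ := hother i
      obtain ⟨L, hL, hexp⟩ := exists_continuous_exp_eq (g := fun p => γ i j p.1 - b l)
        (((hγ i j).comp continuous_fst).sub continuous_const) (fun p => by
          rw [sub_ne_zero, ← h1 k l]
          exact hd i k j l hk hjl _ _)
      exact ⟨fun s => L (s, 0), fun _ => ⟨by fun_prop, fun s => hexp (s, 0)⟩⟩
    · exact ⟨0, fun h => absurd h hjl⟩
  choose LA hLA using hA
  choose LB hLB using hB
  -- the boundary of the square
  have hsq : ∀ i k j l, i ≠ k → j ≠ l → (LA k i j 1 - LA k i j 0) + (LB j k l 1 - LB j k l 0) =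
      (LB l i j 1 - LB l i j 0) + (LA i k l 1 - LA i k l 0) := by
    intro i k j l hik hjl
    obtain ⟨L, hL, hexp⟩ := exists_continuous_exp_eq (g := fun p => γ i j p.1 - γ k l p.2)
      (((hγ i j).comp continuous_fst).sub ((hγ k l).comp continuous_snd))
      (fun p => sub_ne_zero.2 (hd i k j l hik hjl _ _))
    have e1 := variation_eq_of_exp_eq (hLA k i j hik).1 (g := fun s => L (s, 0)) (c := 1)
      (by fun_prop) (fun t => by rw [(hLA k i j hik).2, hexp, h0, one_mul])
    have e2 := variation_eq_of_exp_eq (hLB j k l hjl.symm).1 (g := fun s => L (1, s)) (c := -1)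
      (by fun_prop) (fun t => by rw [(hLB j k l hjl.symm).2, hexp, h1]; ring)
    have e3 := variation_eq_of_exp_eq (hLB l i j hjl).1 (g := fun s => L (s, 1)) (c := 1)
      (by fun_prop) (fun t => by rw [(hLB l i j hjl).2, hexp, h1, one_mul])
    have e4 := variation_eq_of_exp_eq (hLA i k l hik.symm).1 (g := fun s => L (0, s)) (c := -1)
      (by fun_prop) (fun t => by rw [(hLA i k l hik.symm).2, hexp, h0]; ring)
    rw [e1, e2, e3, e4]
    ring
  -- logarithms of the differences of the points, which change by `πi` if the points are swapped
  have hlog : ∀ p : Fin 3 → ℂ, (∀ i k, i ≠ k → p i ≠ p k) → ∃ α : Fin 3 → Fin 3 → ℂ,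
      (∀ i k, i ≠ k → Complex.exp (α i k) = p i - p k) ∧
      ∀ i k, i < k → α k i = α i k + Real.pi * Complex.I := by
    intro p hp
    refine ⟨fun i k => if i < k then Complex.log (p i - p k) else
      Complex.log (p k - p i) + Real.pi * Complex.I, fun i k hik => ?_, fun i k hik => ?_⟩
    · by_cases h : i < k
      · simp only [h, if_true]
        exact Complex.exp_log (sub_ne_zero.2 (hp i k hik))
      · simp only [h, if_false]
        rw [Complex.exp_add, Complex.exp_log (sub_ne_zero.2 (hp k i hik.symm)),
          Complex.exp_pi_mul_I]
        ring
    · simp only [hik, hik.le.not_gt, if_true, if_false]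
  have hab : ∀ i j, b j ≠ a i := by
    intro i j
    obtain ⟨k, hk⟩ := hother i
    obtain ⟨l, hl⟩ := hother j
    rw [← h1 k j, ← h0 i l]
    exact hd k i j l hk.symm hl _ _
  obtain ⟨α, hα, hα'⟩ := hlog a fun i k hik => by
    rw [← h0 i 0, ← h0 k 1]
    exact hd i k 0 1 hik (by decide) _ _
  obtain ⟨β, hβ, hβ'⟩ := hlog b fun j l hjl => by
    rw [← h1 0 j, ← h1 1 l]
    exact hd 0 1 j l (by decide) hjl _ _
  have hnA : ∀ k i j, ∃ n : ℤ, i ≠ k → LA k i j 1 - LA k i j 0 =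
      Complex.log (b j - a k) - α i k + n * (2 * Real.pi * Complex.I) := by
    intro k i j
    by_cases hik : i ≠ k
    · have : Complex.exp (LA k i j 1 - LA k i j 0) =
          Complex.exp (Complex.log (b j - a k) - α i k) := by
        rw [Complex.exp_sub, Complex.exp_sub, (hLA k i j hik).2, (hLA k i j hik).2, h0, h1,
          Complex.exp_log (sub_ne_zero.2 (hab k j)), hα i k hik]
      obtain ⟨n, hn⟩ := Complex.exp_eq_exp_iff_exists_int.1 this
      exact ⟨n, fun _ => hn⟩
    · exact ⟨0, fun h => absurd h hik⟩
  have hnB : ∀ l i j, ∃ n : ℤ, j ≠ l → LB l i j 1 - LB l i j 0 =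
      β j l - (Complex.log (b l - a i) + Real.pi * Complex.I) +
        n * (2 * Real.pi * Complex.I) := by
    intro l i j
    by_cases hjl : j ≠ l
    · have : Complex.exp (LB l i j 1 - LB l i j 0) =
          Complex.exp (β j l - (Complex.log (b l - a i) + Real.pi * Complex.I)) := by
        rw [Complex.exp_sub, Complex.exp_sub, (hLB l i j hjl).2, (hLB l i j hjl).2, h0, h1,
          Complex.exp_add, Complex.exp_log (sub_ne_zero.2 (hab i l)), hβ j l hjl,
          Complex.exp_pi_mul_I]
        congr 1
        ring
      obtain ⟨n, hn⟩ := Complex.exp_eq_exp_iff_exists_int.1 this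
      exact ⟨n, fun _ => hn⟩
    · exact ⟨0, fun h => absurd h hjl⟩
  choose nA hnA using hnA
  choose nB hnB using hnB
  have hpi : (2 * Real.pi * Complex.I : ℂ) ≠ 0 := Complex.two_pi_I_ne_zero
  have hlt : ∀ i k j l, i < k → j < l →
      nA k i j + nB j k l - nB l i j - nA i k l + 1 = 0 := by
    intro i k j l hik hjl
    have h := hsq i k j l hik.ne hjl.ne
    rw [hnA k i j hik.ne, hnB j k l hjl.ne', hnB l i j hjl.ne, hnA i k l hik.ne',
      hα' i k hik, hβ' j l hjl] at h
    have h2 : ((nA k i j + nB j k l - nB l i j - nA i k l + 1 : ℤ) : ℂ) *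
        (2 * Real.pi * Complex.I) = 0 := by
      push_cast
      linear_combination h
    exact_mod_cast (mul_eq_zero.1 h2).resolve_right hpi
  have hgt : ∀ i k j l, i < k → l < j → nA k i j + nB j k l - nB l i j - nA i k l = 0 := by
    intro i k j l hik hjl
    have h := hsq i k j l hik.ne hjl.ne'
    rw [hnA k i j hik.ne, hnB j k l hjl.ne, hnB l i j hjl.ne', hnA i k l hik.ne',
      hα' i k hik, hβ' l j hjl] at h
    have h2 : ((nA k i j + nB j k l - nB l i j - nA i k l : ℤ) : ℂ) *
        (2 * Real.pi * Complex.I) = 0 := by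
      push_cast
      linear_combination h
    exact_mod_cast (mul_eq_zero.1 h2).resolve_right hpi
  have p1 := hlt 0 1 0 1 (by decide) (by decide)
  have p2 := hlt 0 1 0 2 (by decide) (by decide)
  have p3 := hlt 0 1 1 2 (by decide) (by decide)
  have p4 := hlt 0 2 0 1 (by decide) (by decide)
  have p5 := hlt 0 2 0 2 (by decide) (by decide)
  have p6 := hlt 0 2 1 2 (by decide) (by decide)
  have p7 := hlt 1 2 0 1 (by decide) (by decide)
  have p8 := hlt 1 2 0 2 (by decide) (by decide)
  have p9 := hlt 1 2 1 2 (by decide) (by decide)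
  have q1 := hgt 0 1 1 0 (by decide) (by decide)
  have q2 := hgt 0 1 2 0 (by decide) (by decide)
  have q3 := hgt 0 1 2 1 (by decide) (by decide)
  have q4 := hgt 0 2 1 0 (by decide) (by decide)
  have q5 := hgt 0 2 2 0 (by decide) (by decide)
  have q6 := hgt 0 2 2 1 (by decide) (by decide)
  have q7 := hgt 1 2 1 0 (by decide) (by decide)
  have q8 := hgt 1 2 2 0 (by decide) (by decide)
  have q9 := hgt 1 2 2 1 (by decide) (by decide)
  omega

theorem not_isPlanar_of_K33 {V : Type} {G : SimpleGraph V} (a b : Fin 3 → V)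
    (ha : Function.Injective a) (hb : Function.Injective b) (hab : ∀ i j, G.Adj (a i) (b j)) :
    ¬ IsPlanar G := by
  rintro ⟨pt, arc, -, harc, -, hd⟩
  choose γ _ hr using fun i j => harc _ _ (hab i j)
  let e := Complex.equivRealProdCLM.symm
  refine false_of_nine_curves (fun i => e (pt (a i))) (fun j => e (pt (b j)))
    (fun i j t => e ((γ i j).extend t)) (fun i j => by fun_prop) (by simp) (by simp) ?_
  intro i k j l hik hjl s t h
  have hne : ∀ i j, a i ≠ b j := fun i j => (hab i j).ne
  have h := e.injective h
  have hs : s(a i, b j) ≠ s(a k, b l) := by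
    intro h'
    rcases Sym2.eq_iff.1 h' with h' | h'
    · exact hik (ha h'.1)
    · exact hne i l h'.1
  have hmem : ∀ i j t, (γ i j).extend t ∈ arc s(a i, b j) := fun i j t => by
    rw [← hr i j, ← (γ i j).extend_range]
    exact ⟨t, rfl⟩
  obtain ⟨w, ⟨hw1, hw2⟩, -⟩ := hd s(a i, b j) (hab i j) s(a k, b l) (hab k l) hs
    ⟨hmem i j s, h ▸ hmem k l t⟩
  rcases Sym2.mem_iff.1 hw1 with rfl | rfl <;> rcases Sym2.mem_iff.1 hw2 with h2 | h2
  · exact hik (ha h2)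
  · exact hne i l h2
  · exact hne k j h2.symm
  · exact hjl (hb h2)

/-- A cubic bipartite graph with six vertices is `K₃,₃`. -/
theorem IsCBP.card_ne_six {V : Type} {G : SimpleGraph V} (h : IsCBP G) : Nat.card V ≠ 6 := by
  intro h6
  have := h.finite
  obtain ⟨c⟩ := h.bipartite
  have hN : ∀ v i, c v ≠ i → G.neighborSet v ⊆ {w | c w = i} := by
    intro v i hv w hw
    have := c.valid hw
    change c w = i
    omega
  have hne : Nonempty V := by
    rw [← not_isEmpty_iff]
    intro h0
    simp at h6
  -- both colour classes contain the three neighbours of a vertex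
  have h3 : ∀ i, 3 ≤ {w | c w = i}.ncard := by
    have hstep : ∀ v i, c v ≠ i → 3 ≤ {w | c w = i}.ncard := fun v i hv => by
      rw [← h.cubic v]
      exact Set.ncard_le_ncard (hN v i hv)
    intro i
    obtain ⟨v⟩ := hne
    by_cases hv : c v = i
    · obtain ⟨w, hw⟩ : (G.neighborSet v).Nonempty :=
        Set.nonempty_of_ncard_ne_zero (by rw [h.cubic v]; norm_num)
      exact hstep w i (hv ▸ (c.valid hw).symm)
    · exact hstep v i hv
  have hsum : {w | c w = 0}.ncard + {w | c w = 1}.ncard = 6 := by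
    rw [← Set.ncard_union_eq, ← h6, ← Set.ncard_univ]
    · congr 1
      ext w
      simp only [Set.mem_union, Set.mem_ofPred_eq, Set.mem_univ, iff_true]
      omega
    · rw [Set.disjoint_left]
      intro w (h0 : c w = 0) (h1 : c w = 1)
      omega
  have hc : ∀ i, Nat.card {w | c w = i} = 3 := by
    intro i
    rw [Nat.card_coe_set_eq]
    have := h3 0
    have := h3 1
    fin_cases i <;> simp only [Fin.zero_eta, Fin.mk_one] <;> omega
  let e := fun i => (Finite.equivFinOfCardEq (hc i)).symm
  refine not_isPlanar_of_K33 (fun i => (e 0 i : V)) (fun j => (e 1 j : V))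
    (Subtype.val_injective.comp (e 0).injective) (Subtype.val_injective.comp (e 1).injective)
    (fun i j => ?_) h.planar
  have h0 : c (e 0 i : V) = 0 := (e 0 i).2
  have heq := Set.eq_of_subset_of_ncard_le (hN (e 0 i : V) 1 (by rw [h0]; decide))
    (by rw [h.cubic, ← Nat.card_coe_set_eq, hc])
  exact heq.symm.subset (e 1 j).2

/-! ### Cubic, bipartite and 2-connected graphs are closed under gluing -/

/-- Every set of vertices that is closed under the adjacency of `G - v` contains all or none of the
vertices of `G - v`; in other words, `G - v` is preconnected. -/
def IsTight {V : Type} (G : SimpleGraph V) (v : V) : Prop :=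
  ∀ c : V → Prop, (∀ x y, x ≠ v → y ≠ v → G.Adj x y → (c x ↔ c y)) →
    ∀ x y, x ≠ v → y ≠ v → (c x ↔ c y)

theorem isTight_iff_preconnected {V : Type} {G : SimpleGraph V} {v : V} :
    IsTight G v ↔ (G.induce {w : V | w ≠ v}).Preconnected := by
  constructor
  · intro h x y
    have := (h (fun w => ∃ hw : w ≠ v, (G.induce {w : V | w ≠ v}).Reachable x ⟨w, hw⟩) ?_
      x y x.2 y.2).1 ⟨x.2, .refl _⟩
    · exact this.2
    · rintro u w hu hw huw
      have huw' : (G.induce {w : V | w ≠ v}).Adj ⟨u, hu⟩ ⟨w, hw⟩ := huw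
      exact ⟨fun ⟨_, hr⟩ => ⟨hw, hr.trans huw'.reachable⟩,
        fun ⟨_, hr⟩ => ⟨hu, hr.trans huw'.reachable.symm⟩⟩
  · intro h c hc x y hx hy
    obtain ⟨p⟩ := h ⟨x, hx⟩ ⟨y, hy⟩
    have : ∀ {u w : {w : V | w ≠ v}} (p : (G.induce {w : V | w ≠ v}).Walk u w),
        (c u ↔ c w) := by
      intro u w p
      induction p with
      | nil => rfl
      | @cons u u' _ hadj _ ih => exact (hc u u' u.2 u'.2 hadj).trans ih
    exact this p

theorem exists_ne_ne_of_three_le_card {V : Type} (h : 3 ≤ Nat.card V) (x y : V) :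
    ∃ v, v ≠ x ∧ v ≠ y := by
  have : Finite V := Nat.finite_of_card_ne_zero (by omega)
  by_contra! hcon
  have h1 : (Set.univ : Set V) ⊆ {x, y} := fun v _ => by
    by_cases hv : v = x
    · exact Or.inl hv
    · exact Or.inr (hcon v hv)
  have h2 := Set.ncard_le_ncard h1
  have h3 := Set.ncard_insert_le x {y}
  rw [Set.ncard_univ] at h2
  rw [Set.ncard_singleton] at h3
  omega

theorem isTwoConnected_iff {V : Type} {G : SimpleGraph V} :
    IsTwoConnected G ↔ 3 ≤ Nat.card V ∧ ∀ v, IsTight G v := by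
  constructor
  · exact fun h => ⟨h.1, fun v => isTight_iff_preconnected.2 (h.2.2 v).preconnected⟩
  · rintro ⟨h3, h⟩
    have : Finite V := Nat.finite_of_card_ne_zero (by omega)
    have : Nonempty V := (Nat.card_pos_iff.1 (by omega)).1
    refine ⟨h3, ⟨fun x y => ?_⟩, fun v => ?_⟩
    · obtain ⟨v, hvx, hvy⟩ := exists_ne_ne_of_three_le_card h3 x y
      have := isTight_iff_preconnected.1 (h v) ⟨x, hvx.symm⟩ ⟨y, hvy.symm⟩
      exact this.map (SimpleGraph.Embedding.induce _).toHom
    · obtain ⟨w, hw, -⟩ := exists_ne_ne_of_three_le_card h3 v v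
      have : Nonempty {w : V | w ≠ v} := ⟨⟨w, hw⟩⟩
      exact ⟨isTight_iff_preconnected.1 (h v)⟩

/-- A 2-connected graph has no bridge. -/
theorem iff_of_adj_ne_edge {V : Type} {G : SimpleGraph V} (hG : IsTwoConnected G) {a₁ a₂ : V}
    (ha : a₁ ≠ a₂)
    (c : V → Prop) (hc : ∀ x y, G.Adj x y → s(x, y) ≠ s(a₁, a₂) → (c x ↔ c y)) (x y : V) :
    c x ↔ c y := by
  rw [isTwoConnected_iff] at hG
  obtain ⟨w, hw₁, hw₂⟩ := exists_ne_ne_of_three_le_card hG.1 a₁ a₂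
  have h1 : ∀ x, x ≠ a₁ → (c x ↔ c w) := fun x hx =>
    hG.2 a₁ c (fun u v hu hv h => hc u v h (by grind)) x w hx hw₁
  have h2 : ∀ x, x ≠ a₂ → (c x ↔ c w) := fun x hx =>
    hG.2 a₂ c (fun u v hu hv h => hc u v h (by grind)) x w hx hw₂
  have h3 : ∀ x, (c x ↔ c w) := fun x => by
    by_cases hx : x = a₁
    · exact h2 x (hx ▸ ha)
    · exact h1 x hx
  exact (h3 x).trans (h3 y).symm

/-- Two graphs without the edges `a₁a₂` and `b₁b₂` hang together by two links `a₁b₁` and `a₂b₂`,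
even after the deletion of a vertex `v` of the first one. -/
theorem iff_of_two_links {V W : Type} {A : SimpleGraph V} {B : SimpleGraph W}
    (hA : IsTwoConnected A) (hB : IsTwoConnected B) {a₁ a₂ v : V} {b₁ b₂ : W}
    (ha : a₁ ≠ a₂) (hb : b₁ ≠ b₂) {p : V → Prop} {q : W → Prop}
    (hp : ∀ x y, x ≠ v → y ≠ v → A.Adj x y → s(x, y) ≠ s(a₁, a₂) → (p x ↔ p y))
    (hq : ∀ x y, B.Adj x y → s(x, y) ≠ s(b₁, b₂) → (q x ↔ q y))
    (h₁ : a₁ ≠ v → (p a₁ ↔ q b₁)) (h₂ : a₂ ≠ v → (p a₂ ↔ q b₂)) :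
    (∀ x, x ≠ v → (p x ↔ q b₁)) ∧ ∀ y, q y ↔ q b₁ := by
  have hB' := fun y => iff_of_adj_ne_edge hB hb q hq y b₁
  refine ⟨fun x hx => ?_, hB'⟩
  have hA' : ∀ x y, x ≠ v → y ≠ v → (p x ↔ p y) := by
    refine (isTwoConnected_iff.1 hA).2 v p fun x y hx hy hxy => ?_
    by_cases he : s(x, y) = s(a₁, a₂)
    · have := hB' b₂
      rcases Sym2.eq_iff.1 he with ⟨rfl, rfl⟩ | ⟨rfl, rfl⟩
      · rw [h₁ hx, h₂ hy, this]
      · rw [h₁ hy, h₂ hx, this]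
    · exact hp x y hx hy hxy he
  by_cases hv : a₁ = v
  · rw [hA' x a₂ hx (hv ▸ ha.symm), h₂ (hv ▸ ha.symm), hB']
  · rw [hA' x a₁ hx hv, h₁ hv]

theorem IsTwoConnected.glueEdge {V W : Type} {A : SimpleGraph V} {B : SimpleGraph W}
    (hA : IsTwoConnected A) (hB : IsTwoConnected B) {a₁ a₂ : V} {b₁ b₂ : W}
    (ha : a₁ ≠ a₂) (hb : b₁ ≠ b₂) : IsTwoConnected (glueEdge A a₁ a₂ B b₁ b₂) := by
  have : Finite V := Nat.finite_of_card_ne_zero (by have := hA.1; omega)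
  have : Finite W := Nat.finite_of_card_ne_zero (by have := hB.1; omega)
  refine isTwoConnected_iff.2 ⟨by have := hA.1; rw [Nat.card_sum]; omega, ?_⟩
  rintro (v | v) c hc
  · have := iff_of_two_links hA hB (v := v) ha hb (p := fun x => c (Sum.inl x))
      (q := fun y => c (Sum.inr y))
      (fun x y hx hy h hs => hc _ _ (by simpa) (by simpa) ⟨h, hs⟩)
      (fun x y h hs => hc _ _ (by simp) (by simp) ⟨h, hs⟩)
      (fun h => hc _ _ (by simpa) (by simp) (Or.inl ⟨rfl, rfl⟩))
      (fun h => hc _ _ (by simpa) (by simp) (Or.inr ⟨rfl, rfl⟩))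
    rintro (x | x) (y | y) hx hy <;> simp_all
  · have := iff_of_two_links hB hA (v := v) hb ha (p := fun x => c (Sum.inr x))
      (q := fun y => c (Sum.inl y))
      (fun x y hx hy h hs => hc _ _ (by simpa) (by simpa) ⟨h, hs⟩)
      (fun x y h hs => hc _ _ (by simp) (by simp) ⟨h, hs⟩)
      (fun h => hc _ _ (by simpa) (by simp) (Or.inl ⟨rfl, rfl⟩))
      (fun h => hc _ _ (by simpa) (by simp) (Or.inr ⟨rfl, rfl⟩))
    rintro (x | x) (y | y) hx hy <;> simp_all

theorem IsTwoConnected.glueMiddle {V W : Type} {A : SimpleGraph V} {B : SimpleGraph W}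
    (hA : IsTwoConnected A) (hB : IsTwoConnected B) {a₁ a₂ : V} {b₁ b₂ : W}
    (ha : a₁ ≠ a₂) (hb : b₁ ≠ b₂) : IsTwoConnected (glueMiddle A a₁ a₂ B b₁ b₂) := by
  have : Finite V := Nat.finite_of_card_ne_zero (by have := hA.1; omega)
  have : Finite W := Nat.finite_of_card_ne_zero (by have := hB.1; omega)
  refine isTwoConnected_iff.2 ⟨by have := hA.1; rw [Nat.card_sum]; omega, ?_⟩
  rintro (v | v | i) c hc
  · have hz1 := hc (Sum.inr (Sum.inr 0)) (Sum.inr (Sum.inl b₁)) (by simp) (by simp)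
      (Or.inl ⟨rfl, rfl⟩)
    have hz2 := hc (Sum.inr (Sum.inr 1)) (Sum.inr (Sum.inl b₂)) (by simp) (by simp)
      (Or.inr ⟨rfl, rfl⟩)
    have := iff_of_two_links hA hB (v := v) ha hb (p := fun x => c (Sum.inl x))
      (q := fun y => c (Sum.inr (Sum.inl y)))
      (fun x y hx hy h hs => hc _ _ (by simpa) (by simpa) ⟨h, hs⟩)
      (fun x y h hs => hc _ _ (by simp) (by simp) ⟨h, hs⟩)
      (fun h => (hc (Sum.inl a₁) (Sum.inr (Sum.inr 0))
        (by simpa) (by simp) (Or.inl ⟨rfl, rfl⟩)).trans hz1)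
      (fun h => (hc (Sum.inl a₂) (Sum.inr (Sum.inr 1))
        (by simpa) (by simp) (Or.inr ⟨rfl, rfl⟩)).trans hz2)
    have key : ∀ x, x ≠ Sum.inl v → (c x ↔ c (Sum.inr (Sum.inl b₁))) := by
      rintro (x | x | i) hx
      · exact this.1 x (by simpa using hx)
      · exact this.2 x
      · have := this.2 b₂
        fin_cases i <;> simp_all
    exact fun x y hx hy => (key x hx).trans (key y hy).symm
  · have hz1 := hc (Sum.inr (Sum.inr 0)) (Sum.inl a₁) (by simp) (by simp)
      (Or.inl ⟨rfl, rfl⟩)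
    have hz2 := hc (Sum.inr (Sum.inr 1)) (Sum.inl a₂) (by simp) (by simp)
      (Or.inr ⟨rfl, rfl⟩)
    have := iff_of_two_links hB hA (v := v) hb ha (p := fun x => c (Sum.inr (Sum.inl x)))
      (q := fun y => c (Sum.inl y))
      (fun x y hx hy h hs => hc _ _ (by simpa) (by simpa) ⟨h, hs⟩)
      (fun x y h hs => hc _ _ (by simp) (by simp) ⟨h, hs⟩)
      (fun h => (hc (Sum.inr (Sum.inl b₁)) (Sum.inr (Sum.inr 0))
        (by simpa) (by simp) (Or.inl ⟨rfl, rfl⟩)).trans hz1)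
      (fun h => (hc (Sum.inr (Sum.inl b₂)) (Sum.inr (Sum.inr 1))
        (by simpa) (by simp) (Or.inr ⟨rfl, rfl⟩)).trans hz2)
    have key : ∀ x, x ≠ Sum.inr (Sum.inl v) → (c x ↔ c (Sum.inl a₁)) := by
      rintro (x | x | i) hx
      · exact this.2 x
      · exact this.1 x (by simpa using hx)
      · have := this.2 a₂
        fin_cases i <;> simp_all
    exact fun x y hx hy => (key x hx).trans (key y hy).symm
  · have hA' := iff_of_adj_ne_edge hA ha (fun x => c (Sum.inl x))
      (fun x y h hs => hc _ _ (by simp) (by simp) ⟨h, hs⟩)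
    have hB' := iff_of_adj_ne_edge hB hb (fun x => c (Sum.inr (Sum.inl x)))
      (fun x y h hs => hc _ _ (by simp) (by simp) ⟨h, hs⟩)
    -- the middle vertex `z j` that is left links both sides
    have key : ∀ j : Fin 2, j ≠ i → ∀ x, x ≠ Sum.inr (Sum.inr i) →
        (c x ↔ c (Sum.inr (Sum.inr j))) := by
      intro j hj
      obtain ⟨a, ha⟩ : ∃ a, c (Sum.inl a) ↔ c (Sum.inr (Sum.inr j)) := by
        fin_cases j
        · exact ⟨a₁, hc _ _ (by simp) (by simpa using hj) (Or.inl ⟨rfl, rfl⟩)⟩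
        · exact ⟨a₂, hc _ _ (by simp) (by simpa using hj) (Or.inr ⟨rfl, rfl⟩)⟩
      obtain ⟨b, hb⟩ : ∃ b, c (Sum.inr (Sum.inl b)) ↔ c (Sum.inr (Sum.inr j)) := by
        fin_cases j
        · exact ⟨b₁, hc _ _ (by simp) (by simpa using hj) (Or.inl ⟨rfl, rfl⟩)⟩
        · exact ⟨b₂, hc _ _ (by simp) (by simpa using hj) (Or.inr ⟨rfl, rfl⟩)⟩
      rintro (x | x | k) hx
      · exact (hA' x a).trans ha
      · exact (hB' x b).trans hb
      · have : k = j := by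
          have : k ≠ i := by simpa using hx
          omega
        rw [this]
    obtain ⟨j, hj⟩ : ∃ j, j ≠ i := exists_ne i
    exact fun x y hx hy => (key j hj x hx).trans (key j hj y hy).symm

/-- Two graphs without the vertices `a` and `b` hang together by the links `xσ(x)`, even after
the deletion of a vertex `v ≠ a` of the first one. -/
theorem iff_of_vertex_links {V W : Type} {A : SimpleGraph V} {B : SimpleGraph W}
    (hA : IsTwoConnected A) (hB : IsTwoConnected B) {a v : V} {b : W} (hv : v ≠ a)
    (σ : A.neighborSet a → B.neighborSet b) {p : V → Prop} {q : W → Prop}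
    (hp : ∀ x y, x ≠ v → y ≠ v → x ≠ a → y ≠ a → A.Adj x y → (p x ↔ p y))
    (hq : ∀ x y, x ≠ b → y ≠ b → B.Adj x y → (q x ↔ q y))
    (hσ : ∀ x : A.neighborSet a, (x : V) ≠ v → (p x ↔ q (σ x))) {w : W} (hw : w ≠ b) :
    (∀ x, x ≠ a → x ≠ v → (p x ↔ q w)) ∧ ∀ y, y ≠ b → (q y ↔ q w) := by
  have hB' : ∀ y, y ≠ b → (q y ↔ q w) := fun y hy => (isTwoConnected_iff.1 hB).2 b q hq y w hy hw
  refine ⟨fun x hxa hxv => ?_, hB'⟩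
  -- the vertex `a` stands for all of `B - b`
  have := (isTwoConnected_iff.1 hA).2 v (fun x => (x = a ∧ q w) ∨ (x ≠ a ∧ p x)) ?_ x a hxv hv.symm
  · simpa [hxa] using this
  · intro x y hx hy hxy
    have key : ∀ x, x ≠ v → A.Adj a x → (p x ↔ q w) := fun x hx h => by
      rw [hσ ⟨x, h⟩ hx]
      exact hB' _ (B.ne_of_adj (σ ⟨x, h⟩).2).symm
    by_cases hxa : x = a
    · subst hxa
      simpa [hxy.ne'] using (key y hy hxy).symm
    · by_cases hya : y = a
      · subst hya
        simpa [hxy.ne] using key x hx hxy.symm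
      · simpa [hxa, hya] using hp x y hx hy hxa hya hxy

theorem IsTwoConnected.glueVertex {V W : Type} {A : SimpleGraph V} {B : SimpleGraph W}
    (hA : IsTwoConnected A) (hB : IsTwoConnected B) {a : V} {b : W}
    (σ : A.neighborSet a ≃ B.neighborSet b) : IsTwoConnected (glueVertex A a B b σ) := by
  have : Finite V := Nat.finite_of_card_ne_zero (by have := hA.1; omega)
  have : Finite W := Nat.finite_of_card_ne_zero (by have := hB.1; omega)
  have hcard : ∀ {V : Type} [Finite V] (a : V), Nat.card {x // x ≠ a} + 1 = Nat.card V := by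
    intro V _ a
    have := Set.ncard_sdiff_singleton_add_one (Set.mem_univ a)
    rw [Set.ncard_univ] at this
    rw [← this, ← Nat.card_coe_set_eq]
    congr 1
    exact Nat.card_congr (Equiv.subtypeEquivRight (by simp))
  refine isTwoConnected_iff.2 ⟨?_, ?_⟩
  · have h1 := hA.1
    have h2 := hB.1
    have h3 := hcard a
    have h4 := hcard b
    rw [Nat.card_sum]
    omega
  rintro v c hc
  have hpx : ∀ {x} (h : x ≠ a), c (Sum.inl ⟨x, h⟩) ↔ ∃ h, c (Sum.inl ⟨x, h⟩) :=
    fun h => ⟨fun h' => ⟨h, h'⟩, fun h' => h'.2⟩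
  have hqy : ∀ {y} (h : y ≠ b), c (Sum.inr ⟨y, h⟩) ↔ ∃ h, c (Sum.inr ⟨y, h⟩) :=
    fun h => ⟨fun h' => ⟨h, h'⟩, fun h' => h'.2⟩
  rcases v with ⟨v, hv⟩ | ⟨v, hv⟩
  · obtain ⟨w, hw, -⟩ := exists_ne_ne_of_three_le_card hB.1 b b
    have := iff_of_vertex_links hA hB hv σ (p := fun x => ∃ h, c (Sum.inl ⟨x, h⟩))
      (q := fun y => ∃ h, c (Sum.inr ⟨y, h⟩))
      (fun x y hx hy hxa hya hxy => by
        rw [← hpx hxa, ← hpx hya]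
        exact hc _ _ (by simpa) (by simpa) hxy)
      (fun x y hx hy hxy => by
        rw [← hqy hx, ← hqy hy]
        exact hc _ _ (by simp) (by simp) hxy)
      (fun x hx => by
        rw [← hpx (A.ne_of_adj x.2).symm, ← hqy (B.ne_of_adj (σ x).2).symm]
        exact hc _ _ (by simpa) (by simp) ⟨x.2, rfl⟩) hw
    have key : ∀ x, x ≠ Sum.inl ⟨v, hv⟩ → (c x ↔ c (Sum.inr ⟨w, hw⟩)) := by
      rintro (⟨x, hx⟩ | ⟨x, hx⟩) hne
      · rw [hpx hx, hqy hw]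
        exact this.1 x hx (by simpa using hne)
      · rw [hqy hx, hqy hw]
        exact this.2 x hx
    exact fun x y hx hy => (key x hx).trans (key y hy).symm
  · obtain ⟨w, hw, -⟩ := exists_ne_ne_of_three_le_card hA.1 a a
    have := iff_of_vertex_links hB hA hv σ.symm (q := fun x => ∃ h, c (Sum.inl ⟨x, h⟩))
      (p := fun y => ∃ h, c (Sum.inr ⟨y, h⟩))
      (fun x y hx hy hxa hya hxy => by
        rw [← hqy hxa, ← hqy hya]
        exact hc _ _ (by simpa) (by simpa) hxy)
      (fun x y hx hy hxy => by
        rw [← hpx hx, ← hpx hy]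
        exact hc _ _ (by simp) (by simp) hxy)
      (fun x hx => by
        rw [← hqy (B.ne_of_adj x.2).symm, ← hpx (A.ne_of_adj (σ.symm x).2).symm]
        exact hc _ _ (by simpa) (by simp) ⟨(σ.symm x).2, by simp⟩) hw
    have key : ∀ x, x ≠ Sum.inr ⟨v, hv⟩ → (c x ↔ c (Sum.inl ⟨w, hw⟩)) := by
      rintro (⟨x, hx⟩ | ⟨x, hx⟩) hne
      · rw [hpx hx, hpx hw]
        exact this.2 x hx
      · rw [hqy hx, hpx hw]
        exact this.1 x hx (by simpa using hne)
    exact fun x y hx hy => (key x hx).trans (key y hy).symm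

/-- A vertex whose neighbours correspond to those of a vertex with three neighbours has three
neighbours. -/
theorem ncard_neighborSet_eq_three {V V' : Type} {G : SimpleGraph V} {G' : SimpleGraph V'} {x : V}
    {x' : V'} (h : (G.neighborSet x).ncard = 3) (φ : ∀ y, G.Adj x y → V')
    (hmaps : ∀ y h, G'.Adj x' (φ y h)) (hinj : ∀ y z hy hz, φ y hy = φ z hz → y = z)
    (hsurj : ∀ y', G'.Adj x' y' → ∃ y h, φ y h = y') : (G'.neighborSet x').ncard = 3 := by
  rw [← h]
  exact (Set.ncard_congr φ hmaps hinj fun y' hy' => hsurj y' hy').symm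

open Classical in
theorem IsCubic.glueEdge {V W : Type} {A : SimpleGraph V} {B : SimpleGraph W}
    (hA : IsCubic A) (hB : IsCubic B) {a₁ a₂ : V} {b₁ b₂ : W}
    (ha : A.Adj a₁ a₂) (hb : B.Adj b₁ b₂) : IsCubic (glueEdge A a₁ a₂ B b₁ b₂) := by
  have ha' := ha.ne
  have hb' := hb.ne
  rintro (x | x)
  · refine ncard_neighborSet_eq_three (hA x) (fun y _ => if s(x, y) = s(a₁, a₂) then
      (if x = a₁ then Sum.inr b₁ else Sum.inr b₂) else Sum.inl y) ?_ ?_ ?_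
    · intro y hy
      by_cases h : s(x, y) = s(a₁, a₂)
      · by_cases h1 : x = a₁
        · rw [if_pos h, if_pos h1]
          exact Or.inl (by simp [h1])
        · rw [if_pos h, if_neg h1]
          exact Or.inr ⟨by grind, rfl⟩
      · rw [if_neg h]
        exact ⟨hy, h⟩
    · intro y z hy hz hyz
      split_ifs at hyz <;> grind
    · rintro (y | y) hy
      · exact ⟨y, hy.1, if_neg hy.2⟩
      · rcases hy with ⟨rfl, rfl⟩ | ⟨rfl, rfl⟩
        · exact ⟨a₂, ha, by simp⟩
        · exact ⟨a₁, ha.symm, by simp [Sym2.eq_swap, ha'.symm]⟩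
  · refine ncard_neighborSet_eq_three (hB x) (fun y _ => if s(x, y) = s(b₁, b₂) then
      (if x = b₁ then Sum.inl a₁ else Sum.inl a₂) else Sum.inr y) ?_ ?_ ?_
    · intro y hy
      by_cases h : s(x, y) = s(b₁, b₂)
      · by_cases h1 : x = b₁
        · rw [if_pos h, if_pos h1]
          exact Or.inl (by simp [h1])
        · rw [if_pos h, if_neg h1]
          exact Or.inr ⟨rfl, by grind⟩
      · rw [if_neg h]
        exact ⟨hy, h⟩
    · intro y z hy hz hyz
      split_ifs at hyz <;> grind
    · rintro (y | y) hy
      · rcases hy with ⟨rfl, rfl⟩ | ⟨rfl, rfl⟩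
        · exact ⟨b₂, hb, by simp⟩
        · exact ⟨b₁, hb.symm, by simp [Sym2.eq_swap, hb'.symm]⟩
      · exact ⟨y, hy.1, if_neg hy.2⟩

open Classical in
theorem IsCubic.glueMiddle {V W : Type} {A : SimpleGraph V} {B : SimpleGraph W}
    (hA : IsCubic A) (hB : IsCubic B) {a₁ a₂ : V} {b₁ b₂ : W}
    (ha : A.Adj a₁ a₂) (hb : B.Adj b₁ b₂) : IsCubic (glueMiddle A a₁ a₂ B b₁ b₂) := by
  have ha' := ha.ne
  have hb' := hb.ne
  rintro (x | x | i)
  · refine ncard_neighborSet_eq_three (hA x) (fun y _ => if s(x, y) = s(a₁, a₂) then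
      (if x = a₁ then Sum.inr (Sum.inr 0) else Sum.inr (Sum.inr 1)) else Sum.inl y) ?_ ?_ ?_
    · intro y hy
      by_cases h : s(x, y) = s(a₁, a₂)
      · by_cases h1 : x = a₁
        · rw [if_pos h, if_pos h1]
          exact Or.inl (by simp [h1])
        · rw [if_pos h, if_neg h1]
          exact Or.inr ⟨by grind, rfl⟩
      · rw [if_neg h]
        exact ⟨hy, h⟩
    · intro y z hy hz hyz
      split_ifs at hyz <;> grind
    · rintro (y | y | i) hy
      · exact ⟨y, hy.1, if_neg hy.2⟩
      · exact hy.elim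
      · rcases hy with ⟨rfl, rfl⟩ | ⟨rfl, rfl⟩
        · exact ⟨a₂, ha, by simp⟩
        · exact ⟨a₁, ha.symm, by simp [Sym2.eq_swap, ha'.symm]⟩
  · refine ncard_neighborSet_eq_three (hB x) (fun y _ => if s(x, y) = s(b₁, b₂) then
      (if x = b₁ then Sum.inr (Sum.inr 0) else Sum.inr (Sum.inr 1)) else Sum.inr (Sum.inl y))
      ?_ ?_ ?_
    · intro y hy
      by_cases h : s(x, y) = s(b₁, b₂)
      · by_cases h1 : x = b₁
        · rw [if_pos h, if_pos h1]
          exact Or.inl (by simp [h1])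
        · rw [if_pos h, if_neg h1]
          exact Or.inr ⟨by grind, rfl⟩
      · rw [if_neg h]
        exact ⟨hy, h⟩
    · intro y z hy hz hyz
      split_ifs at hyz <;> grind
    · rintro (y | y | i) hy
      · exact hy.elim
      · exact ⟨y, hy.1, if_neg hy.2⟩
      · rcases hy with ⟨rfl, rfl⟩ | ⟨rfl, rfl⟩
        · exact ⟨b₂, hb, by simp⟩
        · exact ⟨b₁, hb.symm, by simp [Sym2.eq_swap, hb'.symm]⟩
  · obtain ⟨a, b, hab⟩ : ∃ a b, (LambdaPacking.glueMiddle A a₁ a₂ B b₁ b₂).neighborSet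
        (Sum.inr (Sum.inr i)) = {Sum.inl a, Sum.inr (Sum.inl b), Sum.inr (Sum.inr (i + 1))} := by
      fin_cases i
      · refine ⟨a₁, b₁, ?_⟩
        ext (y | y | j)
        · simp [LambdaPacking.glueMiddle]
        · simp [LambdaPacking.glueMiddle]
        · fin_cases j <;> simp [LambdaPacking.glueMiddle]
      · refine ⟨a₂, b₂, ?_⟩
        ext (y | y | j)
        · simp [LambdaPacking.glueMiddle]
        · simp [LambdaPacking.glueMiddle]
        · fin_cases j <;> simp [LambdaPacking.glueMiddle]
    rw [hab, Set.ncard_eq_three]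
    exact ⟨_, _, _, by simp, by simp, by simp, rfl⟩

open Classical in
theorem IsCubic.glueVertex {V W : Type} {A : SimpleGraph V} {B : SimpleGraph W}
    (hA : IsCubic A) (hB : IsCubic B) {a : V} {b : W}
    (σ : A.neighborSet a ≃ B.neighborSet b) : IsCubic (glueVertex A a B b σ) := by
  rintro (⟨x, hx⟩ | ⟨x, hx⟩)
  · refine ncard_neighborSet_eq_three (hA x) (fun y hy => if h : y = a then
      Sum.inr ⟨σ ⟨x, h ▸ hy.symm⟩, (B.ne_of_adj (σ ⟨x, h ▸ hy.symm⟩).2).symm⟩ else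
        Sum.inl ⟨y, h⟩) ?_ ?_ ?_
    · intro y hy
      by_cases h : y = a
      · simp only [h, dif_pos]
        exact ⟨h ▸ hy.symm, rfl⟩
      · simp only [h, dif_neg, not_false_iff]
        exact hy
    · intro y z hy hz hyz
      split_ifs at hyz <;> simp_all
    · rintro (⟨y, hy⟩ | ⟨y, hy⟩) h
      · exact ⟨y, h, dif_neg hy⟩
      · obtain ⟨h1, rfl⟩ := h
        exact ⟨a, h1.symm, by simp⟩
  · refine ncard_neighborSet_eq_three (hB x) (fun y hy => if h : y = b then
      Sum.inl ⟨σ.symm ⟨x, h ▸ hy.symm⟩, (A.ne_of_adj (σ.symm ⟨x, h ▸ hy.symm⟩).2).symm⟩ else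
        Sum.inr ⟨y, h⟩) ?_ ?_ ?_
    · intro y hy
      by_cases h : y = b
      · simp only [h, dif_pos]
        exact ⟨(σ.symm ⟨x, h ▸ hy.symm⟩).2, by simp⟩
      · simp only [h, dif_neg, not_false_iff]
        exact hy
    · intro y z hy hz hyz
      split_ifs at hyz <;> simp_all
    · rintro (⟨y, hy⟩ | ⟨y, hy⟩) h
      · obtain ⟨h1, h2⟩ := h
        have h2 : (σ ⟨y, h1⟩ : W) = x := h2
        have h3 : B.Adj x b := by
          rw [← h2]
          exact (σ ⟨y, h1⟩).2.symm
        refine ⟨b, h3, ?_⟩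
        have h4 : (⟨x, h3.symm⟩ : B.neighborSet b) = σ ⟨y, h1⟩ := Subtype.ext h2.symm
        simp [h4]
      · exact ⟨y, h, dif_neg hy⟩

theorem isBipartite_iff_exists_bool {V : Type} {G : SimpleGraph V} :
    G.IsBipartite ↔ ∃ c : V → Bool, ∀ u v, G.Adj u v → c u ≠ c v := by
  constructor
  · rintro ⟨c⟩
    exact ⟨fun v => finTwoEquiv (c v), fun u v h h' => c.valid h (finTwoEquiv.injective h')⟩
  · rintro ⟨c, hc⟩
    exact ⟨⟨fun v => finTwoEquiv.symm (c v), fun {u v} h h' =>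
      hc u v h (finTwoEquiv.symm.injective h')⟩⟩

/-- A bipartition in which a given vertex has a given side. -/
theorem exists_bool_of_isBipartite {V : Type} {G : SimpleGraph V} (h : G.IsBipartite) (v : V)
    (i : Bool) : ∃ c : V → Bool, c v = i ∧ ∀ u w, G.Adj u w → c u ≠ c w := by
  obtain ⟨c, hc⟩ := isBipartite_iff_exists_bool.1 h
  refine ⟨fun w => xor (c w) (xor (c v) i), by simp, fun u w huw => ?_⟩
  have := hc u w huw
  simpa using this

theorem isBipartite_glueEdge {V W : Type} {A : SimpleGraph V} {B : SimpleGraph W}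
    (hA : A.IsBipartite) (hB : B.IsBipartite) {a₁ a₂ : V} {b₁ b₂ : W}
    (ha : A.Adj a₁ a₂) (hb : B.Adj b₁ b₂) : (glueEdge A a₁ a₂ B b₁ b₂).IsBipartite := by
  obtain ⟨c, hca, hc⟩ := exists_bool_of_isBipartite hA a₁ false
  obtain ⟨d, hdb, hd⟩ := exists_bool_of_isBipartite hB b₁ true
  have h1 := hc _ _ ha
  have h2 := hd _ _ hb
  refine isBipartite_iff_exists_bool.2 ⟨Sum.elim c d, ?_⟩
  rintro (u | u) (v | v) h
  · exact hc u v h.1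
  · rcases h with ⟨rfl, rfl⟩ | ⟨rfl, rfl⟩ <;> simp_all
  · rcases h with ⟨rfl, rfl⟩ | ⟨rfl, rfl⟩ <;> simp_all
  · exact hd u v h.1

theorem isBipartite_glueMiddle {V W : Type} {A : SimpleGraph V} {B : SimpleGraph W}
    (hA : A.IsBipartite) (hB : B.IsBipartite) {a₁ a₂ : V} {b₁ b₂ : W}
    (ha : A.Adj a₁ a₂) (hb : B.Adj b₁ b₂) : (glueMiddle A a₁ a₂ B b₁ b₂).IsBipartite := by
  obtain ⟨c, hca, hc⟩ := exists_bool_of_isBipartite hA a₁ true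
  obtain ⟨d, hdb, hd⟩ := exists_bool_of_isBipartite hB b₁ true
  have h1 := hc _ _ ha
  have h2 := hd _ _ hb
  refine isBipartite_iff_exists_bool.2 ⟨Sum.elim c (Sum.elim d finTwoEquiv), ?_⟩
  rintro (u | u | i) (v | v | j) h
  · exact hc u v h.1
  · exact h.elim
  · rcases h with ⟨rfl, rfl⟩ | ⟨rfl, rfl⟩ <;> simp_all [finTwoEquiv]
  · exact h.elim
  · exact hd u v h.1
  · rcases h with ⟨rfl, rfl⟩ | ⟨rfl, rfl⟩ <;> simp_all [finTwoEquiv]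
  · rcases h with ⟨rfl, rfl⟩ | ⟨rfl, rfl⟩ <;> simp_all [finTwoEquiv]
  · rcases h with ⟨rfl, rfl⟩ | ⟨rfl, rfl⟩ <;> simp_all [finTwoEquiv]
  · exact fun h' => h (finTwoEquiv.injective h')

theorem isBipartite_glueVertex {V W : Type} {A : SimpleGraph V} {B : SimpleGraph W}
    (hA : A.IsBipartite) (hB : B.IsBipartite) {a : V} {b : W}
    (σ : A.neighborSet a ≃ B.neighborSet b) : (glueVertex A a B b σ).IsBipartite := by
  obtain ⟨c, hca, hc⟩ := exists_bool_of_isBipartite hA a false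
  obtain ⟨d, hdb, hd⟩ := exists_bool_of_isBipartite hB b true
  have key : ∀ x : A.neighborSet a, c x ≠ d (σ x) := fun x => by
    have h1 := hc _ _ x.2
    have h2 := hd _ _ (σ x).2
    simp_all
  refine isBipartite_iff_exists_bool.2 ⟨Sum.elim (fun x => c x) (fun y => d y), ?_⟩
  rintro (u | u) (v | v) h
  · exact hc u v h
  · obtain ⟨h1, h2⟩ := h
    have := key ⟨u, h1⟩
    rwa [h2] at this
  · obtain ⟨h1, h2⟩ := h
    have := key ⟨v, h1⟩
    rw [h2] at this
    exact this.symm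
  · exact hd u v h

/-- The class of finite cubic, bipartite, 2-connected graphs. -/
structure IsCubicBipartite {V : Type} (G : SimpleGraph V) : Prop where
  finite : Finite V
  twoConnected : IsTwoConnected G
  cubic : IsCubic G
  bipartite : G.IsBipartite

theorem IsCBP.isCubicBipartite {V : Type} {G : SimpleGraph V} (h : IsCBP G) : IsCubicBipartite G :=
  ⟨h.1, h.2, h.3, h.4⟩

theorem IsCubicBipartite.isCBP {V : Type} {G : SimpleGraph V} (h : IsCubicBipartite G)
    (hp : IsPlanar G) : IsCBP G :=
  ⟨h.1, h.2, h.3, h.4, hp⟩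

theorem IsCubicBipartite.of_iso {V W : Type} {A : SimpleGraph V} {B : SimpleGraph W} (e : A ≃g B)
    (h : IsCubicBipartite B) : IsCubicBipartite A := by
  obtain ⟨hf, ⟨h3, hc, ht⟩, hcub, hb⟩ := h
  have ht' := isTwoConnected_iff.1 ⟨h3, hc, ht⟩
  refine ⟨Finite.of_equiv _ e.symm.toEquiv, isTwoConnected_iff.2
    ⟨by rwa [Nat.card_congr e.toEquiv], fun v c hc x y hx hy => ?_⟩, fun v => ?_, ?_⟩
  · have := ht'.2 (e v) (fun w => c (e.symm w)) (fun x y hx hy hxy =>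
      hc _ _ (fun h => hx (by rw [← h, e.apply_symm_apply]))
        (fun h => hy (by rw [← h, e.apply_symm_apply])) (e.symm.map_rel_iff.2 hxy))
      (e x) (e y) (by simpa) (by simpa)
    simpa using this
  · refine ncard_neighborSet_eq_three (hcub (e v)) (fun y _ => e.symm y) (fun y h => ?_)
      (fun y z _ _ h => e.symm.injective h) (fun y h => ⟨e y, e.map_rel_iff.2 h, by simp⟩)
    rw [← e.map_rel_iff, e.apply_symm_apply]
    exact h
  · obtain ⟨c, hc⟩ := isBipartite_iff_exists_bool.1 hb
    exact isBipartite_iff_exists_bool.2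
      ⟨fun v => c (e v), fun u v h => hc _ _ (e.map_rel_iff.2 h)⟩

theorem IsCubicBipartite.glueEdge {V W : Type} {A : SimpleGraph V} {B : SimpleGraph W}
    (hA : IsCubicBipartite A) (hB : IsCubicBipartite B) {a₁ a₂ : V} {b₁ b₂ : W}
    (ha : A.Adj a₁ a₂) (hb : B.Adj b₁ b₂) : IsCubicBipartite (glueEdge A a₁ a₂ B b₁ b₂) :=
  have := hA.finite
  have := hB.finite
  ⟨inferInstance, hA.twoConnected.glueEdge hB.twoConnected ha.ne hb.ne,
    hA.cubic.glueEdge hB.cubic ha hb, isBipartite_glueEdge hA.bipartite hB.bipartite ha hb⟩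

theorem IsCubicBipartite.glueMiddle {V W : Type} {A : SimpleGraph V} {B : SimpleGraph W}
    (hA : IsCubicBipartite A) (hB : IsCubicBipartite B) {a₁ a₂ : V} {b₁ b₂ : W}
    (ha : A.Adj a₁ a₂) (hb : B.Adj b₁ b₂) : IsCubicBipartite (glueMiddle A a₁ a₂ B b₁ b₂) :=
  have := hA.finite
  have := hB.finite
  ⟨inferInstance, hA.twoConnected.glueMiddle hB.twoConnected ha.ne hb.ne,
    hA.cubic.glueMiddle hB.cubic ha hb, isBipartite_glueMiddle hA.bipartite hB.bipartite ha hb⟩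

theorem IsCubicBipartite.glueVertex {V W : Type} {A : SimpleGraph V} {B : SimpleGraph W}
    (hA : IsCubicBipartite A) (hB : IsCubicBipartite B) {a : V} {b : W}
    (σ : A.neighborSet a ≃ B.neighborSet b) : IsCubicBipartite (glueVertex A a B b σ) :=
  have := hA.finite
  have := hB.finite
  ⟨inferInstance, hA.twoConnected.glueVertex hB.twoConnected σ,
    hA.cubic.glueVertex hB.cubic σ, isBipartite_glueVertex hA.bipartite hB.bipartite σ⟩

/-! ### Straight-line drawings -/

/-- The point or the straight line segment that represents a vertex `s(u, u)` or an edge `s(u, v)`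
if `p` gives the positions of the vertices. -/
def hull {V : Type} (p : V → ℂ) (e : Sym2 V) : Set ℂ := convexHull ℝ (p '' {c | c ∈ e})

theorem hull_mk {V : Type} (p : V → ℂ) (u v : V) : hull p s(u, v) = segment ℝ (p u) (p v) := by
  rw [hull, ← convexHull_pair, ← Set.image_pair]
  congr 2
  ext c
  simp

/-- `p` is a straight-line drawing of `G`: the vertices and edges of `G`, seen as points and
segments, form a geometric simplicial complex, that is, two of them meet in common ends only. -/
def IsDrawing {V : Type} (G : SimpleGraph V) (p : V → ℂ) : Prop :=
  ∀ e f : Sym2 V, (e.IsDiag ∨ e ∈ G.edgeSet) → (f.IsDiag ∨ f ∈ G.edgeSet) →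
    ∀ z, z ∈ hull p e → z ∈ hull p f → e = f ∨ ∃ c, c ∈ e ∧ c ∈ f ∧ z = p c

theorem mem_hull {V : Type} (p : V → ℂ) {v : V} {e : Sym2 V} (h : v ∈ e) : p v ∈ hull p e :=
  subset_convexHull ℝ _ ⟨v, h, rfl⟩

theorem isClosed_hull {V : Type} (p : V → ℂ) (e : Sym2 V) : IsClosed (hull p e) := by
  induction e with
  | _ u v =>
    rw [hull_mk, segment_eq_image_lineMap]
    exact (isCompact_Icc.image (AffineMap.lineMap_continuous)).isClosed

theorem hull_map {V W : Type} (p : V → ℂ) (φ : W → V) (e : Sym2 W) :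
    hull p (e.map φ) = hull (p ∘ φ) e := by
  induction e with
  | _ u v => rw [Sym2.map_mk, hull_mk, hull_mk]; rfl

theorem hull_affine {V : Type} (p : V → ℂ) (T : ℂ →ᵃ[ℝ] ℂ) (e : Sym2 V) :
    hull (T ∘ p) e = T '' hull p e := by
  induction e with
  | _ u v => rw [hull_mk, hull_mk, image_segment]; rfl

theorem IsDrawing.injective {V : Type} {G : SimpleGraph V} {p : V → ℂ} (h : IsDrawing G p) :
    Function.Injective p := by
  intro u v huv
  have h1 : p u ∈ hull p s(u, u) := mem_hull p (Sym2.mem_mk_left u u)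
  have h2 : p u ∈ hull p s(v, v) := huv ▸ mem_hull p (Sym2.mem_mk_left v v)
  rcases h s(u, u) s(v, v) (Or.inl rfl) (Or.inl rfl) _ h1 h2 with h3 | ⟨c, hc, hc', -⟩
  · simpa using h3
  · simp only [Sym2.mem_iff, or_self] at hc hc'
    rw [← hc, hc']

theorem IsDrawing.comp_hom {V W : Type} {G : SimpleGraph V} {p : V → ℂ} (h : IsDrawing G p)
    {H : SimpleGraph W} (φ : W → V) (hφ : Function.Injective φ)
    (hadj : ∀ u v, H.Adj u v → G.Adj (φ u) (φ v)) : IsDrawing H (p ∘ φ) := by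
  have hmap : ∀ e : Sym2 W, (e.IsDiag ∨ e ∈ H.edgeSet) →
      ((e.map φ).IsDiag ∨ e.map φ ∈ G.edgeSet) := by
    intro e
    induction e with
    | _ u v =>
      rintro (he | he)
      · exact Or.inl (congrArg φ he)
      · exact Or.inr (hadj u v he)
  intro e f he hf z hze hzf
  rw [← hull_map] at hze hzf
  rcases h _ _ (hmap e he) (hmap f hf) z hze hzf with h1 | ⟨c, hc, hc', hz⟩
  · exact Or.inl (Sym2.map.injective hφ h1)
  · obtain ⟨a, ha, rfl⟩ := Sym2.mem_map.1 hc
    obtain ⟨b, hb, hab⟩ := Sym2.mem_map.1 hc'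
    rw [hφ hab] at hb
    exact Or.inr ⟨a, ha, hb, hz⟩

theorem IsDrawing.affine {V : Type} {G : SimpleGraph V} {p : V → ℂ} (h : IsDrawing G p)
    (T : ℂ →ᵃ[ℝ] ℂ) (hT : Function.Injective T) : IsDrawing G (T ∘ p) := by
  intro e f he hf z hze hzf
  rw [hull_affine] at hze hzf
  obtain ⟨w, hw, rfl⟩ := hze
  obtain ⟨w', hw', hww⟩ := hzf
  rw [hT hww] at hw'
  refine (h e f he hf w hw hw').imp_right ?_
  rintro ⟨c, hc, hc', rfl⟩
  exact ⟨c, hc, hc', rfl⟩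

/-- A straight-line drawing is a drawing of the plane with simple arcs. -/
theorem IsDrawing.isPlanar {V : Type} {G : SimpleGraph V} {p : V → ℂ} (h : IsDrawing G p) :
    IsPlanar G := by
  let L := Complex.equivRealProdCLM
  have hL : Function.Injective L := L.injective
  refine ⟨fun v => L (p v), fun e => L '' hull p e, hL.comp h.injective, fun u v huv => ?_,
    fun e he w hw => ?_, fun e he f hf hef => ?_⟩
  · have hne : p u ≠ p v := h.injective.ne huv.ne
    refine ⟨⟨⟨fun t => L (AffineMap.lineMap (p u) (p v) (t : ℝ)), ?_⟩, ?_, ?_⟩, ?_, ?_⟩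
    · exact L.continuous.comp (AffineMap.lineMap_continuous.comp continuous_subtype_val)
    · simp
    · simp
    · intro s t hst
      exact Subtype.ext (AffineMap.lineMap_injective ℝ hne (hL hst))
    · change Set.range (fun t : unitInterval => L (AffineMap.lineMap (p u) (p v) (t : ℝ))) = _
      simp only [hull_mk, segment_eq_image_lineMap, Set.image_image]
      ext z
      simp [unitInterval]
  · obtain ⟨z, hz, hzw⟩ := hw
    rw [hL hzw] at hz
    rcases h e s(w, w) (Or.inr he) (Or.inl rfl) _ hz (mem_hull p (Sym2.mem_mk_left w w)) with
      h1 | ⟨c, hc, hc', -⟩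
    · rw [h1]
      exact Sym2.mem_mk_left w w
    · simp only [Sym2.mem_iff, or_self] at hc'
      rwa [← hc']
  · rintro _ ⟨⟨z, hz, rfl⟩, ⟨z', hz', hzz⟩⟩
    rw [hL hzz] at hz'
    obtain ⟨c, hc, hc', rfl⟩ := (h e f (Or.inr he) (Or.inr hf) z hz hz').resolve_left hef
    exact ⟨c, ⟨hc, hc'⟩, rfl⟩

/-- A straight-line drawing in which `a₁` and `a₂` are the points `0` and `1`, and all other
vertices lie strictly between the vertical lines through `0` and `1`. -/
structure IsStripDrawing {V : Type} (G : SimpleGraph V) (a₁ a₂ : V) (p : V → ℂ) : Prop where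
  drawing : IsDrawing G p
  left : p a₁ = 0
  right : p a₂ = 1
  strip : ∀ v, v ≠ a₁ → v ≠ a₂ → 0 < (p v).re ∧ (p v).re < 1

theorem re_mem_Icc_of_mem_hull {V : Type} {p : V → ℂ} {l r : ℝ}
    (h : ∀ v, p v ∈ Complex.re ⁻¹' Set.Icc l r)
    {e : Sym2 V} {z : ℂ} (hz : z ∈ hull p e) : z.re ∈ Set.Icc l r :=
  convexHull_min (t := Complex.re ⁻¹' Set.Icc l r) (Set.image_subset_iff.2 fun v _ => h v)
    ((convex_Icc l r).linear_preimage Complex.reLm) hz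

theorem abs_im_le_of_mem_hull {V : Type} {p : V → ℂ} {R : ℝ} (h : ∀ v, |(p v).im| ≤ R)
    {e : Sym2 V} {z : ℂ} (hz : z ∈ hull p e) : |z.im| ≤ R :=
  abs_le.2 (convexHull_min (t := Complex.im ⁻¹' Set.Icc (-R) R)
    (Set.image_subset_iff.2 fun v _ => abs_le.1 (h v))
    ((convex_Icc (-R) R).linear_preimage Complex.imLm) hz)

/-- A vertex with the extreme value of a linear function is the only point of a simplex with this
value. -/
theorem eq_of_mem_hull_of_extreme {V : Type} {p : V → ℂ} {a : V} {f : ℂ →ₗ[ℝ] ℝ}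
    (h : ∀ v, v ≠ a → f (p a) < f (p v)) {e : Sym2 V} {z : ℂ} (hz : z ∈ hull p e)
    (hf : f z ≤ f (p a)) : a ∈ e ∧ z = p a := by
  induction e with
  | _ u v =>
    rw [hull_mk] at hz
    obtain ⟨s, t, hs, ht, hst, rfl⟩ := hz
    rw [map_add, map_smul, map_smul, smul_eq_mul, smul_eq_mul] at hf
    have hsum : (s + t) * f (p a) = f (p a) := by rw [hst, one_mul]
    by_cases hu : u = a
    · subst hu
      refine ⟨Sym2.mem_mk_left _ _, ?_⟩
      by_cases hv : v = u
      · rw [hv, ← add_smul, hst, one_smul]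
      · have := h v hv
        have ht0 : t = 0 := by
          by_contra h0
          have := mul_pos (lt_of_le_of_ne ht (Ne.symm h0)) (sub_pos.2 this)
          linarith
        have hs1 : s = 1 := by linarith
        simp [ht0, hs1]
    · have hu' := h u hu
      by_cases hv : v = a
      · subst hv
        have ht0 : s = 0 := by
          by_contra h0
          have := mul_pos (lt_of_le_of_ne hs (Ne.symm h0)) (sub_pos.2 hu')
          linarith
        have hs1 : t = 1 := by linarith
        simp [ht0, hs1]
      · have := h v hv
        rcases hs.eq_or_lt with rfl | hs
        · have : t = 1 := by linarith
          subst this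
          linarith
        · have h1 := mul_pos hs (sub_pos.2 hu')
          have h2 := mul_nonneg ht (sub_pos.2 this).le
          linarith

namespace IsStripDrawing

variable {V : Type} {G : SimpleGraph V} {a₁ a₂ : V} {p : V → ℂ}

theorem re_mem_Icc (h : IsStripDrawing G a₁ a₂ p) (v : V) :
    p v ∈ Complex.re ⁻¹' Set.Icc 0 1 := by
  by_cases h1 : v = a₁
  · simp [h1, h.left]
  · by_cases h2 : v = a₂
    · simp [h2, h.right]
    · exact ⟨(h.strip v h1 h2).1.le, (h.strip v h1 h2).2.le⟩

theorem eq_left (h : IsStripDrawing G a₁ a₂ p) {e : Sym2 V} {z : ℂ} (hz : z ∈ hull p e)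
    (h0 : z.re ≤ 0) : a₁ ∈ e ∧ z = p a₁ :=
  eq_of_mem_hull_of_extreme (f := Complex.reLm) (fun v hv => by
    by_cases h2 : v = a₂
    · simp [h2, h.left, h.right]
    · simpa [h.left] using (h.strip v hv h2).1) hz (by simpa [h.left] using h0)

theorem eq_right (h : IsStripDrawing G a₁ a₂ p) {e : Sym2 V} {z : ℂ} (hz : z ∈ hull p e)
    (h0 : 1 ≤ z.re) : a₂ ∈ e ∧ z = p a₂ :=
  eq_of_mem_hull_of_extreme (f := -Complex.reLm) (fun v hv => by
    by_cases h1 : v = a₁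
    · simp [h1, h.left, h.right]
    · simpa [h.right] using (h.strip v h1 hv).2) hz (by simpa [h.right] using h0)

end IsStripDrawing

/-! ### Insertion of a strip drawing into an edge -/

/-- The affine map of the plane that maps the strip between the vertical lines through `0` and `1`
to the strip between those through `1/3` and `2/3`, and scales the height by `ε`. -/
noncomputable def squash (ε : ℝ) : ℂ →ᵃ[ℝ] ℂ where
  toFun z := ⟨(1 + z.re) / 3, ε * z.im⟩
  linear :=
    { toFun := fun z => ⟨z.re / 3, ε * z.im⟩
      map_add' := fun z w => by apply Complex.ext <;> simp <;> ring
      map_smul' := fun c z => by apply Complex.ext <;> simp <;> ring }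
  map_vadd' z w := by apply Complex.ext <;> simp <;> ring

theorem squash_apply (ε : ℝ) (z : ℂ) : squash ε z = ⟨(1 + z.re) / 3, ε * z.im⟩ := rfl

theorem squash_injective {ε : ℝ} (hε : 0 < ε) : Function.Injective (squash ε) := by
  intro z w h
  rw [squash_apply, squash_apply, Complex.mk.injEq] at h
  apply Complex.ext
  · linarith [h.1]
  · exact mul_left_cancel₀ hε.ne' h.2

/-- The four kinds of vertices and edges of `glueEdge A a₁ a₂ B b₁ b₂`. -/
theorem glueEdge_simplex {V W : Type} {A : SimpleGraph V} {a₁ a₂ : V} {B : SimpleGraph W}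
    {b₁ b₂ : W} (hb : b₁ ≠ b₂) {e : Sym2 (V ⊕ W)}
    (he : e.IsDiag ∨ e ∈ (glueEdge A a₁ a₂ B b₁ b₂).edgeSet) :
    (∃ e' : Sym2 V, (e'.IsDiag ∨ e' ∈ A.edgeSet) ∧ e = e'.map Sum.inl) ∨
    (∃ e' : Sym2 W, (e'.IsDiag ∨ e' ∈ B.edgeSet) ∧ e' ≠ s(b₁, b₂) ∧ e = e'.map Sum.inr) ∨
    e = s(Sum.inl a₁, Sum.inr b₁) ∨ e = s(Sum.inl a₂, Sum.inr b₂) := by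
  induction e with
  | _ q r =>
    rcases q with u | y <;> rcases r with v | z
    · refine Or.inl ⟨s(u, v), he.imp (fun h => ?_) fun h => h.1, rfl⟩
      exact Sum.inl_injective h
    · rcases he with he | he
      · cases he
      · rcases he with ⟨rfl, rfl⟩ | ⟨rfl, rfl⟩ <;> simp
    · rcases he with he | he
      · cases he
      · rcases he with ⟨rfl, rfl⟩ | ⟨rfl, rfl⟩
        · exact Or.inr (Or.inr (Or.inl Sym2.eq_swap))
        · exact Or.inr (Or.inr (Or.inr Sym2.eq_swap))
    · refine Or.inr (Or.inl ⟨s(y, z), he.imp (fun h => ?_) fun h => h.1, ?_, rfl⟩)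
      · exact Sum.inr_injective h
      · rcases he with he | he
        · rintro h
          have : y = z := Sum.inr_injective he
          subst this
          rcases Sym2.eq_iff.1 h with h' | h'
          · exact hb (h'.1.symm.trans h'.2)
          · exact hb (h'.2.symm.trans h'.1)
        · exact he.2

/-- A strip drawing of `A` can be inserted, sufficiently squashed, into the middle third of
the edge `b₁b₂` from `0` to `1` in a drawing of `B`. -/
theorem exists_isDrawing_glueEdge_of_unit {V W : Type} [Finite V] [Finite W] {A : SimpleGraph V}
    {a₁ a₂ : V} {pA : V → ℂ} (hA : IsStripDrawing A a₁ a₂ pA) {B : SimpleGraph W} {b₁ b₂ : W}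
    {pB : W → ℂ} (hB : IsDrawing B pB) (hb : B.Adj b₁ b₂) (h0 : pB b₁ = 0) (h1 : pB b₂ = 1)
    {U : Set ℂ} (hU : IsOpen U) (hUs : ∀ r : ℝ, 0 < r → r < 1 → (r : ℂ) ∈ U) :
    ∃ p : V → ℂ, (∀ x, p x ∈ U) ∧ IsDrawing (glueEdge A a₁ a₂ B b₁ b₂) (Sum.elim p pB) := by
  have hseg : ∀ r : ℝ, 0 ≤ r → r ≤ 1 → (r : ℂ) ∈ hull pB s(b₁, b₂) := by
    intro r hr hr'
    rw [hull_mk, h0, h1]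
    exact ⟨1 - r, r, by linarith, hr, by ring, by simp⟩
  -- the part of `U` that avoids all vertices and edges of `B` except for `b₁b₂`
  let O : Set ℂ := U ∩
    ⋂ e ∈ {e : Sym2 W | (e.IsDiag ∨ e ∈ B.edgeSet) ∧ e ≠ s(b₁, b₂)}, (hull pB e)ᶜ
  have hO : IsOpen O := hU.inter ((Set.toFinite _).isOpen_biInter fun e _ =>
    (isClosed_hull pB e).isOpen_compl)
  let M : Set ℂ := (fun r : ℝ => (r : ℂ)) '' Set.Icc (1 / 3) (2 / 3)
  have hM : IsCompact M := isCompact_Icc.image Complex.continuous_ofReal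
  have hMO : M ⊆ O := by
    rintro _ ⟨r, ⟨hr, hr'⟩, rfl⟩
    refine ⟨hUs r (by linarith) (by linarith), Set.mem_iInter₂.2 fun e he hre => ?_⟩
    obtain ⟨c, -, hc, hrc⟩ := (hB e s(b₁, b₂) he.1 (Or.inr hb) _ hre
      (hseg r (by linarith) (by linarith))).resolve_left he.2
    rcases Sym2.mem_iff.1 hc with rfl | rfl
    · rw [h0] at hrc
      have : r = 0 := Complex.ofReal_injective hrc
      linarith
    · rw [h1] at hrc
      have : r = 1 := Complex.ofReal_injective hrc
      linarith
  obtain ⟨δ, hδ, hδO⟩ := hM.exists_thickening_subset_open hO hMO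
  obtain ⟨R, hR⟩ : ∃ R : ℝ, ∀ v, |(pA v).im| ≤ R := by
    obtain ⟨R, hR⟩ := (Set.finite_range fun v => |(pA v).im|).bddAbove
    exact ⟨R, fun v => hR ⟨v, rfl⟩⟩
  have hR0 : 0 ≤ R := (abs_nonneg _).trans (hR a₁)
  let ε : ℝ := δ / (R + 1)
  have hε : 0 < ε := by positivity
  have hεR : ε * R < δ := by
    rw [div_mul_eq_mul_div, div_lt_iff₀ (by linarith)]
    nlinarith
  have hTO : ∀ (e : Sym2 V) (z : ℂ), z ∈ hull pA e → squash ε z ∈ O := by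
    intro e z hz
    obtain ⟨hr0, hr1⟩ := re_mem_Icc_of_mem_hull hA.re_mem_Icc hz
    have him := abs_im_le_of_mem_hull hR hz
    apply hδO
    rw [Metric.mem_thickening_iff]
    refine ⟨_, ⟨(1 + z.re) / 3, ⟨by linarith, by linarith⟩, rfl⟩, ?_⟩
    rw [squash_apply, Complex.dist_of_re_eq (by simp), Real.dist_eq, Complex.ofReal_im, sub_zero,
      abs_mul, abs_of_pos hε]
    exact (mul_le_mul_of_nonneg_left him hε.le).trans_lt hεR
  let p : V ⊕ W → ℂ := Sum.elim (squash ε ∘ pA) pB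
  have hpA : ∀ e : Sym2 V, hull p (e.map Sum.inl) = squash ε '' hull pA e := fun e => by
    rw [hull_map, ← hull_affine]
    rfl
  have hpB : ∀ e : Sym2 W, hull p (e.map Sum.inr) = hull pB e := fun e => by
    rw [hull_map]
    rfl
  have hp1 : p (Sum.inl a₁) = ((1 / 3 : ℝ) : ℂ) := by
    change squash ε (pA a₁) = _
    rw [hA.left, squash_apply]
    apply Complex.ext <;> simp
  have hp2 : p (Sum.inl a₂) = ((2 / 3 : ℝ) : ℂ) := by
    change squash ε (pA a₂) = _
    rw [hA.right, squash_apply]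
    apply Complex.ext
    · simp
      norm_num
    · simp
  have hl1 : ∀ z ∈ hull p s(Sum.inl a₁, Sum.inr b₁), ∃ r : ℝ, 0 ≤ r ∧ r ≤ 1 / 3 ∧ z = r := by
    intro z hz
    rw [hull_mk, hp1, show p (Sum.inr b₁) = 0 from h0] at hz
    obtain ⟨s, t, hs, ht, hst, rfl⟩ := hz
    exact ⟨s * (1 / 3), by linarith, by linarith, by simp⟩
  have hl2 : ∀ z ∈ hull p s(Sum.inl a₂, Sum.inr b₂), ∃ r : ℝ, 2 / 3 ≤ r ∧ r ≤ 1 ∧ z = r := by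
    intro z hz
    rw [hull_mk, hp2, show p (Sum.inr b₂) = 1 from h1] at hz
    obtain ⟨s, t, hs, ht, hst, rfl⟩ := hz
    exact ⟨s * (2 / 3) + t, by linarith, by linarith, by simp⟩
  -- two simplices of different kinds
  have hAB : ∀ (e : Sym2 V) (f : Sym2 W), (f.IsDiag ∨ f ∈ B.edgeSet) → f ≠ s(b₁, b₂) →
      ∀ z, z ∈ hull p (e.map Sum.inl) → z ∉ hull p (f.map Sum.inr) := by
    intro e f hf hne z hze hzf
    rw [hpA] at hze
    rw [hpB] at hzf
    obtain ⟨w, hw, rfl⟩ := hze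
    exact Set.mem_iInter₂.1 (hTO e w hw).2 f ⟨hf, hne⟩ hzf
  have hA1 : ∀ (e : Sym2 V) (z : ℂ), z ∈ hull p (e.map Sum.inl) →
      z ∈ hull p s(Sum.inl a₁, Sum.inr b₁) →
      ∃ c, c ∈ e.map Sum.inl ∧ c ∈ s(Sum.inl a₁, Sum.inr b₁) ∧ z = p c := by
    intro e z hze hz1
    rw [hpA] at hze
    obtain ⟨w, hw, rfl⟩ := hze
    obtain ⟨r, -, hr, hr'⟩ := hl1 _ hz1
    have : (squash ε w).re = r := by rw [hr', Complex.ofReal_re]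
    rw [squash_apply] at this
    obtain ⟨h3, rfl⟩ := hA.eq_left hw (by dsimp only at this; linarith)
    exact ⟨Sum.inl a₁, Sym2.mem_map.2 ⟨a₁, h3, rfl⟩, Sym2.mem_mk_left _ _, rfl⟩
  have hA2 : ∀ (e : Sym2 V) (z : ℂ), z ∈ hull p (e.map Sum.inl) →
      z ∈ hull p s(Sum.inl a₂, Sum.inr b₂) →
      ∃ c, c ∈ e.map Sum.inl ∧ c ∈ s(Sum.inl a₂, Sum.inr b₂) ∧ z = p c := by
    intro e z hze hz2
    rw [hpA] at hze
    obtain ⟨w, hw, rfl⟩ := hze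
    obtain ⟨r, hr, -, hr'⟩ := hl2 _ hz2
    have : (squash ε w).re = r := by rw [hr', Complex.ofReal_re]
    rw [squash_apply] at this
    obtain ⟨h3, rfl⟩ := hA.eq_right hw (by dsimp only at this; linarith)
    exact ⟨Sum.inl a₂, Sym2.mem_map.2 ⟨a₂, h3, rfl⟩, Sym2.mem_mk_left _ _, rfl⟩
  have hBr : ∀ (e : Sym2 W), (e.IsDiag ∨ e ∈ B.edgeSet) → e ≠ s(b₁, b₂) → ∀ r : ℝ, 0 ≤ r →
      r ≤ 1 → (r : ℂ) ∈ hull p (e.map Sum.inr) → (b₁ ∈ e ∧ r = 0) ∨ (b₂ ∈ e ∧ r = 1) := by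
    intro e he hne r hr hr' hre
    rw [hpB] at hre
    obtain ⟨c, hce, hc, hrc⟩ := (hB e s(b₁, b₂) he (Or.inr hb) _ hre
      (hseg r hr hr')).resolve_left hne
    rcases Sym2.mem_iff.1 hc with rfl | rfl
    · rw [h0] at hrc
      exact Or.inl ⟨hce, by exact_mod_cast hrc⟩
    · rw [h1] at hrc
      exact Or.inr ⟨hce, by exact_mod_cast hrc⟩
  have hB1 : ∀ (e : Sym2 W), (e.IsDiag ∨ e ∈ B.edgeSet) → e ≠ s(b₁, b₂) → ∀ z,
      z ∈ hull p (e.map Sum.inr) → z ∈ hull p s(Sum.inl a₁, Sum.inr b₁) →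
      ∃ c, c ∈ e.map Sum.inr ∧ c ∈ s(Sum.inl a₁, Sum.inr b₁) ∧ z = p c := by
    intro e he hne z hze hz1
    obtain ⟨r, hr0, hr, rfl⟩ := hl1 _ hz1
    rcases hBr e he hne r hr0 (by linarith) hze with ⟨hc, rfl⟩ | ⟨hc, rfl⟩
    · exact ⟨Sum.inr b₁, Sym2.mem_map.2 ⟨b₁, hc, rfl⟩, Sym2.mem_mk_right _ _, by simp [p, h0]⟩
    · norm_num at hr
  have hB2 : ∀ (e : Sym2 W), (e.IsDiag ∨ e ∈ B.edgeSet) → e ≠ s(b₁, b₂) → ∀ z,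
      z ∈ hull p (e.map Sum.inr) → z ∈ hull p s(Sum.inl a₂, Sum.inr b₂) →
      ∃ c, c ∈ e.map Sum.inr ∧ c ∈ s(Sum.inl a₂, Sum.inr b₂) ∧ z = p c := by
    intro e he hne z hze hz2
    obtain ⟨r, hr, hr1, rfl⟩ := hl2 _ hz2
    rcases hBr e he hne r (by linarith) hr1 hze with ⟨hc, rfl⟩ | ⟨hc, rfl⟩
    · norm_num at hr
    · exact ⟨Sum.inr b₂, Sym2.mem_map.2 ⟨b₂, hc, rfl⟩, Sym2.mem_mk_right _ _, by simp [p, h1]⟩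
  have h12 : ∀ z, z ∈ hull p s(Sum.inl a₁, Sum.inr b₁) →
      z ∉ hull p s(Sum.inl a₂, Sum.inr b₂) := by
    intro z hz1 hz2
    obtain ⟨r, -, hr, rfl⟩ := hl1 _ hz1
    obtain ⟨r', hr', -, hrr⟩ := hl2 _ hz2
    have : r = r' := by exact_mod_cast hrr
    linarith
  have hswap : ∀ {e f : Sym2 (V ⊕ W)} {z : ℂ}, (∃ c, c ∈ f ∧ c ∈ e ∧ z = p c) →
      e = f ∨ ∃ c, c ∈ e ∧ c ∈ f ∧ z = p c := by
    rintro e f z ⟨c, h1, h2, h3⟩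
    exact Or.inr ⟨c, h2, h1, h3⟩
  refine ⟨squash ε ∘ pA, fun x => (hTO s(x, x) _ (mem_hull pA (Sym2.mem_mk_left x x))).1, ?_⟩
  intro e f he hf z hze hzf
  rcases glueEdge_simplex hb.ne he with ⟨e, he', rfl⟩ | ⟨e, he', hne, rfl⟩ | rfl | rfl <;>
    rcases glueEdge_simplex hb.ne hf with ⟨f, hf', rfl⟩ | ⟨f, hf', hnf, rfl⟩ | rfl | rfl
  · rw [hpA] at hze hzf
    obtain ⟨w, hw, rfl⟩ := hze
    obtain ⟨w', hw', hww⟩ := hzf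
    rw [squash_injective hε hww] at hw'
    rcases hA.drawing e f he' hf' w hw hw' with rfl | ⟨c, hc, hc', rfl⟩
    · exact Or.inl rfl
    · exact Or.inr ⟨Sum.inl c, Sym2.mem_map.2 ⟨c, hc, rfl⟩, Sym2.mem_map.2 ⟨c, hc', rfl⟩, rfl⟩
  · exact absurd hzf (hAB e f hf' hnf z hze)
  · exact Or.inr (hA1 e z hze hzf)
  · exact Or.inr (hA2 e z hze hzf)
  · exact absurd hze (hAB f e he' hne z hzf)
  · rw [hpB] at hze hzf
    rcases hB e f he' hf' z hze hzf with rfl | ⟨c, hc, hc', rfl⟩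
    · exact Or.inl rfl
    · exact Or.inr ⟨Sum.inr c, Sym2.mem_map.2 ⟨c, hc, rfl⟩, Sym2.mem_map.2 ⟨c, hc', rfl⟩, rfl⟩
  · exact Or.inr (hB1 e he' hne z hze hzf)
  · exact Or.inr (hB2 e he' hne z hze hzf)
  · exact hswap (hA1 f z hzf hze)
  · exact hswap (hB1 f hf' hnf z hzf hze)
  · exact Or.inl rfl
  · exact absurd hzf (h12 z hze)
  · exact hswap (hA2 f z hzf hze)
  · exact hswap (hB2 f hf' hnf z hzf hze)
  · exact absurd hze (h12 z hzf)
  · exact Or.inl rfl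

/-- A strip drawing of `A` can be inserted into an edge `b₁b₂` in a drawing of `B`, inside any given
neighbourhood of the interior of this edge. -/
theorem exists_isDrawing_glueEdge {V W : Type} [Finite V] [Finite W] {A : SimpleGraph V}
    {a₁ a₂ : V} {pA : V → ℂ} (hA : IsStripDrawing A a₁ a₂ pA) {B : SimpleGraph W} {b₁ b₂ : W}
    {pB : W → ℂ} (hB : IsDrawing B pB) (hb : B.Adj b₁ b₂)
    {U : Set ℂ} (hU : IsOpen U) (hUs : openSegment ℝ (pB b₁) (pB b₂) ⊆ U) :
    ∃ p : V → ℂ, (∀ x, p x ∈ U) ∧ IsDrawing (glueEdge A a₁ a₂ B b₁ b₂) (Sum.elim p pB) := by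
  set d : ℂ := pB b₂ - pB b₁ with hd
  have hd0 : d ≠ 0 := sub_ne_zero.2 (hB.injective.ne hb.ne.symm)
  -- the similarity that maps `0` and `1` to the ends of the edge, and its inverse
  let N : ℂ →ᵃ[ℝ] ℂ := (LinearMap.mulLeft ℝ d).toAffineMap + AffineMap.const ℝ ℂ (pB b₁)
  let N' : ℂ →ᵃ[ℝ] ℂ := (LinearMap.mulLeft ℝ d⁻¹).toAffineMap + AffineMap.const ℝ ℂ (-d⁻¹ * pB b₁)
  have hN : ∀ z, N z = d * z + pB b₁ := fun z => by simp [N]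
  have hN' : ∀ z, N' z = d⁻¹ * (z - pB b₁) := fun z => by simp [N']; ring
  have hNN : ∀ z, N (N' z) = z := fun z => by
    rw [hN, hN']
    field_simp
    ring
  have hNi : Function.Injective N := fun z w h => by
    rw [hN, hN] at h
    exact mul_left_cancel₀ hd0 (add_right_cancel h)
  obtain ⟨p, hp, hdr⟩ := exists_isDrawing_glueEdge_of_unit hA
    (hB.affine N' (Function.LeftInverse.injective (g := N) hNN)) hb
    (by simp [hN']) (by simp [hN', ← hd, hd0]) (U := N ⁻¹' U)
    (hU.preimage (by
      rw [show (N : ℂ → ℂ) = fun z => d * z + pB b₁ from funext hN]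
      fun_prop))
    (fun r hr hr' => hUs ⟨1 - r, r, by linarith, hr, by ring, by
      rw [hN, hd]
      simp
      ring⟩)
  refine ⟨N ∘ p, hp, ?_⟩
  have : Sum.elim (N ∘ p) pB = N ∘ Sum.elim p (N' ∘ pB) := by
    funext x
    rcases x with x | x
    · rfl
    · exact (hNN _).symm
  rw [this]
  exact hdr.affine N hNi

/-- Insertion into an edge of a strip drawing gives a strip drawing. -/
theorem IsStripDrawing.glueEdge {V W : Type} [Finite V] [Finite W] {A : SimpleGraph V}
    {a₁ a₂ : V} {pA : V → ℂ} (hA : IsStripDrawing A a₁ a₂ pA) {B : SimpleGraph W} {b₁ b₂ c₁ c₂ : W}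
    {pB : W → ℂ} (hB : IsStripDrawing B c₁ c₂ pB) (hb : B.Adj b₁ b₂) :
    ∃ p, IsStripDrawing (glueEdge A a₁ a₂ B b₁ b₂) (Sum.inr c₁) (Sum.inr c₂) p := by
  have hU : openSegment ℝ (pB b₁) (pB b₂) ⊆ Complex.re ⁻¹' Set.Ioo 0 1 := by
    have key : ∀ b, (0 ≤ (pB b).re ∧ (pB b).re ≤ 1) ∧ ((pB b).re = 0 → b = c₁) ∧
        ((pB b).re = 1 → b = c₂) := by
      intro b
      by_cases h1 : b = c₁
      · simp [h1, hB.left]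
      · by_cases h2 : b = c₂
        · simp [h2, hB.right]
        · have := hB.strip b h1 h2
          exact ⟨⟨this.1.le, this.2.le⟩, fun h => by linarith, fun h => by linarith⟩
    rintro _ ⟨s, t, hs, ht, hst, rfl⟩
    obtain ⟨⟨h1, h2⟩, h3, h4⟩ := key b₁
    obtain ⟨⟨h1', h2'⟩, h3', h4'⟩ := key b₂
    have hre : (s • pB b₁ + t • pB b₂).re = s * (pB b₁).re + t * (pB b₂).re := by simp
    rw [Set.mem_preimage, hre]
    have hx : ¬ ((pB b₁).re = 0 ∧ (pB b₂).re = 0) := fun h => hb.ne ((h3 h.1).trans (h3' h.2).symm)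
    have hy : ¬ ((pB b₁).re = 1 ∧ (pB b₂).re = 1) := fun h => hb.ne ((h4 h.1).trans (h4' h.2).symm)
    constructor
    · rcases h1.eq_or_lt with h | h
      · have : 0 < (pB b₂).re := lt_of_le_of_ne h1' fun h' => hx ⟨h.symm, h'.symm⟩
        rw [← h]
        nlinarith [mul_pos ht this]
      · nlinarith [mul_pos hs h, mul_nonneg ht.le h1']
    · rcases h2.eq_or_lt with h | h
      · have : (pB b₂).re < 1 := lt_of_le_of_ne h2' fun h' => hy ⟨h, h'⟩
        nlinarith [mul_pos ht (sub_pos.2 this)]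
      · nlinarith [mul_pos hs (sub_pos.2 h), mul_nonneg ht.le (sub_nonneg.2 h2')]
  obtain ⟨p, hp, hdr⟩ := exists_isDrawing_glueEdge hA hB.drawing hb
    (isOpen_Ioo.preimage Complex.continuous_re) hU
  refine ⟨_, hdr, hB.left, hB.right, ?_⟩
  rintro (v | v) h1 h2
  · exact hp v
  · exact hB.strip v (by simpa using h1) (by simpa using h2)

/-! ### Drawings with integer coordinates -/

/-- Twice the signed area of the triangle `abc`. -/
def orient {R : Type} [CommRing R] (a b c : R × R) : R :=
  (b.1 - a.1) * (c.2 - a.2) - (b.2 - a.2) * (c.1 - a.1)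

/-- A test for straight-line drawings with integer coordinates in which no vertex lies on the line
through an edge: the ends of one of any two disjoint edges lie strictly on the same side of
the line through the other one. -/
def IsIntDrawing {V : Type} (G : SimpleGraph V) (q : V → ℤ × ℤ) : Prop :=
  (∀ u v, q u = q v → u = v) ∧
  (∀ u v, G.Adj u v → ∀ w, w = u ∨ w = v ∨ orient (q u) (q v) (q w) ≠ 0) ∧
  ∀ u v, G.Adj u v → ∀ w x, G.Adj w x → (u = w ∨ u = x ∨ v = w ∨ v = x) ∨
    0 < orient (q u) (q v) (q w) * orient (q u) (q v) (q x) ∨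
    0 < orient (q w) (q x) (q u) * orient (q w) (q x) (q v)

instance {V : Type} [Fintype V] [DecidableEq V] (G : SimpleGraph V) [DecidableRel G.Adj]
    (q : V → ℤ × ℤ) : Decidable (IsIntDrawing G q) := by
  unfold IsIntDrawing
  infer_instance

theorem orient_of_mem_segment {a b c d : ℝ × ℝ} {z : ℂ}
    (hz : z ∈ segment ℝ (⟨c.1, c.2⟩ : ℂ) ⟨d.1, d.2⟩) : ∃ s t : ℝ, 0 ≤ s ∧ 0 ≤ t ∧ s + t = 1 ∧
      z = s • (⟨c.1, c.2⟩ : ℂ) + t • (⟨d.1, d.2⟩ : ℂ) ∧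
      orient a b (z.re, z.im) = s * orient a b c + t * orient a b d := by
  obtain ⟨s, t, hs, ht, hst, rfl⟩ := hz
  refine ⟨s, t, hs, ht, hst, rfl, ?_⟩
  obtain rfl : s = 1 - t := by linarith
  simp [orient]
  ring

/-- A segment whose ends lie strictly on the same side of a line does not meet this line. -/
theorem false_of_orient_mul_pos {a b c d : ℝ × ℝ} {z : ℂ}
    (h : 0 < orient a b c * orient a b d) (hz : z ∈ segment ℝ (⟨a.1, a.2⟩ : ℂ) ⟨b.1, b.2⟩)
    (hz' : z ∈ segment ℝ (⟨c.1, c.2⟩ : ℂ) ⟨d.1, d.2⟩) : False := by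
  obtain ⟨s, t, -, -, -, -, h1⟩ := orient_of_mem_segment (a := a) (b := b) hz
  obtain ⟨s', t', hs', ht', hst', -, h2⟩ := orient_of_mem_segment (a := a) (b := b) hz'
  have e1 : orient a b a = 0 := by simp [orient]
  have e2 : orient a b b = 0 := by simp [orient]; ring
  rw [h1, e1, e2, mul_zero, mul_zero, add_zero] at h2
  rcases mul_pos_iff.1 h with ⟨h3, h4⟩ | ⟨h3, h4⟩
  · rcases hs'.eq_or_lt with rfl | hs'
    · have : t' = 1 := by linarith
      subst this
      linarith
    · nlinarith [mul_pos hs' h3, mul_nonneg ht' h4.le]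
  · rcases hs'.eq_or_lt with rfl | hs'
    · have : t' = 1 := by linarith
      subst this
      linarith
    · nlinarith [mul_pos hs' (neg_pos.2 h3), mul_nonneg ht' (neg_pos.2 h4).le]

/-- If `d` does not lie on the line through `a` and `b`, then the segments `ab` and `ad` meet in `a`
only. -/
theorem eq_of_orient_ne_zero {a b d : ℝ × ℝ} {z : ℂ} (h : orient a b d ≠ 0)
    (hz : z ∈ segment ℝ (⟨a.1, a.2⟩ : ℂ) ⟨b.1, b.2⟩)
    (hz' : z ∈ segment ℝ (⟨a.1, a.2⟩ : ℂ) ⟨d.1, d.2⟩) : z = ⟨a.1, a.2⟩ := by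
  obtain ⟨s, t, -, -, -, -, h1⟩ := orient_of_mem_segment (a := a) (b := b) hz
  obtain ⟨s', t', hs', ht', hst', hz', h2⟩ := orient_of_mem_segment (a := a) (b := b) hz'
  have e1 : orient a b a = 0 := by simp [orient]
  have e2 : orient a b b = 0 := by simp [orient]; ring
  rw [h1, e1, e2, mul_zero, mul_zero, add_zero, mul_zero, zero_add] at h2
  have ht0 : t' = 0 := (mul_eq_zero.1 h2.symm).resolve_right h
  have hs1 : s' = 1 := by linarith
  rw [hz', ht0, hs1]
  simp

theorem IsIntDrawing.isDrawing {V : Type} {G : SimpleGraph V} {q : V → ℤ × ℤ}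
    (h : IsIntDrawing G q) : IsDrawing G (fun v => (⟨(q v).1, (q v).2⟩ : ℂ)) := by
  obtain ⟨hinj, hgen, hsep⟩ := h
  let r : V → ℝ × ℝ := fun v => ((q v).1, (q v).2)
  let p : V → ℂ := fun v => ⟨(q v).1, (q v).2⟩
  have hor : ∀ u v w, orient (r u) (r v) (r w) = (orient (q u) (q v) (q w) : ℤ) := fun u v w => by
    simp [r, orient]
  have hpinj : Function.Injective p := fun u v huv => by
    have h1 := congrArg Complex.re huv
    have h2 := congrArg Complex.im huv
    simp only [p] at h1 h2
    exact hinj u v (Prod.ext (by exact_mod_cast h1) (by exact_mod_cast h2))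
  have hgen' : ∀ u v w, G.Adj u v → w ≠ u → w ≠ v → orient (r u) (r v) (r w) ≠ 0 := by
    intro u v w huv hwu hwv
    rw [hor]
    exact_mod_cast ((hgen u v huv w).resolve_left hwu).resolve_left hwv
  have hsep' : ∀ u v w x, G.Adj u v → G.Adj w x → (u = w ∨ u = x ∨ v = w ∨ v = x) ∨
      0 < orient (r u) (r v) (r w) * orient (r u) (r v) (r x) ∨
      0 < orient (r w) (r x) (r u) * orient (r w) (r x) (r v) := by
    intro u v w x huv hwx
    simp only [hor]
    exact_mod_cast hsep u v huv w x hwx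
  -- a vertex on an edge is an end of this edge
  have hvert : ∀ u v w, G.Adj u v → p w ∈ hull p s(u, v) → w ∈ s(u, v) := by
    intro u v w huv hw
    by_contra hcon
    rw [Sym2.mem_iff, not_or] at hcon
    rw [hull_mk] at hw
    obtain ⟨s, t, -, -, -, -, h1⟩ := orient_of_mem_segment (a := r u) (b := r v)
      (c := r u) (d := r v) hw
    refine hgen' u v w huv hcon.1 hcon.2 ?_
    have e1 : orient (r u) (r v) (r u) = 0 := by simp [orient]
    have e2 : orient (r u) (r v) (r v) = 0 := by simp [orient]; ring
    rw [e1, e2, mul_zero, mul_zero, add_zero] at h1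
    exact h1
  have hsymm : ∀ u v w x z, G.Adj u v → G.Adj w x → z ∈ hull p s(u, v) → z ∈ hull p s(w, x) →
      u = w → s(u, v) = s(w, x) ∨ ∃ c, c ∈ s(u, v) ∧ c ∈ s(w, x) ∧ z = p c := by
    rintro u v w x z huv hwx hz hz' rfl
    by_cases hvx : v = x
    · exact Or.inl (by rw [hvx])
    · rw [hull_mk] at hz hz'
      exact Or.inr ⟨u, Sym2.mem_mk_left _ _, Sym2.mem_mk_left _ _,
        eq_of_orient_ne_zero (a := r u) (b := r v) (d := r x)
          (hgen' u v x huv hwx.ne.symm (Ne.symm hvx)) hz hz'⟩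
  have hdiag : ∀ (e : Sym2 V) w z, (e.IsDiag ∨ e ∈ G.edgeSet) → z ∈ hull p e →
      z ∈ hull p s(w, w) → w ∈ e ∧ z = p w := by
    intro e w z he hz hz'
    rw [hull_mk, segment_same, Set.mem_singleton_iff] at hz'
    subst hz'
    refine ⟨?_, rfl⟩
    induction e with
    | _ u v =>
      rcases he with he | he
      · obtain rfl : u = v := he
        rw [hull_mk, segment_same, Set.mem_singleton_iff] at hz
        rw [hpinj hz]
        exact Sym2.mem_mk_left _ _
      · exact hvert u v w he hz
  intro e f he hf z hz hz'
  change z ∈ hull p e at hz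
  change z ∈ hull p f at hz'
  induction e with
  | _ u v =>
    induction f with
    | _ w x =>
      rcases hf with hf | hf
      · obtain rfl : w = x := hf
        obtain ⟨h1, h2⟩ := hdiag _ w z he hz hz'
        exact Or.inr ⟨w, h1, Sym2.mem_mk_left _ _, h2⟩
      · rcases he with he | he
        · obtain rfl : u = v := he
          obtain ⟨h1, h2⟩ := hdiag _ u z (Or.inr hf) hz' hz
          exact Or.inr ⟨u, Sym2.mem_mk_left _ _, h1, h2⟩
        · have he' : G.Adj u v := he
          have hf' : G.Adj w x := hf
          rcases hsep' u v w x he' hf' with (h1 | h1 | h1 | h1) | h1 | h1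
          · exact hsymm u v w x z he' hf' hz hz' h1
          · have := hsymm u v x w z he' hf'.symm hz (by rwa [Sym2.eq_swap]) h1
            rwa [Sym2.eq_swap (a := x)] at this
          · have := hsymm v u w x z he'.symm hf' (by rwa [Sym2.eq_swap]) hz' h1
            rwa [Sym2.eq_swap (a := v)] at this
          · have := hsymm v u x w z he'.symm hf'.symm (by rwa [Sym2.eq_swap])
              (by rwa [Sym2.eq_swap]) h1
            rwa [Sym2.eq_swap (a := v), Sym2.eq_swap (a := x)] at this
          · rw [hull_mk] at hz hz'
            exact (false_of_orient_mul_pos (a := r u) (b := r v) (c := r w) (d := r x) h1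
              hz hz').elim
          · rw [hull_mk] at hz hz'
            exact (false_of_orient_mul_pos (a := r w) (b := r x) (c := r u) (d := r v) h1
              hz' hz).elim

/-- Division by `n` turns a drawing with integer coordinates and `a₁ = (0, 0)`, `a₂ = (n, 0)` into
a strip drawing. -/
theorem IsIntDrawing.exists_isStripDrawing {V : Type} {G : SimpleGraph V} {q : V → ℤ × ℤ}
    (h : IsIntDrawing G q) {a₁ a₂ : V} {n : ℤ} (hn : 0 < n) (h₁ : q a₁ = (0, 0))
    (h₂ : q a₂ = (n, 0)) (hs : ∀ v, v = a₁ ∨ v = a₂ ∨ (0 < (q v).1 ∧ (q v).1 < n)) :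
    ∃ p, IsStripDrawing G a₁ a₂ p := by
  have hn' : (0 : ℝ) < n := by exact_mod_cast hn
  have hn0 : (n : ℝ)⁻¹ ≠ 0 := inv_ne_zero hn'.ne'
  have hT : ∀ z, (LinearMap.lsmul ℝ ℂ (n : ℝ)⁻¹).toAffineMap z = (n : ℝ)⁻¹ • z := fun z => rfl
  refine ⟨_, h.isDrawing.affine (LinearMap.lsmul ℝ ℂ (n : ℝ)⁻¹).toAffineMap
    (smul_right_injective ℂ hn0), ?_, ?_, fun v h1 h2 => ?_⟩
  · rw [Function.comp_apply, hT, h₁]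
    apply Complex.ext <;> simp
  · rw [Function.comp_apply, hT, h₂]
    apply Complex.ext <;> simp [hn'.ne']
  · obtain ⟨h3, h4⟩ := ((hs v).resolve_left h1).resolve_left h2
    have h3' : (0 : ℝ) < (q v).1 := by exact_mod_cast h3
    have h4' : ((q v).1 : ℝ) < n := by exact_mod_cast h4
    rw [Function.comp_apply, hT, Complex.smul_re, smul_eq_mul]
    refine ⟨mul_pos (inv_pos.2 hn') h3', ?_⟩
    rw [inv_mul_lt_iff₀ hn', mul_one]
    exact h4'

/-! ### The cube, the six-prism and the smallest graph `K` -/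

instance (n : ℕ) : DecidableRel (prism n).Adj := fun _ _ =>
  decidable_of_iff' _ SimpleGraph.boxProd_adj

instance {V W : Type} [DecidableEq V] [DecidableEq W] (A : SimpleGraph V) [DecidableRel A.Adj]
    (a₁ a₂ : V) (B : SimpleGraph W) [DecidableRel B.Adj] (b₁ b₂ : W) :
    DecidableRel (glueMiddle A a₁ a₂ B b₁ b₂).Adj := by
  rintro (x | x | x) (y | y | y) <;> unfold glueMiddle <;> dsimp only <;> infer_instance

/-- Positions of the vertices of the cube, with an edge as the longest side of the outer face. -/
def cubePos (v : Fin 4 × Fin 2) : ℤ × ℤ :=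
  ![![(0, 0), (4, 2)], ![(12, 0), (8, 3)], ![(9, 9), (7, 6)], ![(3, 10), (5, 7)]] v.1 v.2

/-- Positions of the vertices of the six-prism, with an edge as the longest side of the outer
face. -/
def sixPrismPos (v : Fin 6 × Fin 2) : ℤ × ℤ :=
  ![![(0, 0), (8, 4)], ![(24, 0), (16, 5)], ![(21, 11), (18, 10)], ![(15, 19), (16, 13)],
    ![(7, 21), (9, 16)], ![(3, 13), (6, 11)]] v.1 v.2

/-- The graph `K` glued from two cubes. -/
abbrev cubePair : SimpleGraph (Fin 4 × Fin 2 ⊕ (Fin 4 × Fin 2 ⊕ Fin 2)) :=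
  glueMiddle cube (0, 0) (1, 0) cube (0, 0) (1, 0)

/-- Positions of the vertices of `K`: the middle edge is horizontal, and the two cubes are drawn
above and below. -/
def cubePairPos : Fin 4 × Fin 2 ⊕ (Fin 4 × Fin 2 ⊕ Fin 2) → ℤ × ℤ :=
  Sum.elim (fun v => cubePos v + (3, 2))
    (Sum.elim (fun v => ((cubePos v).1 + 1, -(cubePos v).2 - 2)) ![(0, 0), (18, 0)])

theorem isIntDrawing_cube : IsIntDrawing cube cubePos := by decide +kernel

theorem isIntDrawing_sixPrism : IsIntDrawing sixPrism sixPrismPos := by decide +kernel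

theorem isIntDrawing_cubePair : IsIntDrawing cubePair cubePairPos := by decide +kernel

theorem exists_isStripDrawing_cube : ∃ p, IsStripDrawing cube (0, 0) (1, 0) p :=
  isIntDrawing_cube.exists_isStripDrawing (n := 12) (by norm_num) rfl rfl (by decide +kernel)

theorem exists_isStripDrawing_sixPrism : ∃ p, IsStripDrawing sixPrism (0, 0) (1, 0) p :=
  isIntDrawing_sixPrism.exists_isStripDrawing (n := 24) (by norm_num) rfl rfl (by decide +kernel)

theorem exists_isStripDrawing_cubePair :
    ∃ p, IsStripDrawing cubePair (Sum.inr (Sum.inr 0)) (Sum.inr (Sum.inr 1)) p :=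
  isIntDrawing_cubePair.exists_isStripDrawing (n := 18) (by norm_num) rfl rfl (by decide +kernel)

/-- A graph is 2-connected if each of its vertices is left out by a path through all others. -/
theorem isTwoConnected_of_paths {V : Type} {G : SimpleGraph V} (h3 : 3 ≤ Nat.card V)
    (h : ∀ v, ∃ l : List V, l.IsChain G.Adj ∧ v ∉ l ∧ ∀ w, w ≠ v → w ∈ l) :
    IsTwoConnected G := by
  refine isTwoConnected_iff.2 ⟨h3, fun v c hc => ?_⟩
  obtain ⟨l, hl, hv, hw⟩ := h v
  have key : ∀ l : List V, l.IsChain G.Adj → v ∉ l → ∀ x ∈ l, ∀ y ∈ l, (c x ↔ c y) := by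
    intro l
    induction l with
    | nil => simp
    | cons a l ih =>
      intro hl hv
      have ih' := ih hl.tail (fun h => hv (List.mem_cons_of_mem _ h))
      have ha : ∀ x ∈ l, (c a ↔ c x) := by
        cases l with
        | nil => simp
        | cons b l =>
          intro x hx
          have hab : c a ↔ c b := hc a b (fun h => hv (by simp [h])) (fun h => hv (by simp [h]))
            (List.isChain_cons_cons.1 hl).1
          exact hab.trans (ih' b (by simp) x hx)
      intro x hx y hy
      have ha' : ∀ x ∈ a :: l, (c a ↔ c x) := List.forall_mem_cons.2 ⟨Iff.rfl, ha⟩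
      exact (ha' x hx).symm.trans (ha' y hy)
  exact fun x y hx hy => key l hl hv x (hw x hx) y (hw y hy)

theorem isCubic_prism_of_decide {n : ℕ} (h : ∀ v, (prism n).degree v = 3) : IsCubic (prism n) := by
  intro v
  rw [← h v, ← SimpleGraph.card_neighborSet_eq_degree, ← Nat.card_coe_set_eq,
    Nat.card_eq_fintype_card]

/-- A Hamiltonian cycle of the cube. -/
def cubeCycle : List (Fin 4 × Fin 2) :=
  [(0, 0), (1, 0), (2, 0), (3, 0), (3, 1), (2, 1), (1, 1), (0, 1)]

/-- A Hamiltonian cycle of the six-prism. -/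
def sixPrismCycle : List (Fin 6 × Fin 2) :=
  [(0, 0), (1, 0), (2, 0), (3, 0), (4, 0), (5, 0), (5, 1), (4, 1), (3, 1), (2, 1), (1, 1), (0, 1)]

theorem isCubicBipartite_cube : IsCubicBipartite cube where
  finite := inferInstance
  twoConnected := by
    refine isTwoConnected_of_paths (by simp) fun v => ?_
    have : ∃ i : Fin 8, ((cubeCycle.rotate i).tail).IsChain cube.Adj ∧
        v ∉ (cubeCycle.rotate i).tail ∧ ∀ w, w ≠ v → w ∈ (cubeCycle.rotate i).tail := by
      revert v
      decide +kernel
    obtain ⟨i, hi⟩ := this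
    exact ⟨_, hi⟩
  cubic := isCubic_prism_of_decide (by decide +kernel)
  bipartite := isBipartite_iff_exists_bool.2
    ⟨fun v => decide ((v.1.val + v.2.val) % 2 = 0), by decide +kernel⟩

theorem isCubicBipartite_sixPrism : IsCubicBipartite sixPrism where
  finite := inferInstance
  twoConnected := by
    refine isTwoConnected_of_paths (by simp) fun v => ?_
    have : ∃ i : Fin 12, ((sixPrismCycle.rotate i).tail).IsChain sixPrism.Adj ∧
        v ∉ (sixPrismCycle.rotate i).tail ∧ ∀ w, w ≠ v → w ∈ (sixPrismCycle.rotate i).tail := by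
      revert v
      decide +kernel
    obtain ⟨i, hi⟩ := this
    exact ⟨_, hi⟩
  cubic := isCubic_prism_of_decide (by decide +kernel)
  bipartite := isBipartite_iff_exists_bool.2
    ⟨fun v => decide ((v.1.val + v.2.val) % 2 = 0), by decide +kernel⟩

theorem IsCubeOrSixPrism.isCBP {V : Type} {G : SimpleGraph V} (h : IsCubeOrSixPrism V G) :
    IsCBP G := by
  rcases h with ⟨⟨e⟩⟩ | ⟨⟨e⟩⟩
  · obtain ⟨p, hp⟩ := exists_isStripDrawing_cube
    exact (isCubicBipartite_cube.of_iso e).isCBP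
      (hp.drawing.comp_hom e e.injective fun u v h => e.map_rel_iff.2 h).isPlanar
  · obtain ⟨p, hp⟩ := exists_isStripDrawing_sixPrism
    exact (isCubicBipartite_sixPrism.of_iso e).isCBP
      (hp.drawing.comp_hom e e.injective fun u v h => e.map_rel_iff.2 h).isPlanar

theorem IsCubeOrSixPrism.isGlued {V : Type} {G : SimpleGraph V} (h : IsCubeOrSixPrism V G) :
    IsGlued G := by
  rcases h with ⟨⟨e⟩⟩ | ⟨⟨e⟩⟩
  · exact .iso .cube e.symm
  · exact .iso .sixPrism e.symm

/-! ### The classes of ingredients and the graphs of the construction -/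

theorem StepK.mono {𝓑 𝓒 : ∀ V : Type, SimpleGraph V → Prop} (h : ∀ V G, 𝓑 V G → 𝓒 V G) {V : Type}
    {G : SimpleGraph V} {u v : V} (hG : StepK 𝓑 G u v) : StepK 𝓒 G u v := by
  cases hG with
  | mk A B hA hB vA vB a₁ a₂ b₁ b₂ ha hb =>
    exact .mk A B (h _ _ hA) (h _ _ hB) vA vB a₁ a₂ b₁ b₂ ha hb

theorem StepH.mono {𝓑 𝓒 : ∀ V : Type, SimpleGraph V → Prop} (h : ∀ V G, 𝓑 V G → 𝓒 V G) {V : Type}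
    {G : SimpleGraph V} {h₁ h₂ x : V} (hG : StepH 𝓑 G h₁ h₂ x) : StepH 𝓒 G h₁ h₂ x := by
  cases hG with
  | mk K S k k₁ k₂ k₃ hK hk₂ hk₃ h₁₂ h₁₃ h₂₃ hS vS s σ =>
    exact .mk K S k k₁ k₂ k₃ (hK.imp (.mono h) (.mono h)) hk₂ hk₃ h₁₂ h₁₃ h₂₃ (h _ _ hS) vS s σ

theorem StepD.mono {𝓑 𝓒 : ∀ V : Type, SimpleGraph V → Prop} (h : ∀ V G, 𝓑 V G → 𝓒 V G) {V : Type}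
    {G : SimpleGraph V} {x : V} (hG : StepD 𝓑 G x) : StepD 𝓒 G x := by
  cases hG with
  | mk K H z₁ z₂ h₁ h₂ x hK hH =>
    exact .mk K H z₁ z₂ h₁ h₂ x (hK.imp (.mono h) (.mono h)) (hH.mono h)

theorem StepF.mono {𝓑 𝓒 : ∀ V : Type, SimpleGraph V → Prop} (h : ∀ V G, 𝓑 V G → 𝓒 V G) {V : Type}
    {G : SimpleGraph V} {f₁ f₂ : V} (hG : StepF 𝓑 G f₁ f₂) : StepF 𝓒 G f₁ f₂ := by
  cases hG with
  | mk Q D q₁ q₂ x y hQ vQ hq hD hd => exact .mk Q D q₁ q₂ x y (h _ _ hQ) vQ hq (hD.mono h) hd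

theorem StepN.mono {𝓑 𝓒 : ∀ V : Type, SimpleGraph V → Prop} (h : ∀ V G, 𝓑 V G → 𝓒 V G) {V : Type}
    {G : SimpleGraph V} (hG : StepN 𝓑 G) : StepN 𝓒 G := by
  cases hG with
  | mk K F z₁ z₂ f₁ f₂ hK hF => exact .mk K F z₁ z₂ f₁ f₂ (hK.imp (.mono h) (.mono h)) (hF.mono h)

/-- A class of graphs that is closed under the three gluing operations. -/
structure IsGluingClosed (𝓒 : ∀ V : Type, SimpleGraph V → Prop) : Prop where
  vertex {V W : Type} {A : SimpleGraph V} {B : SimpleGraph W} (hA : 𝓒 V A) (hB : 𝓒 W B)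
    (a : V) (b : W) (σ : A.neighborSet a ≃ B.neighborSet b) : 𝓒 _ (glueVertex A a B b σ)
  edge {V W : Type} {A : SimpleGraph V} {B : SimpleGraph W} (hA : 𝓒 V A) (hB : 𝓒 W B)
    {a₁ a₂ : V} {b₁ b₂ : W} (ha : A.Adj a₁ a₂) (hb : B.Adj b₁ b₂) : 𝓒 _ (glueEdge A a₁ a₂ B b₁ b₂)
  middle {V W : Type} {A : SimpleGraph V} {B : SimpleGraph W} (hA : 𝓒 V A) (hB : 𝓒 W B)
    {a₁ a₂ : V} {b₁ b₂ : W} (ha : A.Adj a₁ a₂) (hb : B.Adj b₁ b₂) :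
    𝓒 _ (glueMiddle A a₁ a₂ B b₁ b₂)

theorem isGluingClosed_isGlued : IsGluingClosed fun _ G => IsGlued G :=
  ⟨.vertex, .edge, .middle⟩

theorem isGluingClosed_isCubicBipartite : IsGluingClosed fun _ G => IsCubicBipartite G :=
  ⟨fun hA hB _ _ σ => hA.glueVertex hB σ, .glueEdge, .glueMiddle⟩

theorem StepK.mem_and_adj {𝓒 : ∀ V : Type, SimpleGraph V → Prop} (h𝓒 : IsGluingClosed 𝓒) {V : Type}
    {K : SimpleGraph V} {z₁ z₂ : V} (hK : StepK 𝓒 K z₁ z₂ ∨ StepK 𝓒 K z₂ z₁) :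
    𝓒 V K ∧ K.Adj z₁ z₂ := by
  rcases hK with hK | hK
  · cases hK with
    | mk A B hA hB vA vB a₁ a₂ b₁ b₂ ha hb => exact ⟨h𝓒.middle hA hB ha hb, zero_ne_one⟩
  · cases hK with
    | mk A B hA hB vA vB a₁ a₂ b₁ b₂ ha hb => exact ⟨h𝓒.middle hA hB ha hb, one_ne_zero⟩

theorem StepH.mem_and_adj {𝓒 : ∀ V : Type, SimpleGraph V → Prop} (h𝓒 : IsGluingClosed 𝓒) {V : Type}
    {H : SimpleGraph V} {h₁ h₂ x : V} (hH : StepH 𝓒 H h₁ h₂ x) : 𝓒 V H ∧ H.Adj h₁ h₂ := by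
  cases hH with
  | mk K S k k₁ k₂ k₃ hK hk₂ hk₃ h₁₂ h₁₃ h₂₃ hS vS s σ =>
    exact ⟨h𝓒.vertex (StepK.mem_and_adj h𝓒 hK).1 hS _ _ _, hk₃, rfl⟩

theorem StepD.mem {𝓒 : ∀ V : Type, SimpleGraph V → Prop} (h𝓒 : IsGluingClosed 𝓒) {V : Type}
    {D : SimpleGraph V} {x : V} (hD : StepD 𝓒 D x) : 𝓒 V D := by
  cases hD with
  | mk K H z₁ z₂ h₁ h₂ x hK hH =>
    obtain ⟨h1, h2⟩ := StepK.mem_and_adj h𝓒 hK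
    obtain ⟨h3, h4⟩ := hH.mem_and_adj h𝓒
    exact h𝓒.edge h1 h3 h2 h4

theorem StepF.mem_and_adj {𝓒 : ∀ V : Type, SimpleGraph V → Prop} (h𝓒 : IsGluingClosed 𝓒) {V : Type}
    {F : SimpleGraph V} {f₁ f₂ : V} (hF : StepF 𝓒 F f₁ f₂) : 𝓒 V F ∧ F.Adj f₁ f₂ := by
  cases hF with
  | mk Q D q₁ q₂ x y hQ vQ hq hD hd =>
    exact ⟨h𝓒.edge hQ (hD.mem h𝓒) hq hd, Or.inr ⟨rfl, rfl⟩⟩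

/-- The construction does not leave a class that is closed under the gluing operations. -/
theorem StepN.mem {𝓒 : ∀ V : Type, SimpleGraph V → Prop} (h𝓒 : IsGluingClosed 𝓒) {V : Type}
    {N : SimpleGraph V} (hN : StepN 𝓒 N) : 𝓒 V N := by
  cases hN with
  | mk K F z₁ z₂ f₁ f₂ hK hF =>
    obtain ⟨h1, h2⟩ := StepK.mem_and_adj h𝓒 hK
    obtain ⟨h3, h4⟩ := hF.mem_and_adj h𝓒
    exact h𝓒.edge h1 h3 h2 h4

/-! ### The order of the graphs of the construction -/

theorem card_ne {V : Type} [Finite V] (a : V) : Nat.card {x // x ≠ a} = Nat.card V - 1 := by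
  have := Fintype.ofFinite V
  classical
  rw [Nat.card_eq_fintype_card, Nat.card_eq_fintype_card]
  exact Set.card_ne_eq a

theorem IsCBP.eight_le_card {V : Type} {G : SimpleGraph V} (h : IsCBP G) (h2 : Nat.card V % 6 = 2) :
    8 ≤ Nat.card V := by
  have := h.twoConnected.1
  omega

theorem IsCBP.twelve_le_card {V : Type} {G : SimpleGraph V} (h : IsCBP G)
    (h0 : Nat.card V % 6 = 0) : 12 ≤ Nat.card V := by
  have := h.twoConnected.1
  have := h.card_ne_six
  omega

theorem StepK.le_card {V : Type} {K : SimpleGraph V} {z₁ z₂ : V}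
    (hK : StepK (fun _ B => IsCBP B) K z₁ z₂ ∨ StepK (fun _ B => IsCBP B) K z₂ z₁) :
    Finite V ∧ 18 ≤ Nat.card V := by
  have main : ∀ {V : Type} {K : SimpleGraph V} {z₁ z₂ : V},
      StepK (fun _ B => IsCBP B) K z₁ z₂ → Finite V ∧ 18 ≤ Nat.card V := by
    intro V K z₁ z₂ hK
    cases hK with
    | mk A B hA hB vA vB a₁ a₂ b₁ b₂ ha hb =>
      have := hA.finite
      have := hB.finite
      have := hA.eight_le_card vA
      have := hB.eight_le_card vB
      refine ⟨inferInstance, ?_⟩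
      rw [Nat.card_sum, Nat.card_sum, Nat.card_fin]
      omega
  exact hK.elim main main

theorem StepH.le_card {V : Type} {H : SimpleGraph V} {h₁ h₂ x : V}
    (hH : StepH (fun _ B => IsCBP B) H h₁ h₂ x) : Finite V ∧ 28 ≤ Nat.card V := by
  cases hH with
  | mk K S k k₁ k₂ k₃ hK hk₂ hk₃ h₁₂ h₁₃ h₂₃ hS vS s σ =>
    obtain ⟨_, h1⟩ := StepK.le_card hK
    have := hS.finite
    have := hS.twelve_le_card vS
    refine ⟨inferInstance, ?_⟩
    rw [Nat.card_sum, card_ne, card_ne]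
    omega

theorem StepD.le_card {V : Type} {D : SimpleGraph V} {x : V}
    (hD : StepD (fun _ B => IsCBP B) D x) : Finite V ∧ 46 ≤ Nat.card V := by
  cases hD with
  | mk K H z₁ z₂ h₁ h₂ x hK hH =>
    obtain ⟨_, h1⟩ := StepK.le_card hK
    obtain ⟨_, h2⟩ := hH.le_card
    refine ⟨inferInstance, ?_⟩
    rw [Nat.card_sum]
    omega

theorem StepF.le_card {V : Type} {F : SimpleGraph V} {f₁ f₂ : V}
    (hF : StepF (fun _ B => IsCBP B) F f₁ f₂) : Finite V ∧ 54 ≤ Nat.card V := by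
  cases hF with
  | mk Q D q₁ q₂ x y hQ vQ hq hD hd =>
    obtain ⟨_, h1⟩ := hD.le_card
    have := hQ.finite
    have := hQ.eight_le_card vQ
    refine ⟨inferInstance, ?_⟩
    rw [Nat.card_sum]
    omega

theorem StepN.le_card {V : Type} {N : SimpleGraph V} (hN : StepN (fun _ B => IsCBP B) N) :
    72 ≤ Nat.card V := by
  cases hN with
  | mk K F z₁ z₂ f₁ f₂ hK hF =>
    obtain ⟨_, h1⟩ := StepK.le_card hK
    obtain ⟨_, h2⟩ := hF.le_card
    rw [Nat.card_sum]
    omega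

/-! ### Planar graphs of the construction -/

/-- The vertex-gluing of `K = A a|b B` and `S` at an end `k` of the middle edge of `K` inserts `A`
and `B` into two of the edges at `s`, and the other end of the middle edge takes the place of `s`. -/
theorem exists_isDrawing_glueVertex_glueMiddle {V₁ V₂ W : Type} [Finite V₁] [Finite V₂] [Finite W]
    {A : SimpleGraph V₁} {a₁ a₂ : V₁} {pA : V₁ → ℂ} (hA : IsStripDrawing A a₁ a₂ pA)
    {B : SimpleGraph V₂} {b₁ b₂ : V₂} {pB : V₂ → ℂ} (hB : IsStripDrawing B b₁ b₂ pB)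
    {S : SimpleGraph W} {pS : W → ℂ} (hS : IsDrawing S pS) {s : W}
    (σ : (glueMiddle A a₁ a₂ B b₁ b₂).neighborSet (Sum.inr (Sum.inr 0)) ≃ S.neighborSet s) :
    ∃ p, IsDrawing (glueVertex (glueMiddle A a₁ a₂ B b₁ b₂) (Sum.inr (Sum.inr 0)) S s σ) p := by
  have ha : (glueMiddle A a₁ a₂ B b₁ b₂).Adj (Sum.inr (Sum.inr 0)) (Sum.inl a₁) :=
    Or.inl ⟨rfl, rfl⟩
  have hb : (glueMiddle A a₁ a₂ B b₁ b₂).Adj (Sum.inr (Sum.inr 0)) (Sum.inr (Sum.inl b₁)) :=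
    Or.inl ⟨rfl, rfl⟩
  have hσ : ∀ {u v} (hu : (glueMiddle A a₁ a₂ B b₁ b₂).Adj (Sum.inr (Sum.inr 0)) u)
      (hv : (glueMiddle A a₁ a₂ B b₁ b₂).Adj (Sum.inr (Sum.inr 0)) v),
      (σ ⟨u, hu⟩ : W) = σ ⟨v, hv⟩ → u = v := fun hu hv h =>
    congrArg Subtype.val (σ.injective (Subtype.ext h))
  have hσs : ∀ u, (σ u : W) ≠ s := fun u => (S.ne_of_adj (σ u).2).symm
  let α : W := σ ⟨Sum.inl a₁, ha⟩
  let β : W := σ ⟨Sum.inr (Sum.inl b₁), hb⟩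
  have hαβ : α ≠ β := fun h => by simpa using hσ ha hb h
  have hαs : S.Adj s α := (σ ⟨Sum.inl a₁, ha⟩).2
  have hβs : S.Adj s β := (σ ⟨Sum.inr (Sum.inl b₁), hb⟩).2
  obtain ⟨p₁, -, h₁⟩ := exists_isDrawing_glueEdge hB hS hβs.symm isOpen_univ (Set.subset_univ _)
  obtain ⟨p₂, -, h₂⟩ := exists_isDrawing_glueEdge hA h₁ (b₁ := Sum.inr α) (b₂ := Sum.inr s)
    ⟨hαs.symm, by simp [hαβ, hαs.ne']⟩ isOpen_univ (Set.subset_univ _)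
  let φ : {x : V₁ ⊕ (V₂ ⊕ Fin 2) // x ≠ Sum.inr (Sum.inr 0)} ⊕ {y : W // y ≠ s} → V₁ ⊕ (V₂ ⊕ W) :=
    Sum.elim (fun x => Sum.elim Sum.inl (fun y => Sum.inr (Sum.elim Sum.inl (fun _ => Sum.inr s) y))
      x.1) (fun y => Sum.inr (Sum.inr y.1))
  refine ⟨_, h₂.comp_hom φ ?_ ?_⟩
  · rintro (⟨x | x | i, hx⟩ | ⟨x, hx⟩) (⟨y | y | j, hy⟩ | ⟨y, hy⟩) h
    all_goals simp only [φ, Sum.elim_inl, Sum.elim_inr, Sum.inl.injEq, Sum.inr.injEq, reduceCtorEq]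
      at h
    all_goals try subst h
    all_goals try rfl
    · have hi : i ≠ 0 := fun h => hx (by rw [h])
      have hj : j ≠ 0 := fun h => hy (by rw [h])
      have : i = j := by omega
      subst this
      rfl
    · exact absurd rfl hy
    · exact absurd rfl hx
  · have hi1 : ∀ i : Fin 2, (Sum.inr (Sum.inr i) : V₁ ⊕ (V₂ ⊕ Fin 2)) ≠ Sum.inr (Sum.inr 0) →
        i = 1 := fun i hi => by
      have : i ≠ 0 := fun h => hi (by rw [h])
      omega
    have hcross : ∀ x y, (glueVertex (glueMiddle A a₁ a₂ B b₁ b₂) (Sum.inr (Sum.inr 0)) S s σ).Adj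
        (Sum.inl x) (Sum.inr y) →
        (glueEdge A a₁ a₂ (glueEdge B b₁ b₂ S β s) (Sum.inr α) (Sum.inr s)).Adj
          (φ (Sum.inl x)) (φ (Sum.inr y)) := by
      rintro ⟨x | x | i, hx⟩ ⟨y, hy⟩ ⟨h, rfl⟩
      · rcases h with ⟨rfl, -⟩ | ⟨-, h⟩
        · exact Or.inl ⟨rfl, rfl⟩
        · simp at h
      · rcases h with ⟨rfl, -⟩ | ⟨-, h⟩
        · exact ⟨Or.inl ⟨rfl, rfl⟩, by simp⟩
        · simp at h
      · have hne1 := hσs ⟨Sum.inr (Sum.inr i), h⟩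
        have hne2 : (σ ⟨Sum.inr (Sum.inr i), h⟩ : W) ≠ α := fun h' => by simpa using hσ h ha h'
        have hne3 : (σ ⟨Sum.inr (Sum.inr i), h⟩ : W) ≠ β := fun h' => by simpa using hσ h hb h'
        exact ⟨⟨(σ ⟨Sum.inr (Sum.inr i), h⟩).2, by simp [hne1, hne3]⟩, by simp [hne1, hne2]⟩
    rintro (x | x) (y | y) h
    · obtain ⟨x | x | i, hx⟩ := x <;> obtain ⟨y | y | j, hy⟩ := y
      · exact h
      · exact h.elim
      · obtain rfl := hi1 j hy
        rcases h with ⟨-, h⟩ | ⟨rfl, -⟩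
        · simp at h
        · exact Or.inr ⟨rfl, rfl⟩
      · exact h.elim
      · exact ⟨h, by simp⟩
      · obtain rfl := hi1 j hy
        rcases h with ⟨-, h⟩ | ⟨rfl, -⟩
        · simp at h
        · exact ⟨Or.inr ⟨rfl, rfl⟩, by simp⟩
      · obtain rfl := hi1 i hx
        rcases h with ⟨-, h⟩ | ⟨rfl, -⟩
        · simp at h
        · exact Or.inr ⟨rfl, rfl⟩
      · obtain rfl := hi1 i hx
        rcases h with ⟨-, h⟩ | ⟨rfl, -⟩
        · simp at h
        · exact ⟨Or.inr ⟨rfl, rfl⟩, by simp⟩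
      · obtain rfl := hi1 i hx
        obtain rfl := hi1 j hy
        exact absurd rfl h
    · exact hcross x y h
    · exact (hcross y x h.symm).symm
    · have hx := x.2
      have hy := y.2
      exact ⟨⟨h, by simp [hx, hy]⟩, by simp [hx, hy]⟩

/-- The construction with cubes for all ingredients with `2` vertices modulo 6 except for `Q`, and
the six-prism for the remaining one, gives a graph with a straight-line drawing. -/
theorem exists_stepN_of_isStripDrawing {𝓑 : ∀ V : Type, SimpleGraph V → Prop} (hc : 𝓑 _ cube)
    (hs : 𝓑 _ sixPrism) {V : Type} [Finite V] {Q : SimpleGraph V} {q₁ q₂ : V} {p : V → ℂ}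
    (hQ : 𝓑 V Q) (vQ : Nat.card V % 6 = 2) (hq : Q.Adj q₁ q₂) (hp : IsStripDrawing Q q₁ q₂ p) :
    ∃ (V' : Type) (N : SimpleGraph V') (p' : V' → ℂ), Nat.card V' = 64 + Nat.card V ∧
      StepN 𝓑 N ∧ IsDrawing N p' := by
  have hK : StepK 𝓑 cubePair (Sum.inr (Sum.inr 0)) (Sum.inr (Sum.inr 1)) :=
    .mk cube cube hc hc (by simp) (by simp) _ _ _ _ (by decide) (by decide)
  have hcK : IsCubic cubePair := isCubicBipartite_cube.cubic.glueMiddle isCubicBipartite_cube.cubic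
    (by decide) (by decide)
  let k : Fin 4 × Fin 2 ⊕ (Fin 4 × Fin 2 ⊕ Fin 2) := Sum.inr (Sum.inr 0)
  have h₁ : Nat.card (cubePair.neighborSet k) = 3 := by rw [Nat.card_coe_set_eq, hcK]
  have h₂ : Nat.card (sixPrism.neighborSet (0, 0)) = 3 := by
    rw [Nat.card_coe_set_eq, isCubicBipartite_sixPrism.cubic]
  let σ := (Finite.equivFinOfCardEq h₁).trans (Finite.equivFinOfCardEq h₂).symm
  have hk₂ : cubePair.Adj k (Sum.inl (0, 0)) := Or.inl ⟨rfl, rfl⟩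
  have hk₃ : cubePair.Adj k (Sum.inr (Sum.inl (0, 0))) := Or.inl ⟨rfl, rfl⟩
  have hH := StepH.mk cubePair sixPrism k _ _ _ (Or.inl hK) hk₂ hk₃ (by simp) (by simp) (by simp)
    hs (by simp) (0, 0) σ
  have hD := StepD.mk cubePair _ _ _ _ _ _ (Or.inl hK) hH
  have hF := StepF.mk Q _ q₁ q₂ _
    (Sum.inr (Sum.inl ⟨Sum.inl (0, 0), hk₂.ne'⟩)) hQ vQ hq hD
    ⟨⟨hk₂, rfl⟩, by simp⟩
  have hN := StepN.mk cubePair _ _ _ _ _ (Or.inl hK) hF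
  obtain ⟨pc, hpc⟩ := exists_isStripDrawing_cube
  obtain ⟨ps, hps⟩ := exists_isStripDrawing_sixPrism
  obtain ⟨pK, hpK⟩ := exists_isStripDrawing_cubePair
  obtain ⟨pH, hpH⟩ := exists_isDrawing_glueVertex_glueMiddle hpc hpc hps.drawing σ
  obtain ⟨pD, -, hpD⟩ := exists_isDrawing_glueEdge hpK hpH
    (b₁ := Sum.inl ⟨Sum.inr (Sum.inl (0, 0)), hk₃.ne'⟩)
    (b₂ := Sum.inr ⟨(σ ⟨_, hk₃⟩ : Fin 6 × Fin 2), (sixPrism.ne_of_adj (σ ⟨_, hk₃⟩).2).symm⟩)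
    ⟨hk₃, rfl⟩ isOpen_univ (Set.subset_univ _)
  obtain ⟨pF, -, hpF⟩ := exists_isDrawing_glueEdge hp hpD
    (b₁ := Sum.inr (Sum.inr ⟨(σ ⟨_, hk₂⟩ : Fin 6 × Fin 2),
      (sixPrism.ne_of_adj (σ ⟨_, hk₂⟩).2).symm⟩))
    (b₂ := Sum.inr (Sum.inl ⟨Sum.inl (0, 0), hk₂.ne'⟩))
    ⟨⟨hk₂, rfl⟩, by simp⟩ isOpen_univ (Set.subset_univ _)
  obtain ⟨pN, -, hpN⟩ := exists_isDrawing_glueEdge hpK hpF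
    (b₁ := Sum.inl q₂) (b₂ := Sum.inr (Sum.inr (Sum.inl ⟨Sum.inl (0, 0), hk₂.ne'⟩)))
    (Or.inr ⟨rfl, rfl⟩) isOpen_univ (Set.subset_univ _)
  refine ⟨_, _, _, ?_, hN, hpN⟩
  simp only [Nat.card_sum, card_ne]
  simp
  omega

/-- Ingredients of all orders `8 + 12m`: six-prisms are inserted one after the other into an edge of
a cube. -/
theorem exists_isStripDrawing_of_card (m : ℕ) :
    ∃ (V : Type) (Q : SimpleGraph V) (q₁ q₂ : V) (p : V → ℂ), Nat.card V = 8 + 12 * m ∧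
      IsCBP Q ∧ IsGlued Q ∧ Q.Adj q₁ q₂ ∧ IsStripDrawing Q q₁ q₂ p := by
  induction m with
  | zero =>
    obtain ⟨p, hp⟩ := exists_isStripDrawing_cube
    exact ⟨_, cube, (0, 0), (1, 0), p, by simp, isCubicBipartite_cube.isCBP hp.drawing.isPlanar,
      .cube, by decide, hp⟩
  | succ m ih =>
    obtain ⟨V, Q, q₁, q₂, p, hV, hQ, hQg, hq, hp⟩ := ih
    obtain ⟨p', hp'⟩ := exists_isStripDrawing_sixPrism
    have := hQ.finite
    -- an edge of `Q` other than `q₁q₂`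
    obtain ⟨r, hr, hne⟩ : ∃ r ∈ Q.neighborSet q₁, r ≠ q₂ :=
      Set.exists_ne_of_one_lt_ncard (by rw [hQ.cubic]; norm_num) q₂
    have hr : Q.Adj q₁ r := hr
    have h01 : sixPrism.Adj (0, 0) (1, 0) := by decide
    obtain ⟨p'', hp''⟩ := hp'.glueEdge hp hr
    refine ⟨_, glueEdge sixPrism (0, 0) (1, 0) Q q₁ r, Sum.inr q₁, Sum.inr q₂, p'', ?_,
      (isCubicBipartite_sixPrism.glueEdge hQ.isCubicBipartite h01 hr).isCBP hp''.drawing.isPlanar,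
      .edge .sixPrism hQg h01 hr, ⟨hq, ?_⟩, hp''⟩
    · rw [Nat.card_sum, hV]
      simp
      omega
    · simpa using ⟨hne.symm, fun h => absurd h hr.ne⟩

end LambdaPacking

theorem mainTheorem1 :
    -- infinitely many cubic, bipartite, planar, 2-connected graphs of order divisible by 6 without
    -- a Lambda-factor, all given by the construction and glued from cubes and six-prisms
    {n : ℕ | ∃ (V : Type) (G : SimpleGraph V), Nat.card V = n ∧
      LambdaPacking.IsCBP G ∧ Nat.card V % 6 = 0 ∧ ¬ LambdaPacking.HasLambdaFactor G ∧
      LambdaPacking.StepN (fun _ B => LambdaPacking.IsCBP B) G ∧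
      LambdaPacking.IsGlued G}.Infinite ∧
    -- every such graph satisfies the strict inequality
    (∀ (V : Type) (G : SimpleGraph V), LambdaPacking.IsCBP G → Nat.card V % 6 = 0 →
      ¬ LambdaPacking.HasLambdaFactor G → LambdaPacking.lambda G < Nat.card V / 3) ∧
    -- hence equality does not hold for all cubic, bipartite, planar, 2-connected graphs
    (¬ ∀ (V : Type) (G : SimpleGraph V), LambdaPacking.IsCBP G →
      LambdaPacking.lambda G = Nat.card V / 3) ∧
    -- cubes and six-prisms alone as ingredients give such a graph with 72 vertices
    (∃ (V : Type) (N : SimpleGraph V), Nat.card V = 72 ∧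
      LambdaPacking.StepN LambdaPacking.IsCubeOrSixPrism N ∧
      LambdaPacking.IsCBP N ∧ ¬ LambdaPacking.HasLambdaFactor N) ∧
    -- and 72 is the smallest order of such a graph given by the construction
    IsLeast {n : ℕ | ∃ (V : Type) (G : SimpleGraph V), Nat.card V = n ∧
      LambdaPacking.IsCBP G ∧ Nat.card V % 6 = 0 ∧ ¬ LambdaPacking.HasLambdaFactor G ∧
      LambdaPacking.StepN (fun _ B => LambdaPacking.IsCBP B) G} 72 := by
  -- a graph of each of the orders `72 + 12m`
  have hfam : ∀ m : ℕ, ∃ (V : Type) (G : SimpleGraph V), Nat.card V = 72 + 12 * m ∧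
      LambdaPacking.IsCBP G ∧ Nat.card V % 6 = 0 ∧ ¬ LambdaPacking.HasLambdaFactor G ∧
      LambdaPacking.StepN (fun _ B => LambdaPacking.IsCBP B) G ∧ LambdaPacking.IsGlued G := by
    intro m
    obtain ⟨V, Q, q₁, q₂, p, hV, hQ, hQg, hq, hp⟩ := LambdaPacking.exists_isStripDrawing_of_card m
    have := hQ.finite
    have hcube : LambdaPacking.IsCubeOrSixPrism _ LambdaPacking.cube := Or.inl ⟨.refl⟩
    have hsix : LambdaPacking.IsCubeOrSixPrism _ LambdaPacking.sixPrism := Or.inr ⟨.refl⟩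
    obtain ⟨V', N, p', hV', hN, hp'⟩ := LambdaPacking.exists_stepN_of_isStripDrawing
      (𝓑 := fun _ B => LambdaPacking.IsCBP B ∧ LambdaPacking.IsGlued B)
      ⟨hcube.isCBP, hcube.isGlued⟩ ⟨hsix.isCBP, hsix.isGlued⟩ ⟨hQ, hQg⟩ (by omega) hq hp
    exact ⟨V', N, by omega, ((hN.mono fun _ _ h => h.1.isCubicBipartite).mem
      LambdaPacking.isGluingClosed_isCubicBipartite).isCBP hp'.isPlanar, by omega,
      hN.not_hasLambdaFactor, hN.mono fun _ _ h => h.1,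
      (hN.mono fun _ _ h => h.2).mem LambdaPacking.isGluingClosed_isGlued⟩
  have hlt : ∀ (V : Type) (G : SimpleGraph V), LambdaPacking.IsCBP G → Nat.card V % 6 = 0 →
      ¬ LambdaPacking.HasLambdaFactor G → LambdaPacking.lambda G < Nat.card V / 3 := by
    intro V G hG h6 hn
    have := hG.finite
    exact LambdaPacking.lambda_lt_of_not_hasLambdaFactor h6 hn
  refine ⟨?_, hlt, fun hall => ?_, ?_, ?_, ?_⟩
  · refine Set.infinite_of_injective_forall_mem (f := fun m : ℕ => 72 + 12 * m)
      (fun m n h => by simpa using h) fun m => hfam m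
  · obtain ⟨V, G, -, hG, h6, hn, -⟩ := hfam 0
    exact (hlt V G hG h6 hn).ne (hall V G hG)
  · obtain ⟨p, hp⟩ := LambdaPacking.exists_isStripDrawing_cube
    obtain ⟨V, N, p', hV, hN, hp'⟩ := LambdaPacking.exists_stepN_of_isStripDrawing
      (𝓑 := LambdaPacking.IsCubeOrSixPrism) (Or.inl ⟨.refl⟩) (Or.inr ⟨.refl⟩)
      (Q := LambdaPacking.cube) (Or.inl ⟨.refl⟩) (by simp) (by decide) hp
    exact ⟨V, N, by rw [hV]; simp, hN, ((hN.mono fun _ _ h => h.isCBP.isCubicBipartite).mem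
      LambdaPacking.isGluingClosed_isCubicBipartite).isCBP hp'.isPlanar, hN.not_hasLambdaFactor⟩
  · obtain ⟨V, G, hV, hG, h6, hn, hN, -⟩ := hfam 0
    exact ⟨V, G, hV, hG, h6, hn, hN⟩
  · rintro n ⟨V, G, rfl, -, -, -, hN⟩
    exact hN.le_card
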